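/- Let $0<\lambda_0<\lambda_1<\lambda_2<\cdots$ be real numbers, $\Lambda=\{\lambda_j\}_{j\ge 0}$, and suppose that $\Lambda$ is quasi-lacunary with blocks of length at most $N$: there are $q>1$, $N\ge 1$ and indices $0=n_0<n_1<n_2<\cdots$ with $n_{k+1}-n_k\le N$ for all $k\ge 0$ and $\lambda_{n_{k+1}}/\lambda_{n_k}>q$ for all large $k$. Suppose also that the exponents of one block are comparable, i.e. $\sup_{k\ge0}\lambda_{n_{k+1}-1}/\lambda_{n_k}<\infty$ (this is automatic if $N=1$, or if $\lambda_{n_{k+1}}/\lambda_{n_k}$ is bounded). For $\alpha>0$ and $s\ge 1$ let $M^{s}_{\Lambda,\alpha}$ be the closure in $L^s([0,1],(1-x)^{\alpha-1}\,dx)$ of the space $M_\Lambda$ of Müntz polynomials, the complex span of the monomials $t^{\lambda_j}$, $j\ge 0$. For a positive Borel measure $\mu$ on $[0,1]$ we say that the embedding $M^{s}_{\Lambda,\alpha}\hookrightarrow L^r(\mu)$ holds if the inclusion $f\mapsto f$ of $M_\Lambda$ into $L^r(\mu)$ extends to a bounded linear operator $M^{s}_{\Lambda,\alpha}\to L^r(\mu)$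 (equivalently, $\|f\|_{L^r(\mu)}\le C\|f\|_{L^s((1-x)^{\alpha-1}dx)}$ for all $f\in M_\Lambda$, with $C$ independent of $f$), and that it is compact if this operator is compact. Let $\alpha>0$, $\beta\ge1$, $p>0$, and let $\mu$ be a positive Borel measure on $[0,1]$ satisfying the condition $B_{p,\Lambda}(\alpha,\beta)$: $$\sup_{k\ge0}\ \lambda_{n_k}^{\alpha\beta}\int_{[0,1]}t^{p\lambda_{n_k}}\,d\mu(t)<\infty .$$ (i) If $pN\le\beta$, then the embedding $M^{r/\beta}_{\Lambda,\alpha}\hookrightarrow L^r(\mu)$ holds for all real $r\ge\beta$. (ii) If $pN>\beta$, then the embedding $M^{r/\beta}_{\Lambda,\alpha}\hookrightarrow L^r(\mu)$ holds for all real $r>pN$. Moreover, if $\lambda_{n_k}^{\alpha\beta}\int_{[0,1]}t^{p\lambda_{n_k}}\,d\mu(t)\to0$ as $k\to\infty$, then the embeddings in (i) and (ii) are compact. -/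

import Mathlib

open MeasureTheory Filter Topology
open scoped ENNReal

namespace Muntz

noncomputable section

/-- `Λ = (lam j)` is an increasing sequence of positive reals, cut at the indices
`0 = n 0 < n 1 < ⋯` into consecutive blocks `{lam (n k), …, lam (n (k+1) - 1)}` of at most `N`
exponents, where the extracted sequence `lam (n k)` is eventually lacunary with ratio `q > 1`. -/
structure IsQuasiLacunary (lam : ℕ → ℝ) (n : ℕ → ℕ) (N : ℕ) (q : ℝ) : Prop where
  pos : ∀ j, 0 < lam j
  strictMono : StrictMono lam
  strictMono_index : StrictMono n
  index_zero : n 0 = 0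
  block_card : ∀ k, n (k + 1) - n k ≤ N
  one_lt : 1 < q
  ratio : ∀ᶠ k in atTop, q < lam (n (k + 1)) / lam (n k)

/-- The exponents lying in one block are comparable, uniformly over the blocks. -/
def HasComparableBlocks (lam : ℕ → ℝ) (n : ℕ → ℕ) : Prop :=
  ∃ Q : ℝ, ∀ k j, n k ≤ j → j < n (k + 1) → lam j ≤ Q * lam (n k)

/-- The space of Müntz polynomials, the complex span of the monomials `t ^ lam j`. They are
functions on `ℝ`, of which only the restriction to `[0,1]` matters: all the measures below are
carried by `[0,1]`. -/
def polynomials (lam : ℕ → ℝ) : Submodule ℂ (ℝ → ℂ) :=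
  Submodule.span ℂ (Set.range fun j : ℕ => fun t : ℝ => ((t ^ lam j : ℝ) : ℂ))

/-- The measure `(1 - x) ^ (α - 1) dx` on `[0,1]`. -/
def nu (α : ℝ) : Measure ℝ :=
  (volume.restrict (Set.Icc 0 1)).withDensity fun x => ENNReal.ofReal ((1 - x) ^ (α - 1))

/-- The classes in `L^s(nu α)` of Müntz polynomials. -/
def polynomialClasses (lam : ℕ → ℝ) (α : ℝ) (s : ℝ≥0∞) : Submodule ℂ (Lp ℂ s (nu α)) where
  carrier := {g | ∃ f ∈ polynomials lam, g =ᵐ[nu α] f}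
  zero_mem' := ⟨0, Submodule.zero_mem _, Lp.coeFn_zero ℂ s (nu α)⟩
  add_mem' := by
    rintro g g' ⟨f, hf, hg⟩ ⟨f', hf', hg'⟩
    exact ⟨f + f', Submodule.add_mem _ hf hf', (Lp.coeFn_add g g').trans (hg.add hg')⟩
  smul_mem' := by
    rintro c g ⟨f, hf, hg⟩
    exact ⟨c • f, Submodule.smul_mem _ c hf, (Lp.coeFn_smul c g).trans (hg.const_smul c)⟩

/-- The Müntz space `M^s_{Λ,α}`: the closure of the Müntz polynomials in `L^s(nu α)`. -/
def space (lam : ℕ → ℝ) (α : ℝ) (s : ℝ≥0∞) [Fact (1 ≤ s)] : Submodule ℂ (Lp ℂ s (nu α)) :=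
  (polynomialClasses lam α s).topologicalClosure

/-- The bounded operator `J : M^s_{Λ,α} → L^r(μ)` is the inclusion: every Müntz polynomial `f`
belongs to `L^s(nu α)`, and `J` sends its class there to its class in `L^r(μ)`. By density of
the Müntz polynomials there is at most one such `J`. -/
def IsInclusion (lam : ℕ → ℝ) (α : ℝ) (s r : ℝ≥0∞) (μ : Measure ℝ) [Fact (1 ≤ s)] [Fact (1 ≤ r)]
    (J : space lam α s →L[ℂ] Lp ℂ r μ) : Prop :=
  ∀ f ∈ polynomials lam, ∃ g : space lam α s,
    (g : Lp ℂ s (nu α)) =ᵐ[nu α] f ∧ J g =ᵐ[μ] f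

/-- The embedding `M^{r/β}_{Λ,α} ↪ L^r(μ)` holds: both exponents are at least `1`, and the
inclusion of Müntz polynomials extends to a bounded operator. -/
def Embeds (lam : ℕ → ℝ) (α β r : ℝ) (μ : Measure ℝ) : Prop :=
  ∃ (_ : Fact (1 ≤ ENNReal.ofReal (r / β))) (_ : Fact (1 ≤ ENNReal.ofReal r))
    (J : space lam α (ENNReal.ofReal (r / β)) →L[ℂ] Lp ℂ (ENNReal.ofReal r) μ),
    IsInclusion lam α (ENNReal.ofReal (r / β)) (ENNReal.ofReal r) μ J

/-- The embedding `M^{r/β}_{Λ,α} ↪ L^r(μ)` holds and is compact. -/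
def EmbedsCompactly (lam : ℕ → ℝ) (α β r : ℝ) (μ : Measure ℝ) : Prop :=
  ∃ (_ : Fact (1 ≤ ENNReal.ofReal (r / β))) (_ : Fact (1 ≤ ENNReal.ofReal r))
    (J : space lam α (ENNReal.ofReal (r / β)) →L[ℂ] Lp ℂ (ENNReal.ofReal r) μ),
    IsInclusion lam α (ENNReal.ofReal (r / β)) (ENNReal.ofReal r) μ J ∧ IsCompactOperator J

/-- The quantity `lam (n k) ^ (α β) * ∫ t ^ (p * lam (n k)) dμ(t)`, with values in `[0,∞]`. -/
def moment (lam : ℕ → ℝ) (n : ℕ → ℕ) (p α β : ℝ) (μ : Measure ℝ) (k : ℕ) : ℝ≥0∞ :=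
  ENNReal.ofReal (lam (n k) ^ (α * β)) *
    ∫⁻ t in Set.Icc (0 : ℝ) 1, ENNReal.ofReal (t ^ (p * lam (n k))) ∂μ

/-- The condition `B_{p,Λ}(α,β)`. -/
def ConditionB (lam : ℕ → ℝ) (n : ℕ → ℕ) (p α β : ℝ) (μ : Measure ℝ) : Prop :=
  (⨆ k, moment lam n p α β μ k) < ∞

end

end Muntz

open MeasureTheory Filter Topology
open scoped ENNReal

namespace Muntz
-- With t = e^{-x}, Müntz polynomials become exponential sums f(x) = ∑ c_j e^{-λ_j x}. The exponents
-- are first regrouped (`IsQuasiLacunary.exists_separatedBlocks`) so that a fixed ratio q > 1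
-- separates the last exponent of each block from the first exponent L_k of the next. The core is
-- the extraction of a single block f_k from f (`exists_block_extraction`). Exponents above the
-- block are annihilated by operators f(x+h) - e^{-λ_i h} f(x), and those below by multipliers (z -
-- λ_i)/(z + μ_i), where μ is a lacunary majorant of λ. By partial fractions the latter product is
-- the identity plus averages of f over (x, ∞), with bounded total cost. What survives is a sum over
-- the block alone, with altered coefficients. Having boundedly many comparable exponents, it is
-- controlled on the whole line by its mean over a fixed interval. The multipliers are then inverted
-- on the block one at a time in a weighted sup norm, each at a cost whose infinite product
-- converges. The outcome is |f_k(x)| ≤ D_k e^{-θ L_k x} for x ≥ 0, for any prescribed θ between 1/q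
-- and 1, with D_k an integral of |f| against an explicit kernel. A Schur type argument
-- (`exists_sum_lintegral_rpow_le`) gives ∑ L_k^{-α} D_k^s ≤ C ‖f‖^s in L^s((1-x)^{α-1}dx). It
-- remains to bound the lacunary sum ∑ D_k t^{θ L_k} in L^r(μ), r = sβ, through the moments of μ.
-- This works when p < rθ, so θ can be found as soon as p < r (`exists_lintegral_rpow_sum_le`). The
-- only other case needed is the endpoint r = β with N = 1, where blocks are single monomials and θ
-- = 1 is allowed (`lintegral_rpow_sum_le_of_le`). For compactness the same bound is applied to f
-- minus its first blocks. Its constant involves only the later moments, so the inclusion is a norm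
-- limit of finite rank operators.
-- Lacunary sums and partial fractions.
/-- The function `min u u⁻¹` is summable along a lacunary sequence, uniformly in the sequence. -/
lemma sum_min_inv_le_of_lacunary {q : ℝ} (hq : 1 < q) {u : ℕ → ℝ} (hu : ∀ k, 0 < u k)
    (hqu : ∀ k, q * u k ≤ u (k + 1)) (n : ℕ) :
    ∑ k ∈ Finset.range n, min (u k) (u k)⁻¹ ≤ 2 / (1 - q⁻¹) := by
  have hq0 : 0 < q := by linarith
  set a := q⁻¹ with ha
  have ha1 : a < 1 := inv_lt_one_of_one_lt₀ hq
  have ha0 : 0 < a := inv_pos.2 hq0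
  have hstep : ∀ k, u k ≤ a * u (k + 1) := fun k => by
    rw [ha, inv_mul_eq_div, le_div_iff₀ hq0]; linarith [hqu k]
  have hstep' : ∀ k, (u (k + 1))⁻¹ ≤ a * (u k)⁻¹ := fun k => by
    rw [ha, ← mul_inv]
    exact inv_anti₀ (mul_pos hq0 (hu k)) (hqu k)
  have h1a : 0 < 1 - a := by linarith
  -- Multiplied by 1 - a the sum telescopes. The first alternative is the geometric growth while u
  -- stays below 1, the second the geometric decay beyond; each of the two series contributes at
  -- most 1 to the final 2.
  have key : (u n ≤ 1 → (∑ k ∈ Finset.range n, min (u k) (u k)⁻¹) * (1 - a) ≤ a * u n) ∧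
      (1 < u n → (∑ k ∈ Finset.range n, min (u k) (u k)⁻¹) * (1 - a) ≤ 2 - (u n)⁻¹) := by
    induction n with
    | zero =>
      refine ⟨fun _ => by simpa using mul_nonneg ha0.le (hu 0).le, fun h => ?_⟩
      have := inv_lt_one_of_one_lt₀ h
      simp only [Finset.range_zero, Finset.sum_empty, zero_mul]
      linarith
    | succ n ih =>
      rw [Finset.sum_range_succ, add_mul]
      have h1 := hstep n
      have h2 := hstep' n
      have h3 := hu n
      have h4 := hu (n + 1)
      have hi := inv_pos.2 h3
      rcases le_or_gt (u n) 1 with h | h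
      · have ih1 := ih.1 h
        have hm : min (u n) (u n)⁻¹ * (1 - a) ≤ u n * (1 - a) :=
          mul_le_mul_of_nonneg_right (min_le_left _ _) h1a.le
        refine ⟨fun _ => by nlinarith, fun h' => ?_⟩
        have := inv_lt_one_of_one_lt₀ h'
        nlinarith
      · have ih2 := ih.2 h
        have hm : min (u n) (u n)⁻¹ * (1 - a) ≤ (u n)⁻¹ * (1 - a) :=
          mul_le_mul_of_nonneg_right (min_le_right _ _) h1a.le
        refine ⟨fun h' => ?_, fun _ => by nlinarith⟩
        exfalso
        nlinarith
  rw [le_div_iff₀ h1a]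
  rcases le_or_gt (u n) 1 with h | h
  · nlinarith [key.1 h, hu n]
  · nlinarith [key.2 h, inv_pos.2 (hu n)]

/-- The function `min u u⁻¹ ^ g` is summable along a lacunary sequence. -/
lemma exists_sum_rpow_le_of_lacunary {q g : ℝ} (hq : 1 < q) (hg : 0 < g) :
    ∃ C : ℝ, 0 < C ∧ ∀ u : ℕ → ℝ, (∀ k, 0 < u k) → (∀ k, q * u k ≤ u (k + 1)) → ∀ n,
      ∑ k ∈ Finset.range n, min (u k ^ g) (u k ^ (-g)) ≤ C := by
  have hq0 : 0 < q := by linarith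
  have h1 : 1 < q ^ g := Real.one_lt_rpow hq hg
  refine ⟨2 / (1 - (q ^ g)⁻¹), div_pos two_pos (by linarith [inv_lt_one_of_one_lt₀ h1]),
    fun u hu hqu n => ?_⟩
  have := sum_min_inv_le_of_lacunary h1 (u := fun k => u k ^ g) (fun k => Real.rpow_pos_of_pos (hu k) g)
    (fun k => by
      rw [← Real.mul_rpow hq0.le (hu k).le]
      exact Real.rpow_le_rpow (mul_pos hq0 (hu k)).le (hqu k) hg.le) n
  simpa only [Real.rpow_neg (hu _).le] using this

lemma prod_le_exp_sum {ι : Type*} (s : Finset ι) (f g : ι → ℝ) (hf : ∀ i ∈ s, 0 ≤ f i)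
    (h : ∀ i ∈ s, f i ≤ Real.exp (g i)) : ∏ i ∈ s, f i ≤ Real.exp (∑ i ∈ s, g i) := by
  rw [Real.exp_sum]
  exact Finset.prod_le_prod hf h

lemma pow_mul_le_of_lacunary {q : ℝ} (hq : 0 ≤ q) {u : ℕ → ℝ} (hqu : ∀ k, q * u k ≤ u (k + 1))
    (i k : ℕ) : q ^ k * u i ≤ u (i + k) := by
  induction k with
  | zero => simp
  | succ k ih =>
    calc q ^ (k + 1) * u i = q * (q ^ k * u i) := by ring
      _ ≤ q * u (i + k) := mul_le_mul_of_nonneg_left ih hq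
      _ ≤ u (i + (k + 1)) := hqu _

lemma mul_le_of_lacunary_of_lt {q : ℝ} (hq : 1 < q) {u : ℕ → ℝ} (hu : ∀ k, 0 < u k)
    (hqu : ∀ k, q * u k ≤ u (k + 1)) {i j : ℕ} (hij : i < j) : q * u i ≤ u j := by
  obtain ⟨k, rfl⟩ := Nat.exists_eq_add_of_lt hij
  have := pow_mul_le_of_lacunary (by linarith) hqu i (k + 1)
  refine le_trans ?_ this
  refine mul_le_mul_of_nonneg_right ?_ (hu i).le
  calc q = q ^ 1 := (pow_one q).symm
    _ ≤ q ^ (k + 1) := pow_le_pow_right₀ hq.le (by omega)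

/-- A factor of the residue is close to `1` when its two nodes are far apart. -/
lemma add_div_abs_sub_le_exp {q a b : ℝ} (hq : 1 < q) (ha : 0 < a) (hb : 0 < b)
    (h : q * a ≤ b ∨ q * b ≤ a) :
    (a + b) / |a - b| ≤ Real.exp (2 / (1 - q⁻¹) * min (b / a) (b / a)⁻¹) := by
  wlog hab : a ≤ b generalizing a b
  · have := this hb ha h.symm (le_of_not_ge hab)
    rw [add_comm, abs_sub_comm, inv_div, min_comm] at this
    rwa [inv_div]
  have hq0 : 0 < q := by linarith
  have h1 : q * a ≤ b := by
    rcases h with h | h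
    · exact h
    · nlinarith
  have hlt : a < b := by nlinarith
  have hk : 0 < 1 - q⁻¹ := by linarith [inv_lt_one_of_one_lt₀ hq]
  have hmin : min (b / a) (b / a)⁻¹ = a / b := by
    rw [inv_div, min_eq_right]
    exact ((div_le_one hb).2 hab).trans ((one_le_div ha).2 hab)
  rw [hmin, abs_sub_comm, abs_of_pos (by linarith)]
  have h2 : a / b ≤ q⁻¹ := by
    rw [div_le_iff₀ hb, inv_mul_eq_div, le_div_iff₀ hq0]; linarith
  refine le_trans ?_ (Real.add_one_le_exp _)
  rw [div_le_iff₀ (by linarith)]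
  have h3 : (1 - q⁻¹) * b ≤ b - a := by
    have : a ≤ q⁻¹ * b := by rwa [div_le_iff₀ hb] at h2
    linarith
  have h4 : 2 / (1 - q⁻¹) * (a / b) * ((1 - q⁻¹) * b) = 2 * a := by
    rw [div_mul_eq_mul_div, div_mul_eq_mul_div, div_eq_iff hk.ne']
    field_simp
  have h5 : 2 / (1 - q⁻¹) * (a / b) * ((1 - q⁻¹) * b) ≤ 2 / (1 - q⁻¹) * (a / b) * (b - a) :=
    mul_le_mul_of_nonneg_left h3 (by positivity)
  linarith

/-- Partial fractions of a product of Blaschke type with lacunary poles. -/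
lemma exists_partial_fractions {q : ℝ} (hq : 1 < q) :
    ∃ C : ℝ, 0 < C ∧ ∀ lam mu : ℕ → ℝ, (∀ j, 0 ≤ lam j) → (∀ j, lam j ≤ mu j) → (∀ j, 0 < mu j) →
      (∀ j, q * mu j ≤ mu (j + 1)) → ∀ n, ∃ c : ℕ → ℝ, (∀ i < n, |c i| ≤ C * mu i) ∧
      ∀ z, 0 ≤ z → ∏ i ∈ Finset.range n, (z - lam i) / (z + mu i) =
        1 + ∑ i ∈ Finset.range n, c i / (z + mu i) := by
  have hk : 0 < 1 - q⁻¹ := by linarith [inv_lt_one_of_one_lt₀ hq]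
  set K := 2 / (1 - q⁻¹) with hK
  have hKpos : 0 < K := by positivity
  refine ⟨2 * Real.exp (K * K), by positivity, fun lam mu hlam hle hmu hqmu n => ?_⟩
  -- The difference ∏ (z - λ_i) - ∏ (z + μ_i) of two monic polynomials has degree less than n, so it
  -- equals its Lagrange interpolant at the poles -μ_i, where the second product vanishes. Dividing
  -- by ∏ (z + μ_i) gives the partial fractions.
  set s := Finset.range n
  set v : ℕ → ℝ := fun i => -mu i with hv
  set r : ℕ → ℝ := fun i => ∏ j ∈ s, (-mu i - lam j) with hr
  have hsep : ∀ i j, i ≠ j → q * mu i ≤ mu j ∨ q * mu j ≤ mu i := fun i j hij => by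
    rcases lt_or_gt_of_ne hij with h | h
    · exact Or.inl (mul_le_of_lacunary_of_lt hq hmu hqmu h)
    · exact Or.inr (mul_le_of_lacunary_of_lt hq hmu hqmu h)
  have hne : ∀ i j, i ≠ j → mu i ≠ mu j := fun i j hij h => by
    rcases hsep i j hij with h' | h' <;> nlinarith [hmu i, hmu j]
  have hinj : Set.InjOn v s := fun i _ j _ h => by
    by_contra hij
    exact hne i j hij (neg_injective h)
  refine ⟨fun i => Lagrange.nodalWeight s v i * r i, fun i hi => ?_, fun z hz => ?_⟩
  · have hi' : i ∈ s := Finset.mem_range.2 hi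
    have e1 : Lagrange.nodalWeight s v i * r i =
        (-mu i - lam i) * ∏ j ∈ s.erase i, ((-mu i - lam j) / (mu j - mu i)) := by
      rw [Lagrange.nodalWeight, hr]
      simp only
      rw [← Finset.mul_prod_erase s _ hi', mul_left_comm, ← Finset.prod_mul_distrib]
      congr 1
      refine Finset.prod_congr rfl fun j _ => ?_
      rw [hv]
      simp only
      rw [div_eq_mul_inv, mul_comm]
      congr 2
      ring
    simp only [e1]
    rw [abs_mul, Finset.abs_prod]
    have h1 : |(-mu i - lam i)| ≤ 2 * mu i := by
      rw [abs_le]; constructor <;> linarith [hle i, hlam i, hmu i]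
    -- Since λ_j ≤ μ_j, each factor is at most (μ_i + μ_j)/|μ_i - μ_j|, which lacunarity of μ alone
    -- makes close to 1; λ itself may cluster. This keeps the residues bounded by C μ_i uniformly in
    -- n.
    have h2 : ∏ j ∈ s.erase i, |(-mu i - lam j) / (mu j - mu i)| ≤ Real.exp (K * K) := by
      have h3 : ∏ j ∈ s.erase i, |(-mu i - lam j) / (mu j - mu i)| ≤
          Real.exp (∑ j ∈ s.erase i, K * min (mu j / mu i) (mu j / mu i)⁻¹) := by
        refine prod_le_exp_sum _ _ _ (fun _ _ => abs_nonneg _) fun j hj => ?_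
        have hji : j ≠ i := Finset.ne_of_mem_erase hj
        refine le_trans ?_ (add_div_abs_sub_le_exp hq (hmu i) (hmu j) (hsep i j hji.symm))
        rw [abs_div, abs_sub_comm (mu j)]
        refine div_le_div_of_nonneg_right ?_ (abs_nonneg _)
        rw [abs_le]; constructor <;> linarith [hle j, hlam j, hmu i, hmu j]
      refine h3.trans (Real.exp_le_exp.2 ?_)
      rw [← Finset.mul_sum]
      refine mul_le_mul_of_nonneg_left ?_ hKpos.le
      refine le_trans (Finset.sum_le_sum_of_subset_of_nonneg (Finset.erase_subset i s)
        fun j _ _ => ?_) (sum_min_inv_le_of_lacunary hq (u := fun j => mu j / mu i)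
          (fun j => div_pos (hmu j) (hmu i)) (fun j => ?_) n)
      · have := div_pos (hmu j) (hmu i)
        positivity
      · rw [← mul_div_assoc]
        exact div_le_div_of_nonneg_right (hqmu j) (hmu i).le
    calc |(-mu i - lam i)| * ∏ j ∈ s.erase i, |(-mu i - lam j) / (mu j - mu i)|
        ≤ (2 * mu i) * Real.exp (K * K) :=
          mul_le_mul h1 h2 (Finset.prod_nonneg fun _ _ => abs_nonneg _) (by linarith [hmu i])
      _ = _ := by ring
  · have hzne : ∀ i ∈ s, z ≠ v i := fun i _ h => by
      have := hmu i
      simp only [hv] at h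
      linarith
    have hdeg : (Lagrange.nodal s lam - Lagrange.nodal s v).degree < s.card := by
      rcases Nat.eq_zero_or_pos n with h0 | h0
      · have hs : s = ∅ := by simp [s, h0]
        simp [hs]
      · refine lt_of_lt_of_eq (Polynomial.degree_sub_lt_left ?_ (Lagrange.nodal_ne_zero) ?_)
          Lagrange.degree_nodal
        · rw [Lagrange.degree_nodal, Lagrange.degree_nodal]
        · rw [Lagrange.nodal_monic.leadingCoeff, Lagrange.nodal_monic.leadingCoeff]
    have hint : Lagrange.nodal s lam - Lagrange.nodal s v = Lagrange.interpolate s v r := by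
      refine Lagrange.eq_interpolate_of_eval_eq r hinj hdeg fun i hi => ?_
      rw [Polynomial.eval_sub, Lagrange.eval_nodal_at_node hi, sub_zero, Lagrange.eval_nodal]
    have heval := congrArg (Polynomial.eval z) hint
    rw [Lagrange.eval_interpolate_not_at_node r hzne, Polynomial.eval_sub, Lagrange.eval_nodal,
      Lagrange.eval_nodal] at heval
    have hpos : (∏ i ∈ s, (z - v i)) ≠ 0 := Finset.prod_ne_zero_iff.2 fun i hi =>
      sub_ne_zero.2 (hzne i hi)
    have hv' : ∀ i, z - v i = z + mu i := fun i => by simp [hv]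
    rw [Finset.prod_div_distrib]
    simp only [hv'] at heval hpos
    rw [div_eq_iff hpos, add_mul, one_mul, mul_comm (Finset.sum _ _)]
    rw [sub_eq_iff_eq_add'] at heval
    rw [heval]
    congr 2
    refine Finset.sum_congr rfl fun i _ => ?_
    rw [div_eq_mul_inv]; ring

/-! ### Exponential sums with boundedly many comparable exponents. -/

/-- The exponential sum `∑ c j * exp (-lam j * x)`: a Müntz polynomial in the variable
`x = -log t`. -/
noncomputable def expSum (S : Finset ℕ) (lam : ℕ → ℝ) (c : ℕ → ℂ) (x : ℝ) : ℂ :=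
  ∑ j ∈ S, c j * (Real.exp (-(lam j * x)) : ℂ)

lemma continuous_expSum (S : Finset ℕ) (lam : ℕ → ℝ) (c : ℕ → ℂ) : Continuous (expSum S lam c) := by
  unfold expSum
  fun_prop

/-- With a equal to one of the exponents, this combination of two values of the sum annihilates that
exponent and merely rescales the other coefficients. -/
lemma expSum_shift_sub (S : Finset ℕ) (lam : ℕ → ℝ) (c : ℕ → ℂ) (a h x : ℝ) :
    expSum S lam c (x + h) - (Real.exp (-(a * h)) : ℂ) * expSum S lam c x =
      expSum S lam (fun j => ((Real.exp (-(lam j * h)) - Real.exp (-(a * h)) : ℝ) : ℂ) * c j) x := by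
  unfold expSum
  rw [Finset.mul_sum, ← Finset.sum_sub_distrib]
  refine Finset.sum_congr rfl fun j _ => ?_
  rw [mul_add, neg_add, Real.exp_add]
  push_cast
  ring

lemma expSum_erase {S : Finset ℕ} {lam : ℕ → ℝ} {c : ℕ → ℂ} {i : ℕ} (h : c i = 0) (x : ℝ) :
    expSum (S.erase i) lam c x = expSum S lam c x := by
  unfold expSum
  exact Finset.sum_erase S (by rw [h, zero_mul])

lemma exp_gap_forward {θ h : ℝ} (hθ : θ < 1) (hh : 1 ≤ h) (hh2 : h ≤ 2) :
    Real.exp (-2) * (1 - θ) ≤ Real.exp (-(θ * h)) - Real.exp (-h) := by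
  have h1 : Real.exp (-(θ * h)) = Real.exp (-h) * Real.exp ((1 - θ) * h) := by
    rw [← Real.exp_add]; congr 1; ring
  have h2 := Real.add_one_le_exp ((1 - θ) * h)
  have h3 : Real.exp (-2) ≤ Real.exp (-h) := Real.exp_le_exp.2 (by linarith)
  have h4 : (1 - θ) ≤ (1 - θ) * h := by nlinarith
  rw [h1]
  calc Real.exp (-2) * (1 - θ) ≤ Real.exp (-h) * (Real.exp ((1 - θ) * h) - 1) :=
        mul_le_mul h3 (by linarith) (by linarith) (Real.exp_pos _).le
    _ = _ := by ring

/-- A step to the left multiplies an exponent at most l by at most e^{lh}. Allowing the growth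
e^{σlh} leaves a gap proportional to σ - 1, and a large C makes this gap pay for the forcing term in
the induction of `exists_node_bound`. -/
lemma exp_gap_backward {σ Q C C' l h : ℝ} (h1 : 2 * C' * Real.exp (σ * Q * 2) / (σ - 1) ≤ C)
    (hC' : 0 ≤ C') (hC : 0 ≤ C) (hσ : 1 < σ) (hl : 1 ≤ l) (hlQ : l ≤ Q) (hh : 1 ≤ h)
    (hh2 : h ≤ 2) :
    2 * C' * Real.exp (σ * l * h) * Real.exp (l * h) ≤
      C * (Real.exp (σ * l * h) - Real.exp (l * h)) := by
  have hgap : Real.exp (l * h) * (σ - 1) ≤ Real.exp (σ * l * h) - Real.exp (l * h) := by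
    have h1 : Real.exp (σ * l * h) = Real.exp (l * h) * Real.exp ((σ - 1) * (l * h)) := by
      rw [← Real.exp_add]; congr 1; ring
    have h2 := Real.add_one_le_exp ((σ - 1) * (l * h))
    have h4 : 1 ≤ l * h := one_le_mul_of_one_le_of_one_le hl hh
    have h5 : (σ - 1) ≤ (σ - 1) * (l * h) := le_mul_of_one_le_right (by linarith) h4
    rw [h1]
    calc Real.exp (l * h) * (σ - 1) ≤ Real.exp (l * h) * (Real.exp ((σ - 1) * (l * h)) - 1) :=
          mul_le_mul_of_nonneg_left (by linarith) (Real.exp_pos _).le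
      _ = _ := by ring
  rw [div_le_iff₀ (by linarith)] at h1
  have h2 : Real.exp (σ * l * h) ≤ Real.exp (σ * Q * 2) := by
    refine Real.exp_le_exp.2 (mul_le_mul (mul_le_mul_of_nonneg_left hlQ (by linarith)) hh2
      (by linarith) ?_)
    have : 0 ≤ Q := by linarith
    positivity
  calc 2 * C' * Real.exp (σ * l * h) * Real.exp (l * h)
      ≤ 2 * C' * Real.exp (σ * Q * 2) * Real.exp (l * h) := by gcongr
    _ ≤ C * (σ - 1) * Real.exp (l * h) := by gcongr
    _ = C * (Real.exp (l * h) * (σ - 1)) := by ring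
    _ ≤ _ := mul_le_mul_of_nonneg_left hgap hC

/-- Values of an exponential sum on an arithmetic progression are controlled by as many consecutive
ones as there are exponents. -/
lemma exists_node_bound {θ σ Q : ℝ} (hθ : θ < 1) (hσ : 1 < σ) (n : ℕ) :
    ∃ C : ℝ, 1 ≤ C ∧ ∀ (S : Finset ℕ) (lam : ℕ → ℝ) (c : ℕ → ℂ) (l h x : ℝ), S.card ≤ n →
      (∀ j ∈ S, 1 ≤ lam j ∧ lam j ≤ l) → 1 ≤ l → l ≤ Q → 1 ≤ h → h ≤ 2 → ∀ i : ℕ,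
      ‖expSum S lam c (x + i * h)‖ ≤
        C * Real.exp (-(θ * h * i)) * ∑ m ∈ Finset.range n, ‖expSum S lam c (x + m * h)‖ ∧
      ‖expSum S lam c (x - i * h)‖ ≤
        C * Real.exp (σ * l * h * i) * ∑ m ∈ Finset.range n, ‖expSum S lam c (x + m * h)‖ := by
  induction n with
  | zero =>
    refine ⟨1, le_rfl, fun S lam c l h x hS _ _ _ _ _ i => ?_⟩
    rw [Nat.le_zero, Finset.card_eq_zero] at hS
    subst hS
    simp [expSum]
  | succ n ih =>
    obtain ⟨C', hC', ih⟩ := ih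
    set g := Real.exp (-2) * (1 - θ) with hg
    have hg0 : 0 < g := mul_pos (Real.exp_pos _) (by linarith)
    have hs0 : 0 < σ - 1 := by linarith
    -- The two quotients are what the forward and the backward recurrences require; the 1 covers the
    -- starting value.
    set C := 1 + 2 * C' / g + 2 * C' * Real.exp (σ * Q * 2) / (σ - 1) with hC
    have p1 : 0 ≤ 2 * C' / g := by positivity
    have p2 : 0 ≤ 2 * C' * Real.exp (σ * Q * 2) / (σ - 1) := by positivity
    have hC1 : 1 ≤ C := by linarith
    refine ⟨C, hC1, fun S lam c l h x hS hlam hl hlQ hh hh2 => ?_⟩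
    rcases S.eq_empty_or_nonempty with rfl | ⟨j, hj⟩
    · intro i
      simp [expSum]
    set φ := expSum S lam c with hφ
    set A := ∑ m ∈ Finset.range (n + 1), ‖φ (x + m * h)‖ with hA
    have hA0 : 0 ≤ A := Finset.sum_nonneg fun _ _ => norm_nonneg _
    have hxA : ‖φ x‖ ≤ A := by
      have := Finset.single_le_sum (f := fun m : ℕ => ‖φ (x + m * h)‖)
        (fun _ _ => norm_nonneg _) (Finset.mem_range.2 (Nat.succ_pos n))
      simpa using this
    -- Subtracting a multiple of the shifted sum removes the exponent λ_j, so ψ falls under the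
    -- induction hypothesis. The relation `hrel` is then a first order recurrence for φ with forcing
    -- ψ, solved to the right and to the left.
    set c' : ℕ → ℂ := fun i =>
      ((Real.exp (-(lam i * h)) - Real.exp (-(lam j * h)) : ℝ) : ℂ) * c i with hc'
    set ψ := expSum (S.erase j) lam c' with hψ
    have hrel : ∀ y, φ (y + h) = (Real.exp (-(lam j * h)) : ℂ) * φ y + ψ y := fun y => by
      rw [hψ, expSum_erase (by simp [hc']), ← expSum_shift_sub]
      ring
    obtain ⟨hlj1, hljl⟩ := hlam j hj
    have he1 : ‖(Real.exp (-(lam j * h)) : ℂ)‖ = Real.exp (-(lam j * h)) := by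
      rw [Complex.norm_real, Real.norm_of_nonneg (Real.exp_pos _).le]
    have hle1 : Real.exp (-(lam j * h)) ≤ Real.exp (-h) := Real.exp_le_exp.2 (by nlinarith)
    have hB : ∑ m ∈ Finset.range n, ‖ψ (x + m * h)‖ ≤ 2 * A := by
      have h1 : ∀ m ∈ Finset.range n, ‖ψ (x + m * h)‖ ≤
          ‖φ (x + (m + 1 : ℕ) * h)‖ + ‖φ (x + m * h)‖ := fun m _ => by
        have : ψ (x + m * h) = φ (x + (m + 1 : ℕ) * h) -
            (Real.exp (-(lam j * h)) : ℂ) * φ (x + m * h) := by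
          rw [eq_sub_iff_add_eq', ← hrel]
          congr 1
          push_cast
          ring
        rw [this]
        refine (norm_sub_le _ _).trans (add_le_add_right ?_ _)
        rw [norm_mul, he1]
        refine mul_le_of_le_one_left (norm_nonneg _) (hle1.trans ?_)
        rw [← Real.exp_zero]
        exact Real.exp_le_exp.2 (by linarith)
      refine (Finset.sum_le_sum h1).trans ?_
      rw [Finset.sum_add_distrib, two_mul]
      refine add_le_add ?_ ?_
      · rw [hA, Finset.sum_range_succ']
        exact le_add_of_nonneg_right (norm_nonneg _)
      · rw [hA, Finset.sum_range_succ]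
        exact le_add_of_nonneg_right (norm_nonneg _)
    have hcard : (S.erase j).card ≤ n := by
      rw [Finset.card_erase_of_mem hj]; omega
    have hψb := ih (S.erase j) lam c' l h x hcard (fun i hi => hlam i (Finset.mem_of_mem_erase hi))
      hl hlQ hh hh2
    have hC0 : 0 ≤ C' := by linarith
    intro i
    constructor
    · induction i with
      | zero => simpa using hxA.trans (le_mul_of_one_le_left hA0 hC1)
      | succ i IH =>
        have e : x + (i + 1 : ℕ) * h = (x + i * h) + h := by push_cast; ring
        have hgap : g ≤ Real.exp (-(θ * h)) - Real.exp (-h) := exp_gap_forward hθ hh hh2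
        have hE : Real.exp (-(θ * h * (i + 1 : ℕ))) =
            Real.exp (-(θ * h * i)) * Real.exp (-(θ * h)) := by
          rw [← Real.exp_add]; congr 1; push_cast; ring
        have hCg : 2 * C' ≤ C * (Real.exp (-(θ * h)) - Real.exp (-h)) := by
          have : 2 * C' / g ≤ C := by linarith
          rw [div_le_iff₀ hg0] at this
          exact this.trans (mul_le_mul_of_nonneg_left hgap (by linarith))
        have hψi := (hψb i).1.trans (mul_le_mul_of_nonneg_left hB (by positivity))
        rw [e, hrel]
        refine (norm_add_le _ _).trans ?_
        rw [norm_mul, he1, hE]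
        set E := Real.exp (-(θ * h * i))
        have hE0 : 0 < E := Real.exp_pos _
        have t1 : Real.exp (-(lam j * h)) * ‖φ (x + i * h)‖ ≤ Real.exp (-h) * (C * E * A) :=
          mul_le_mul hle1 IH (norm_nonneg _) (Real.exp_pos _).le
        have t2 : 2 * C' * (E * A) ≤ C * (Real.exp (-(θ * h)) - Real.exp (-h)) * (E * A) :=
          mul_le_mul_of_nonneg_right hCg (by positivity)
        linarith
    · induction i with
      | zero => simpa using hxA.trans (le_mul_of_one_le_left hA0 hC1)
      | succ i IH =>
        have e : x - i * h = (x - (i + 1 : ℕ) * h) + h := by push_cast; ring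
        have hE : Real.exp (σ * l * h * (i + 1 : ℕ)) =
            Real.exp (σ * l * h * i) * Real.exp (σ * l * h) := by
          rw [← Real.exp_add]; congr 1; push_cast; ring
        have hψi := (hψb (i + 1)).2.trans (mul_le_mul_of_nonneg_left hB (by positivity))
        have hφ1 : φ (x - (i + 1 : ℕ) * h) = (Real.exp (lam j * h) : ℂ) *
            (φ (x - i * h) - ψ (x - (i + 1 : ℕ) * h)) := by
          rw [e, hrel, add_sub_cancel_right, ← mul_assoc, ← Complex.ofReal_mul, ← Real.exp_add]
          simp
        have he2 : ‖(Real.exp (lam j * h) : ℂ)‖ ≤ Real.exp (l * h) := by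
          rw [Complex.norm_real, Real.norm_of_nonneg (Real.exp_pos _).le]
          exact Real.exp_le_exp.2 (by nlinarith)
        have hCg := exp_gap_backward (by linarith : 2 * C' * Real.exp (σ * Q * 2) / (σ - 1) ≤ C)
          hC0 (by linarith) hσ hl hlQ hh hh2
        rw [hφ1, norm_mul]
        rw [hE] at hψi ⊢
        set E := Real.exp (σ * l * h * i)
        have hE0 : 0 < E := Real.exp_pos _
        have t0 : ‖φ (x - i * h) - ψ (x - (i + 1 : ℕ) * h)‖ ≤
            C * E * A + C' * (E * Real.exp (σ * l * h)) * (2 * A) :=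
          (norm_sub_le _ _).trans (add_le_add IH hψi)
        have t1 := mul_le_mul he2 t0 (norm_nonneg _) (Real.exp_pos _).le
        have t2 := mul_le_mul_of_nonneg_right hCg (mul_nonneg hE0.le hA0)
        refine t1.trans ?_
        linarith

/-- The weight `exp (-θ x) + exp (-Θ x)`. -/
noncomputable def weight (θ Θ x : ℝ) : ℝ := Real.exp (-(θ * x)) + Real.exp (-(Θ * x))

lemma weight_pos (θ Θ x : ℝ) : 0 < weight θ Θ x := by unfold weight; positivity

/-- The weight lives on the whole line: θ lies below all exponents of the block and governs +∞, Θ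
lies above them and governs -∞. A shift to the right gains e^{-θy}, and by the companion lemma a
shift to the left costs e^{Θy}; these are the operator norms used to invert multipliers. -/
lemma weight_add_le {θ Θ y : ℝ} (h : θ ≤ Θ) (hy : 0 ≤ y) (x : ℝ) :
    weight θ Θ (x + y) ≤ Real.exp (-(θ * y)) * weight θ Θ x := by
  unfold weight
  rw [mul_add, mul_add, neg_add, neg_add, Real.exp_add, Real.exp_add, mul_add,
    mul_comm (Real.exp (-(θ * y))), mul_comm (Real.exp (-(θ * y)))]
  have : Real.exp (-(Θ * y)) ≤ Real.exp (-(θ * y)) := Real.exp_le_exp.2 (by nlinarith)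
  have := Real.exp_pos (-(Θ * x))
  gcongr

lemma weight_sub_le {θ Θ y : ℝ} (h : θ ≤ Θ) (hy : 0 ≤ y) (x : ℝ) :
    weight θ Θ (x - y) ≤ Real.exp (Θ * y) * weight θ Θ x := by
  unfold weight
  have e1 : -(θ * (x - y)) = θ * y + -(θ * x) := by ring
  have e2 : -(Θ * (x - y)) = Θ * y + -(Θ * x) := by ring
  rw [e1, e2, Real.exp_add, Real.exp_add, mul_add]
  have : Real.exp (θ * y) ≤ Real.exp (Θ * y) := Real.exp_le_exp.2 (by nlinarith)
  have := Real.exp_pos (-(θ * x))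
  gcongr

/-- An exponential sum with comparable exponents is controlled everywhere by its mean over a fixed
interval. -/
lemma exists_weight_bound {θ σ Q : ℝ} (hθ0 : 0 < θ) (hθ : θ < 1) (hσ : 1 < σ) (n : ℕ) :
    ∃ C R : ℝ, 0 < C ∧ 1 ≤ R ∧ ∀ (S : Finset ℕ) (lam : ℕ → ℝ) (c : ℕ → ℂ) (l : ℝ), S.card ≤ n →
      (∀ j ∈ S, 1 ≤ lam j ∧ lam j ≤ l) → 1 ≤ l → l ≤ Q → ∀ x,
      ‖expSum S lam c x‖ ≤ C * weight θ (σ * l) x * ∫ y in (1 : ℝ)..R, ‖expSum S lam c y‖ := by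
  obtain ⟨C, hC, H⟩ := exists_node_bound (Q := Q) hθ hσ n
  set K := C * Real.exp (σ * Q * 2) with hK
  have hC0 : 0 < C := by linarith
  refine ⟨C * Real.exp (θ + σ * Q) * (n * (K * n)) + 1, 3 * n + 1, by positivity,
    by linarith [Nat.cast_nonneg (α := ℝ) n], fun S lam c l hS hlam hl hlQ => ?_⟩
  set φ := expSum S lam c with hφ
  have hcont : Continuous fun y => ‖φ y‖ := (continuous_expSum S lam c).norm
  have hQ : 1 ≤ Q := hl.trans hlQ
  have hint : ∀ a b, IntervalIntegrable (fun y => ‖φ y‖) volume a b := fun a b =>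
    hcont.intervalIntegrable a b
  have hI0 : ∀ {a b : ℝ}, a ≤ b → 0 ≤ ∫ y in a..b, ‖φ y‖ := fun hab =>
    intervalIntegral.integral_nonneg hab fun _ _ => norm_nonneg _
  have hmono : ∀ {a b a' b' : ℝ}, a' ≤ a → a ≤ b → b ≤ b' →
      ∫ y in a..b, ‖φ y‖ ≤ ∫ y in a'..b', ‖φ y‖ := fun h1 h2 h3 =>
    intervalIntegral.integral_mono_interval h1 h2 h3
      (Filter.Eventually.of_forall fun _ => norm_nonneg _) (hint _ _)
  -- One step h back from x + h bounds φ(x) by its values at x + (m+1)h. Averaging over h in [1,2]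
  -- turns these values into integrals, which is why the step in `exists_node_bound` is allowed to
  -- vary.
  have hloc : ∀ x, ‖φ x‖ ≤ K * n * ∫ y in (x + 1)..(x + 2 * n), ‖φ y‖ := by
    intro x
    rcases Nat.eq_zero_or_pos n with h0 | h0
    · have : S = ∅ := by rw [← Finset.card_eq_zero]; omega
      simp [hφ, this, expSum, h0]
    have hn : (1 : ℝ) ≤ n := by exact_mod_cast h0
    have h1 : ∀ h ∈ Set.Icc (1 : ℝ) 2, ‖φ x‖ ≤
        K * ∑ m ∈ Finset.range n, ‖φ (x + ((m : ℝ) + 1) * h)‖ := fun h hh => by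
      have := (H S lam c l h (x + h) hS hlam hl hlQ hh.1 hh.2 1).2
      rw [Nat.cast_one, one_mul, mul_one, add_sub_cancel_right] at this
      refine this.trans ?_
      refine mul_le_mul ?_ (le_of_eq (Finset.sum_congr rfl fun m _ => ?_))
        (Finset.sum_nonneg fun _ _ => norm_nonneg _) (by positivity)
      · rw [hK]
        refine mul_le_mul_of_nonneg_left (Real.exp_le_exp.2 ?_) hC0.le
        exact mul_le_mul (mul_le_mul_of_nonneg_left hlQ (by linarith)) hh.2 (by linarith [hh.1])
          (by positivity)
      · congr 2; ring
    have h2 : ∫ _ in (1 : ℝ)..2, ‖φ x‖ ≤ ∫ h in (1 : ℝ)..2,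
        K * ∑ m ∈ Finset.range n, ‖φ (x + ((m : ℝ) + 1) * h)‖ := by
      refine intervalIntegral.integral_mono_on (by norm_num) (by simp) ?_ h1
      refine Continuous.intervalIntegrable ?_ _ _
      refine continuous_const.mul (continuous_finsetSum _ fun m _ => ?_)
      exact hcont.comp (by fun_prop)
    rw [intervalIntegral.integral_const, intervalIntegral.integral_const_mul,
      intervalIntegral.integral_finsetSum] at h2
    swap
    · intro m _
      exact (hcont.comp (by fun_prop : Continuous fun h : ℝ => x + ((m : ℝ) + 1) * h)).intervalIntegrable _ _
    have h3 : ∀ m ∈ Finset.range n, ∫ h in (1 : ℝ)..2, ‖φ (x + ((m : ℝ) + 1) * h)‖ ≤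
        ∫ y in (x + 1)..(x + 2 * n), ‖φ y‖ := fun m hm => by
      have hm1 : (1 : ℝ) ≤ m + 1 := by linarith [Nat.cast_nonneg (α := ℝ) m]
      have hmn : (m : ℝ) + 1 ≤ n := by exact_mod_cast Finset.mem_range.1 hm
      rw [intervalIntegral.integral_comp_add_mul (fun y => ‖φ y‖) (by linarith : (m : ℝ) + 1 ≠ 0) x,
        smul_eq_mul]
      refine (mul_le_of_le_one_left (hI0 (by linarith)) (inv_le_one_of_one_le₀ hm1)).trans ?_
      exact hmono (by linarith) (by linarith) (by linarith)
    have h4 := Finset.sum_le_sum h3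
    rw [Finset.sum_const, Finset.card_range, nsmul_eq_mul] at h4
    have h5 : (2 - 1 : ℝ) • ‖φ x‖ = ‖φ x‖ := by norm_num
    rw [h5] at h2
    refine h2.trans ?_
    rw [mul_assoc K]
    exact mul_le_mul_of_nonneg_left h4 (by positivity)
  intro x
  set I := ∫ y in (1 : ℝ)..(3 * n + 1), ‖φ y‖ with hI
  have hI0' : 0 ≤ I := hI0 (by linarith [Nat.cast_nonneg (α := ℝ) n])
  -- The nodes y, y+1, …, y+n-1 lie in [0,n), so their local means are taken inside [1, 3n+1]; the
  -- point x is reached from y by unit steps.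
  set y := Int.fract x with hy
  have hy0 : 0 ≤ y := Int.fract_nonneg x
  have hy1 : y < 1 := Int.fract_lt_one x
  have hnodes : ∑ m ∈ Finset.range n, ‖φ (y + m * 1)‖ ≤ n * (K * n) * I := by
    have : ∀ m ∈ Finset.range n, ‖φ (y + m * 1)‖ ≤ K * n * I := fun m hm => by
      refine (hloc _).trans (mul_le_mul_of_nonneg_left ?_ (by positivity))
      have hmn : (m : ℝ) + 1 ≤ n := by exact_mod_cast Finset.mem_range.1 hm
      have hm0 := Nat.cast_nonneg (α := ℝ) m
      exact hmono (by linarith) (by linarith) (by linarith)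
    refine (Finset.sum_le_sum this).trans (le_of_eq ?_)
    rw [Finset.sum_const, Finset.card_range, nsmul_eq_mul]
    ring
  have hN0 : 0 ≤ n * (K * n) * I := by positivity
  have main : ‖φ x‖ ≤ C * (Real.exp (θ + σ * Q) * weight θ (σ * l) x) * (n * (K * n) * I) := by
    have hxy : x = y + ⌊x⌋ := (Int.fract_add_floor x).symm
    have hσl : 0 < σ * l := by positivity
    have hσlQ : σ * l ≤ σ * Q := mul_le_mul_of_nonneg_left hlQ (by linarith)
    rcases le_or_gt 0 ⌊x⌋ with hf | hf
    · obtain ⟨i, hi⟩ := Int.eq_ofNat_of_zero_le hf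
      rw [hi, Int.cast_natCast] at hxy
      have h1 := (H S lam c l 1 y hS hlam hl hlQ le_rfl one_le_two i).1
      rw [mul_one, ← hxy, ← hφ] at h1
      refine h1.trans (mul_le_mul (mul_le_mul_of_nonneg_left ?_ hC0.le) hnodes
        (Finset.sum_nonneg fun _ _ => norm_nonneg _) ?_)
      · have h2 : Real.exp (-(θ * 1 * i)) ≤ Real.exp (θ + σ * Q) * Real.exp (-(θ * x)) := by
          rw [← Real.exp_add]
          refine Real.exp_le_exp.2 ?_
          rw [hxy]
          have : 0 ≤ σ * Q := by linarith
          nlinarith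
        refine h2.trans (mul_le_mul_of_nonneg_left ?_ (Real.exp_pos _).le)
        exact le_add_of_nonneg_right (Real.exp_pos _).le
      · have := weight_pos θ (σ * l) x
        positivity
    · obtain ⟨i, hi⟩ := Int.eq_ofNat_of_zero_le (neg_nonneg.2 hf.le)
      have hi' : (⌊x⌋ : ℝ) = -(i : ℝ) := by
        have : ⌊x⌋ = -(i : ℤ) := by simp [← hi]
        rw [this]; push_cast; rfl
      rw [hi', ← sub_eq_add_neg] at hxy
      have h1 := (H S lam c l 1 y hS hlam hl hlQ le_rfl one_le_two i).2
      rw [mul_one, ← hxy, ← hφ] at h1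
      refine h1.trans (mul_le_mul (mul_le_mul_of_nonneg_left ?_ hC0.le) hnodes
        (Finset.sum_nonneg fun _ _ => norm_nonneg _) ?_)
      · have h2 : Real.exp (σ * l * 1 * i) ≤ Real.exp (θ + σ * Q) * Real.exp (-(σ * l * x)) := by
          rw [← Real.exp_add]
          refine Real.exp_le_exp.2 ?_
          rw [hxy]
          nlinarith
        refine h2.trans (mul_le_mul_of_nonneg_left ?_ (Real.exp_pos _).le)
        exact le_add_of_nonneg_left (Real.exp_pos _).le
      · have := weight_pos θ (σ * l) x
        positivity
  refine main.trans ?_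
  have hw := weight_pos θ (σ * l) x
  have : 0 ≤ weight θ (σ * l) x * I := by positivity
  calc _ = C * Real.exp (θ + σ * Q) * (n * (K * n)) * (weight θ (σ * l) x * I) := by ring
    _ ≤ (C * Real.exp (θ + σ * Q) * (n * (K * n)) + 1) * (weight θ (σ * l) x * I) := by gcongr; linarith
    _ = _ := by ring

/-! ### Inverting the multipliers in the weighted sup norm. -/

/-- A bound that improves itself by a factor `ε < 1` can be absorbed. -/
lemma le_div_of_absorb {f W : ℝ → ℝ} (hW : ∀ x, 0 < W x) (hf : ∀ x, 0 ≤ f x)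
    (h0 : ∃ A, ∀ x, f x ≤ A * W x) {B ε : ℝ} (hε : ε < 1)
    (h : ∀ A, 0 ≤ A → (∀ x, f x ≤ A * W x) → ∀ x, f x ≤ (B + ε * A) * W x) (x : ℝ) :
    f x ≤ B / (1 - ε) * W x := by
  obtain ⟨A₀, h0⟩ := h0
  -- The a priori bound `h0` makes the best constant A finite, so that A ≤ B + εA can be solved for
  -- A.
  set A := ⨆ x, f x / W x with hA
  have hbdd : BddAbove (Set.range fun x => f x / W x) :=
    ⟨A₀, by rintro _ ⟨x, rfl⟩; exact (div_le_iff₀ (hW x)).2 (h0 x)⟩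
  have h1 : ∀ x, f x ≤ A * W x := fun x => (div_le_iff₀ (hW x)).1 (le_ciSup hbdd x)
  have hA0 : 0 ≤ A := (div_nonneg (hf 0) (hW 0).le).trans (le_ciSup hbdd 0)
  have h2 : A ≤ B + ε * A := ciSup_le fun x => (div_le_iff₀ (hW x)).2 (h A hA0 h1 x)
  refine (h1 x).trans (mul_le_mul_of_nonneg_right ?_ (hW x).le)
  rw [le_div_iff₀ (by linarith)]
  linarith

/-- Inverting the translation multiplier which annihilates an exponent above the block. -/
lemma norm_expSum_le_of_shift {S : Finset ℕ} {lam : ℕ → ℝ} {θ Θ a h : ℝ} (hθ : θ ≤ Θ) (ha : Θ < a)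
    (hh : 0 < h) {c : ℕ → ℂ} {B : ℝ}
    (h0 : ∃ A, ∀ x, ‖expSum S lam c x‖ ≤ A * weight θ Θ x)
    (hB : ∀ x, ‖expSum S lam
      (fun j => ((Real.exp (-(lam j * h)) - Real.exp (-(a * h)) : ℝ) : ℂ) * c j) x‖ ≤
        B * weight θ Θ x) (x : ℝ) :
    ‖expSum S lam c x‖ ≤
      Real.exp (Θ * h) / (1 - Real.exp (-((a - Θ) * h))) * B * weight θ Θ x := by
  have hB0 : 0 ≤ B := by
    have h1 := (norm_nonneg _).trans (hB 0)
    exact nonneg_of_mul_nonneg_left h1 (weight_pos θ Θ 0)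
  have hε : Real.exp (-((a - Θ) * h)) < 1 := by
    rw [Real.exp_lt_one_iff]
    have : 0 < (a - Θ) * h := mul_pos (by linarith) hh
    linarith
  have := le_div_of_absorb (f := fun x => ‖expSum S lam c x‖) (W := weight θ Θ)
    (weight_pos θ Θ) (fun _ => norm_nonneg _) h0 (B := Real.exp (Θ * h) * B) hε ?_ x
  · refine this.trans (le_of_eq ?_)
    ring
  intro A hA hAx x
  -- The sum at x is e^{-ah} times its value at x - h plus the transformed sum at x - h. The shift
  -- to the left costs e^{Θh}, so the feedback factor is e^{-(a-Θ)h} < 1, because a exceeds Θ.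
  have e := expSum_shift_sub S lam c a h (x - h)
  rw [sub_add_cancel, sub_eq_iff_eq_add] at e
  change ‖expSum S lam c x‖ ≤ _
  rw [e]
  refine (norm_add_le _ _).trans ?_
  rw [norm_mul, Complex.norm_real, Real.norm_of_nonneg (Real.exp_pos _).le]
  have h1 := hB (x - h)
  have h2 := hAx (x - h)
  have h3 := weight_sub_le hθ hh.le x
  have h4 : Real.exp (-((a - Θ) * h)) = Real.exp (-(a * h)) * Real.exp (Θ * h) := by
    rw [← Real.exp_add]; congr 1; ring
  rw [h4]
  have h5 := h1.trans (mul_le_mul_of_nonneg_left h3 hB0)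
  have h6 := mul_le_mul_of_nonneg_left (h2.trans (mul_le_mul_of_nonneg_left h3 hA))
    (Real.exp_pos (-(a * h))).le
  linarith

lemma integrableOn_exp_sub {k : ℝ} (hk : 0 < k) (x : ℝ) :
    IntegrableOn (fun v => Real.exp (-(k * (v - x)))) (Set.Ioi x) := by
  have := (integrableOn_exp_mul_Ioi (neg_lt_zero.2 hk) x).const_mul (Real.exp (k * x))
  refine this.congr (Filter.Eventually.of_forall fun v => ?_)
  simp only
  rw [← Real.exp_add]; congr 1; ring

lemma integral_exp_sub {k : ℝ} (hk : 0 < k) (x : ℝ) :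
    ∫ v in Set.Ioi x, Real.exp (-(k * (v - x))) = 1 / k := by
  have : ∀ v, Real.exp (-(k * (v - x))) = Real.exp (k * x) * Real.exp (-k * v) := fun v => by
    rw [← Real.exp_add]; congr 1; ring
  simp_rw [this]
  rw [integral_const_mul, integral_exp_mul_Ioi (neg_lt_zero.2 hk), neg_div_neg_eq, mul_div_assoc',
    ← Real.exp_add]
  simp

lemma exp_tail_mul_eq (m l v x : ℝ) (c : ℂ) :
    (Real.exp (-(m * (v - x))) : ℂ) * (c * (Real.exp (-(l * v)) : ℂ)) =
      (c * (Real.exp (-(l * x)) : ℂ)) * (Real.exp (-((l + m) * (v - x))) : ℂ) := by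
  have : Real.exp (-(m * (v - x))) * Real.exp (-(l * v)) =
      Real.exp (-(l * x)) * Real.exp (-((l + m) * (v - x))) := by
    rw [← Real.exp_add, ← Real.exp_add]; congr 1; ring
  have h := congrArg (fun r : ℝ => (r : ℂ)) this
  simp only [Complex.ofReal_mul] at h
  rw [mul_left_comm, h]
  ring

/-- Exponentials are eigenfunctions of the averages `∫ exp (-m (v - x)) f v dv` over `v > x`. -/
lemma integral_tail_expSum {S : Finset ℕ} {lam : ℕ → ℝ} {m : ℝ} (hm : ∀ j ∈ S, 0 < lam j + m)
    (c : ℕ → ℂ) (x : ℝ) :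
    ∫ v in Set.Ioi x, (Real.exp (-(m * (v - x))) : ℂ) * expSum S lam c v =
      expSum S lam (fun j => ((1 / (lam j + m) : ℝ) : ℂ) * c j) x := by
  unfold expSum
  simp_rw [Finset.mul_sum, exp_tail_mul_eq]
  rw [integral_finsetSum]
  · refine Finset.sum_congr rfl fun j hj => ?_
    rw [integral_const_mul, integral_complex_ofReal, integral_exp_sub (hm j hj)]
    ring
  · intro j hj
    exact ((integrableOn_exp_sub (hm j hj) x).ofReal).const_mul _

/-- Inverting the multiplier which annihilates an exponent below the block. -/
lemma norm_expSum_le_of_tail {S : Finset ℕ} {lam : ℕ → ℝ} {θ Θ a m : ℝ} (hθ : θ ≤ Θ) (ha : a < θ)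
    (ha0 : 0 ≤ a) (hm : 0 < m) (hlam : ∀ j ∈ S, 0 < lam j) {c : ℕ → ℂ} {B : ℝ}
    (h0 : ∃ A, ∀ x, ‖expSum S lam c x‖ ≤ A * weight θ Θ x)
    (hB : ∀ x, ‖expSum S lam (fun j => (((lam j - a) / (lam j + m) : ℝ) : ℂ) * c j) x‖ ≤
        B * weight θ Θ x) (x : ℝ) :
    ‖expSum S lam c x‖ ≤ (m + θ) / (θ - a) * B * weight θ Θ x := by
  have hθm : 0 < m + θ := by linarith
  have hε : (a + m) / (m + θ) < 1 := (div_lt_one hθm).2 (by linarith)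
  have := le_div_of_absorb (f := fun x => ‖expSum S lam c x‖) (W := weight θ Θ)
    (weight_pos θ Θ) (fun _ => norm_nonneg _) h0 (B := B) hε ?_ x
  · refine this.trans (le_of_eq ?_)
    have h1 : 1 - (a + m) / (m + θ) = (θ - a) / (m + θ) := by
      rw [eq_div_iff hθm.ne', sub_mul, div_mul_cancel₀ _ hθm.ne']; ring
    rw [h1, div_div_eq_mul_div]
    ring
  intro A hA hAx x
  have hpos : ∀ j ∈ S, 0 < lam j + m := fun j hj => add_pos (hlam j hj) hm
  -- This is 1 = (λ-a)/(λ+m) + (a+m)/(λ+m), the multiplier 1/(λ+m) being realised by a tail average.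
  -- That average has norm at most 1/(m+θ) for the weight, so the feedback factor (a+m)/(m+θ) is
  -- below 1 exactly because a < θ.
  have e : expSum S lam c x =
      expSum S lam (fun j => (((lam j - a) / (lam j + m) : ℝ) : ℂ) * c j) x +
        ((a + m : ℝ) : ℂ) * ∫ v in Set.Ioi x, (Real.exp (-(m * (v - x))) : ℂ) * expSum S lam c v := by
    rw [integral_tail_expSum hpos]
    unfold expSum
    rw [Finset.mul_sum, ← Finset.sum_add_distrib]
    refine Finset.sum_congr rfl fun j hj => ?_
    have h1 : (lam j - a) / (lam j + m) + (a + m) * (1 / (lam j + m)) = 1 := by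
      have := (hpos j hj).ne'
      field_simp
      ring
    have h2 := congrArg (fun r : ℝ => (r : ℂ)) h1
    simp only [Complex.ofReal_add, Complex.ofReal_mul, Complex.ofReal_one] at h2
    simp only
    rw [Complex.ofReal_add a m]
    linear_combination (-(c j * (Real.exp (-(lam j * x)) : ℂ))) * h2
  have hint : ‖∫ v in Set.Ioi x, (Real.exp (-(m * (v - x))) : ℂ) * expSum S lam c v‖ ≤
      A * weight θ Θ x * (1 / (m + θ)) := by
    rw [← integral_exp_sub hθm x, ← integral_const_mul]
    refine norm_integral_le_of_norm_le ((integrableOn_exp_sub hθm x).const_mul _) ?_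
    refine (ae_restrict_iff' measurableSet_Ioi).2 (Filter.Eventually.of_forall fun v hv => ?_)
    have hv' : 0 ≤ v - x := by have : x < v := hv; linarith
    rw [norm_mul, Complex.norm_real, Real.norm_of_nonneg (Real.exp_pos _).le]
    have h1 := hAx v
    have h2 := weight_add_le hθ hv' x
    rw [add_sub_cancel] at h2
    have h3 : Real.exp (-((m + θ) * (v - x))) =
        Real.exp (-(m * (v - x))) * Real.exp (-(θ * (v - x))) := by
      rw [← Real.exp_add]; congr 1; ring
    rw [h3]
    have h4 := mul_le_mul_of_nonneg_left (h1.trans (mul_le_mul_of_nonneg_left h2 hA))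
      (Real.exp_pos (-(m * (v - x)))).le
    linarith
  change ‖expSum S lam c x‖ ≤ _
  rw [e]
  refine (norm_add_le _ _).trans ?_
  rw [norm_mul, Complex.norm_real, Real.norm_of_nonneg (by linarith)]
  have h1 := mul_le_mul_of_nonneg_left hint (by linarith : 0 ≤ a + m)
  have h2 := hB x
  have h3 : (a + m) * (A * weight θ Θ x * (1 / (m + θ))) =
      (a + m) / (m + θ) * A * weight θ Θ x := by ring
  linarith

/-- Inverting a product of multipliers one factor at a time. -/
lemma norm_expSum_le_of_prod {S : Finset ℕ} {lam : ℕ → ℝ} {W : ℝ → ℝ} {b : ℕ → ℕ → ℝ}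
    {K : ℕ → ℝ} (I : Finset ℕ)
    (hstep : ∀ i ∈ I, ∀ (c : ℕ → ℂ) (B : ℝ),
      (∀ x, ‖expSum S lam (fun j => (b i j : ℂ) * c j) x‖ ≤ B * W x) →
        ∀ x, ‖expSum S lam c x‖ ≤ K i * B * W x) (c : ℕ → ℂ) (B : ℝ)
    (hB : ∀ x, ‖expSum S lam (fun j => ((∏ i ∈ I, b i j : ℝ) : ℂ) * c j) x‖ ≤ B * W x) (x : ℝ) :
    ‖expSum S lam c x‖ ≤ (∏ i ∈ I, K i) * B * W x := by
  induction I using Finset.induction_on generalizing c B x with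
  | empty => simpa using hB x
  | insert i I hi ih =>
    rw [Finset.prod_insert hi]
    have h1 := ih (fun k hk => hstep k (Finset.mem_insert_of_mem hk)) (fun j => (b i j : ℂ) * c j) B
      (fun y => by
        refine le_trans (le_of_eq ?_) (hB y)
        congr 2
        funext j
        rw [Finset.prod_insert hi]
        push_cast
        ring)
    have h2 := hstep i (Finset.mem_insert_self i I) c _ h1 x
    rwa [← mul_assoc] at h2

/-! ### The cost of applying the multipliers. -/

/-- The local mean of a product of translation multipliers. -/
lemma integral_norm_shift_prod_le {S : Finset ℕ} {lam h : ℕ → ℝ} (I : Finset ℕ)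
    (hh : ∀ i ∈ I, 0 ≤ h i) (c : ℕ → ℂ) (R : ℝ) (hR : 1 ≤ R) :
    ∫ x in (1 : ℝ)..R, ‖expSum S lam (fun j => ((∏ i ∈ I,
        (Real.exp (-(lam j * h i)) - Real.exp (-(lam i * h i))) : ℝ) : ℂ) * c j) x‖ ≤
      (∏ i ∈ I, (1 + Real.exp (-(lam i * h i)))) *
        ∫ x in (1 : ℝ)..(R + ∑ i ∈ I, h i), ‖expSum S lam c x‖ := by
  induction I using Finset.induction_on generalizing R with
  | empty => simp
  | insert i I hi ih =>
    rw [Finset.prod_insert hi, Finset.sum_insert hi]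
    have hhi := hh i (Finset.mem_insert_self i I)
    -- Each translation lengthens the interval of integration by its step, so the induction
    -- hypothesis is needed on the longer interval.
    have ih' := ih (fun k hk => hh k (Finset.mem_insert_of_mem hk)) (R + h i) (by linarith)
    set c' : ℕ → ℂ := fun j => ((∏ i ∈ I,
        (Real.exp (-(lam j * h i)) - Real.exp (-(lam i * h i))) : ℝ) : ℂ) * c j with hc'
    set g := expSum S lam c' with hg
    have hcont : Continuous fun y => ‖g y‖ := (continuous_expSum S lam c').norm
    have hint : ∀ a b, IntervalIntegrable (fun y => ‖g y‖) volume a b := fun a b =>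
      hcont.intervalIntegrable a b
    have hmono : ∀ {a b a' b' : ℝ}, a' ≤ a → a ≤ b → b ≤ b' →
        ∫ y in a..b, ‖g y‖ ≤ ∫ y in a'..b', ‖g y‖ := fun h1 h2 h3 =>
      intervalIntegral.integral_mono_interval h1 h2 h3
        (Filter.Eventually.of_forall fun _ => norm_nonneg _) (hint _ _)
    have e : ∀ x, expSum S lam (fun j => ((∏ k ∈ insert i I,
        (Real.exp (-(lam j * h k)) - Real.exp (-(lam k * h k))) : ℝ) : ℂ) * c j) x =
        g (x + h i) - (Real.exp (-(lam i * h i)) : ℂ) * g x := fun x => by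
      rw [hg, expSum_shift_sub]
      congr 1
      funext j
      rw [Finset.prod_insert hi, hc']
      push_cast
      ring
    have hs : Continuous fun x => ‖g (x + h i)‖ := hcont.comp (by fun_prop)
    have h1 : ∫ x in (1 : ℝ)..R, ‖expSum S lam (fun j => ((∏ k ∈ insert i I,
        (Real.exp (-(lam j * h k)) - Real.exp (-(lam k * h k))) : ℝ) : ℂ) * c j) x‖ ≤
        ∫ x in (1 : ℝ)..R, (‖g (x + h i)‖ + Real.exp (-(lam i * h i)) * ‖g x‖) := by
      refine intervalIntegral.integral_mono_on hR
        ((continuous_expSum S lam _).norm.intervalIntegrable _ _) ?_ fun x _ => ?_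
      · exact (hs.add (hcont.const_mul _)).intervalIntegrable _ _
      · rw [e]
        refine (norm_sub_le _ _).trans ?_
        rw [norm_mul, Complex.norm_real, Real.norm_of_nonneg (Real.exp_pos _).le]
    rw [intervalIntegral.integral_add (hs.intervalIntegrable _ _)
      ((hcont.const_mul _).intervalIntegrable _ _), intervalIntegral.integral_const_mul,
      intervalIntegral.integral_comp_add_right (fun x => ‖g x‖)] at h1
    have h2 := hmono (by linarith : (1 : ℝ) ≤ 1 + h i) (by linarith) (le_refl (R + h i))
    have h3 := hmono (le_refl (1 : ℝ)) hR (by linarith : R ≤ R + h i)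
    have he := Real.exp_pos (-(lam i * h i))
    have h4 := mul_le_mul_of_nonneg_left h3 he.le
    have h5 := mul_le_mul_of_nonneg_left ih' (by linarith : 0 ≤ 1 + Real.exp (-(lam i * h i)))
    rw [← add_assoc R, mul_assoc]
    linarith

/-- The kernel `∑ mu i * exp (-mu i * v)`. -/
noncomputable def kernel (mu : ℕ → ℝ) (n : ℕ) (v : ℝ) : ℝ :=
  ∑ i ∈ Finset.range n, mu i * Real.exp (-(mu i * v))

lemma integrableOn_tail_expSum {S : Finset ℕ} {lam : ℕ → ℝ} {m : ℝ} (hm : ∀ j ∈ S, 0 < lam j + m)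
    (c : ℕ → ℂ) (x : ℝ) :
    IntegrableOn (fun v => (Real.exp (-(m * (v - x))) : ℂ) * expSum S lam c v) (Set.Ioi x) := by
  unfold expSum
  simp_rw [Finset.mul_sum, exp_tail_mul_eq]
  exact integrable_finsetSum _ fun j hj =>
    ((integrableOn_exp_sub (hm j hj) x).ofReal).const_mul _

/-- The local mean of a product of multipliers annihilating the exponents below a block. -/
lemma exists_lintegral_tail_prod_le {q : ℝ} (hq : 1 < q) :
    ∃ C : ℝ, 0 < C ∧ ∀ lam mu : ℕ → ℝ, (∀ j, 0 < lam j) → (∀ j, lam j ≤ mu j) →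
      (∀ j, q * mu j ≤ mu (j + 1)) → ∀ (n : ℕ) (M R : ℝ), 1 ≤ R → 1 ≤ mu n → mu n ≤ M →
      ∀ (S : Finset ℕ) (c : ℕ → ℂ),
      ∫⁻ x in Set.Ioc 1 R, ‖expSum S lam (fun j => ((∏ i ∈ Finset.range n,
        (lam j - lam i) / (lam j + mu i) : ℝ) : ℂ) * c j) x‖ₑ ≤
      ENNReal.ofReal (C * R * Real.exp (M * R)) *
        ∫⁻ v in Set.Ioi 1, ‖expSum S lam c v‖ₑ * ENNReal.ofReal (kernel mu (n + 1) v) := by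
  obtain ⟨C, hC, H⟩ := exists_partial_fractions hq
  refine ⟨1 + C, by linarith, fun lam mu hlam hle hqmu n M R hR hmu1 hmuM S c => ?_⟩
  have hmu : ∀ j, 0 < mu j := fun j => (hlam j).trans_le (hle j)
  have hM0 : 0 ≤ M := by linarith
  have hmuM' : ∀ i < n, mu i ≤ M := fun i hi => by
    have := mul_le_of_lacunary_of_lt hq hmu hqmu hi
    nlinarith [hmu i]
  obtain ⟨d, hd, hpf⟩ := H lam mu (fun j => (hlam j).le) hle hmu hqmu n
  set f := expSum S lam c with hf
  set I := ∫⁻ v in Set.Ioi 1, ‖f v‖ₑ * ENNReal.ofReal (kernel mu (n + 1) v) with hI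
  have hkterm : ∀ v i, 0 ≤ mu i * Real.exp (-(mu i * v)) := fun v i =>
    mul_nonneg (hmu i).le (Real.exp_pos _).le
  have hint : ∀ i x, IntegrableOn (fun v => (Real.exp (-(mu i * (v - x))) : ℂ) * f v) (Set.Ioi x) :=
    fun i x => integrableOn_tail_expSum (fun j _ => add_pos (hlam j) (hmu i)) c x
  -- By partial fractions the whole product acts as the identity plus one integral over (x, ∞) with
  -- kernel ∑ d_i e^{-μ_i(v-x)}. As |d_i| ≤ C μ_i and μ_i x ≤ MR, this is dominated by `kernel`.
  have hid : ∀ x, expSum S lam (fun j => ((∏ i ∈ Finset.range n,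
        (lam j - lam i) / (lam j + mu i) : ℝ) : ℂ) * c j) x =
      f x + ∫ v in Set.Ioi x, ∑ i ∈ Finset.range n,
        (d i : ℂ) * ((Real.exp (-(mu i * (v - x))) : ℂ) * f v) := by
    intro x
    rw [integral_finsetSum _ fun i _ => (hint i x).const_mul _]
    simp_rw [integral_const_mul]
    rw [Finset.sum_congr rfl fun i _ => by
      rw [integral_tail_expSum (fun j _ => add_pos (hlam j) (hmu i)) c x]]
    simp only [hf, expSum, Finset.mul_sum]
    rw [Finset.sum_comm, ← Finset.sum_add_distrib]
    refine Finset.sum_congr rfl fun j _ => ?_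
    rw [hpf (lam j) (hlam j).le]
    push_cast
    rw [add_mul, add_mul, one_mul, Finset.sum_mul, Finset.sum_mul]
    congr 1
    refine Finset.sum_congr rfl fun i _ => ?_
    ring
  have hexp : ∀ i < n, ∀ x ∈ Set.Ioc 1 R, ∀ v, Real.exp (-(mu i * (v - x))) ≤
      Real.exp (M * R) * Real.exp (-(mu i * v)) := fun i hi x hx v => by
    rw [← Real.exp_add]
    refine Real.exp_le_exp.2 ?_
    have : mu i * x ≤ M * R := mul_le_mul (hmuM' i hi) hx.2 (by linarith [hx.1]) hM0
    linarith
  have hpt : ∀ x ∈ Set.Ioc 1 R, ‖expSum S lam (fun j => ((∏ i ∈ Finset.range n,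
        (lam j - lam i) / (lam j + mu i) : ℝ) : ℂ) * c j) x‖ₑ ≤
      ‖f x‖ₑ + ENNReal.ofReal (C * Real.exp (M * R)) * I := by
    intro x hx
    rw [hid]
    refine (enorm_add_le _ _).trans (add_le_add_right ?_ _)
    refine (enorm_integral_le_lintegral_enorm _).trans ?_
    refine (lintegral_mono_set (Set.Ioi_subset_Ioi hx.1.le)).trans ?_
    rw [hI, ← lintegral_const_mul' _ _ ENNReal.ofReal_ne_top]
    refine lintegral_mono fun v => ?_
    have e : ∑ i ∈ Finset.range n, (d i : ℂ) * ((Real.exp (-(mu i * (v - x))) : ℂ) * f v) =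
        ((∑ i ∈ Finset.range n, d i * Real.exp (-(mu i * (v - x))) : ℝ) : ℂ) * f v := by
      push_cast
      rw [Finset.sum_mul]
      exact Finset.sum_congr rfl fun i _ => by ring
    rw [e, enorm_mul, mul_comm, mul_left_comm, ← ENNReal.ofReal_mul (by positivity)]
    refine mul_le_mul_right ?_ _
    rw [← ofReal_norm, Complex.norm_real]
    refine ENNReal.ofReal_le_ofReal ?_
    refine (Finset.abs_sum_le_sum_abs _ _).trans ?_
    rw [kernel, Finset.sum_range_succ, mul_add, Finset.mul_sum]
    refine le_add_of_le_of_nonneg (Finset.sum_le_sum fun i hi => ?_)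
      (mul_nonneg (by positivity) (hkterm v n))
    have hi' := Finset.mem_range.1 hi
    rw [abs_mul, abs_of_pos (Real.exp_pos _)]
    calc |d i| * Real.exp (-(mu i * (v - x)))
        ≤ (C * mu i) * (Real.exp (M * R) * Real.exp (-(mu i * v))) :=
          mul_le_mul (hd i hi') (hexp i hi' x hx v) (Real.exp_pos _).le
            (mul_nonneg hC.le (hmu i).le)
      _ = _ := by ring
  -- The identity part is absorbed by the extra term i = n of the kernel, which is at least e^{-MR}
  -- on (1,R] because 1 ≤ μ_n ≤ M.
  have hown : ∫⁻ x in Set.Ioc 1 R, ‖f x‖ₑ ≤ ENNReal.ofReal (Real.exp (M * R)) * I := by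
    rw [hI, ← lintegral_const_mul' _ _ ENNReal.ofReal_ne_top]
    refine le_trans (setLIntegral_mono' measurableSet_Ioc fun x hx => ?_)
      (lintegral_mono_set Set.Ioc_subset_Ioi_self)
    rw [mul_left_comm, ← ENNReal.ofReal_mul (Real.exp_pos _).le]
    refine le_mul_of_one_le_right' ?_
    rw [← ENNReal.ofReal_one]
    refine ENNReal.ofReal_le_ofReal ?_
    have h1 : Real.exp (-(M * R)) ≤ mu n * Real.exp (-(mu n * x)) := by
      have : mu n * x ≤ M * R := mul_le_mul hmuM hx.2 (by linarith [hx.1]) hM0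
      calc Real.exp (-(M * R)) ≤ Real.exp (-(mu n * x)) := Real.exp_le_exp.2 (by linarith)
        _ ≤ _ := le_mul_of_one_le_left (Real.exp_pos _).le hmu1
    have h2 : mu n * Real.exp (-(mu n * x)) ≤ kernel mu (n + 1) x := by
      rw [kernel, Finset.sum_range_succ]
      exact le_add_of_nonneg_left (Finset.sum_nonneg fun i _ => hkterm x i)
    calc (1 : ℝ) = Real.exp (M * R) * Real.exp (-(M * R)) := by rw [← Real.exp_add]; simp
      _ ≤ _ := mul_le_mul_of_nonneg_left (h1.trans h2) (Real.exp_pos _).le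
  calc _ ≤ ∫⁻ x in Set.Ioc 1 R, (‖f x‖ₑ + ENNReal.ofReal (C * Real.exp (M * R)) * I) :=
        setLIntegral_mono' measurableSet_Ioc hpt
    _ = (∫⁻ x in Set.Ioc 1 R, ‖f x‖ₑ) +
          ENNReal.ofReal (C * Real.exp (M * R)) * I * ENNReal.ofReal (R - 1) := by
        rw [lintegral_add_right _ measurable_const, setLIntegral_const, Real.volume_Ioc]
    _ ≤ ENNReal.ofReal (Real.exp (M * R)) * I +
          ENNReal.ofReal (C * Real.exp (M * R) * (R - 1)) * I := by
        refine add_le_add hown (le_of_eq ?_)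
        rw [ENNReal.ofReal_mul (by positivity : 0 ≤ C * Real.exp (M * R))]
        ring
    _ ≤ _ := by
        rw [← add_mul, ← ENNReal.ofReal_add (Real.exp_pos _).le
          (mul_nonneg (by positivity) (by linarith))]
        refine mul_le_mul_left (ENNReal.ofReal_le_ofReal ?_) _
        have := Real.exp_pos (M * R)
        have h2 : 0 ≤ C * Real.exp (M * R) := by positivity
        nlinarith

/-! ### Uniform constants for the products of costs. -/

lemma one_div_one_sub_le_exp {y Y : ℝ} (hy : 0 ≤ y) (hyY : y ≤ Y) (hY : Y < 1) :
    1 / (1 - y) ≤ Real.exp (y / (1 - Y)) := by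
  have h1 : 0 < 1 - y := by linarith
  have h2 : 0 < 1 - Y := by linarith
  refine le_trans ?_ (Real.add_one_le_exp _)
  have : y / (1 - y) ≤ y / (1 - Y) := div_le_div_of_nonneg_left hy h2 (by linarith)
  have e : 1 / (1 - y) = y / (1 - y) + 1 := by field_simp; ring
  linarith

lemma exists_sum_succ_mul_pow_le {a : ℝ} (ha0 : 0 ≤ a) (ha : a < 1) :
    ∃ T : ℝ, 0 ≤ T ∧ ∀ n, ∑ t ∈ Finset.range n, ((t : ℝ) + 1) * a ^ t ≤ T := by
  have h1 : Summable fun t : ℕ => ((t : ℝ) + 1) * a ^ t := by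
    have h2 := summable_pow_mul_geometric_of_norm_lt_one 1
      (by rwa [Real.norm_of_nonneg ha0] : ‖a‖ < 1)
    have h3 := summable_geometric_of_lt_one ha0 ha
    refine (h2.add h3).congr fun t => ?_
    rw [pow_one]; ring
  have h0 : ∀ t : ℕ, 0 ≤ ((t : ℝ) + 1) * a ^ t := fun t => by positivity
  exact ⟨∑' t : ℕ, ((t : ℝ) + 1) * a ^ t, tsum_nonneg h0, fun n =>
    h1.sum_le_tsum _ fun t _ => h0 t⟩

/-- The translation steps used to annihilate the exponents with index at least `m`. -/
noncomputable def shiftStep (lam : ℕ → ℝ) (m i : ℕ) : ℝ := (((i - m : ℕ) : ℝ) + 1) / lam i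

/-- The steps h_i satisfy λ_i h_i = i - m + 1. This growth makes ∏ (1 + e^{-λ_i h_i}) and ∏ 1/(1 -
e^{-(λ_i - σl)h_i}) converge, since λ_i - σl ≥ (1 - σ/q) λ_i. It is still slow enough for ∑ h_i to
be bounded, since λ_i is comparable with the lacunary μ_i; hence also the bound for ∏ e^{σ l h_i}.
-/
lemma exists_shift_constants {q ρ σ Q C₁ : ℝ} (hρ : 1 < ρ) (hσ : 1 < σ) (hσq : σ < q) (hQ : 1 ≤ Q)
    (hC₁ : 1 ≤ C₁) :
    ∃ T K : ℝ, 0 ≤ T ∧ 0 < K ∧ ∀ (lam mu : ℕ → ℝ) (m J : ℕ) (l : ℝ), Monotone lam → 1 ≤ l →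
      l ≤ Q → q * l ≤ lam m → (∀ j, lam j ≤ mu j) → (∀ j, mu j ≤ C₁ * lam j) →
      (∀ j, ρ * mu j ≤ mu (j + 1)) →
      (∀ i, m ≤ i → 0 < shiftStep lam m i ∧ σ * l < lam i) ∧
      ∑ i ∈ Finset.Ico m J, shiftStep lam m i ≤ T ∧
      ∏ i ∈ Finset.Ico m J, Real.exp (σ * l * shiftStep lam m i) /
        (1 - Real.exp (-((lam i - σ * l) * shiftStep lam m i))) ≤ K ∧
      ∏ i ∈ Finset.Ico m J, (1 + Real.exp (-(lam i * shiftStep lam m i))) ≤ K := by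
  have hq : 1 < q := hσ.trans hσq
  have hq0 : 0 < q := by linarith
  set κ := 1 - σ / q with hκ
  have hκ0 : 0 < κ := by rw [hκ, sub_pos, div_lt_one hq0]; exact hσq
  have hY : Real.exp (-κ) < 1 := by rw [Real.exp_lt_one_iff]; linarith
  have hY1 : Real.exp (-1) < 1 := by rw [Real.exp_lt_one_iff]; norm_num
  obtain ⟨T₁, hT₁, H₁⟩ := exists_sum_succ_mul_pow_le (inv_nonneg.2 (by linarith : 0 ≤ ρ))
    (inv_lt_one_of_one_lt₀ hρ)
  obtain ⟨T₂, hT₂, H₂⟩ := exists_sum_succ_mul_pow_le (Real.exp_pos _).le hY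
  obtain ⟨T₃, hT₃, H₃⟩ := exists_sum_succ_mul_pow_le (Real.exp_pos _).le hY1
  have hexp : ∀ (k : ℝ) (t : ℕ), 0 < k → Real.exp (-(k * ((t : ℝ) + 1))) ≤
      ((t : ℝ) + 1) * Real.exp (-k) ^ t := fun k t hk => by
    have e : Real.exp (-(k * ((t : ℝ) + 1))) = Real.exp (-k) * Real.exp (-k) ^ t := by
      rw [← Real.exp_nat_mul, ← Real.exp_add]; congr 1; ring
    rw [e]
    refine mul_le_mul_of_nonneg_right ?_ (by positivity)
    have : Real.exp (-k) ≤ 1 := Real.exp_le_one_iff.2 (by linarith)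
    linarith [Nat.cast_nonneg (α := ℝ) t]
  have hsum : ∀ (a T : ℝ), (∀ n, ∑ t ∈ Finset.range n, ((t : ℝ) + 1) * a ^ t ≤ T) → ∀ m J : ℕ,
      ∑ i ∈ Finset.Ico m J, (((i - m : ℕ) : ℝ) + 1) * a ^ (i - m) ≤ T := fun a T h m J => by
    rw [Finset.sum_Ico_eq_sum_range]
    simpa only [add_tsub_cancel_left] using h (J - m)
  refine ⟨C₁ * T₁, Real.exp (σ * Q * (C₁ * T₁) + T₂ / (1 - Real.exp (-κ))) + Real.exp T₃,
    by positivity, by positivity, fun lam mu m J l hmono hl hlQ hqm hle hge hlac => ?_⟩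
  have hql : 1 < q * l := by nlinarith
  have hlam1 : ∀ i, m ≤ i → q * l ≤ lam i := fun i hi => hqm.trans (hmono hi)
  have hlam0 : ∀ i, m ≤ i → 0 < lam i := fun i hi => by linarith [hlam1 i hi]
  have hσl : ∀ i, m ≤ i → κ * lam i ≤ lam i - σ * l := fun i hi => by
    have h1 : σ / q * (q * l) ≤ σ / q * lam i :=
      mul_le_mul_of_nonneg_left (hlam1 i hi) (by positivity)
    have h2 : σ / q * (q * l) = σ * l := by field_simp
    rw [hκ, sub_mul, one_mul]
    linarith
  have hpos : ∀ i, m ≤ i → 0 < shiftStep lam m i := fun i hi =>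
    div_pos (by positivity) (hlam0 i hi)
  have hstep : ∀ i, m ≤ i → shiftStep lam m i ≤
      C₁ * ((((i - m : ℕ) : ℝ) + 1) * ρ⁻¹ ^ (i - m)) := fun i hi => by
    have h1 := pow_mul_le_of_lacunary (by linarith : 0 ≤ ρ) hlac m (i - m)
    rw [Nat.add_sub_cancel' hi] at h1
    have h2 : 1 ≤ mu m := by linarith [hle m, hlam1 m le_rfl]
    have h3 : ρ ^ (i - m) ≤ C₁ * lam i := by
      have : 0 < ρ ^ (i - m) := by positivity
      nlinarith [hge i]
    rw [shiftStep, div_le_iff₀ (hlam0 i hi)]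
    have h4 : 1 ≤ ρ⁻¹ ^ (i - m) * (C₁ * lam i) := by
      rw [inv_pow, inv_mul_eq_div, le_div_iff₀ (by positivity)]
      linarith
    have h5 : (0 : ℝ) ≤ ((i - m : ℕ) : ℝ) + 1 := by positivity
    nlinarith
  have hS : ∑ i ∈ Finset.Ico m J, shiftStep lam m i ≤ C₁ * T₁ := by
    refine (Finset.sum_le_sum fun i hi => hstep i (Finset.mem_Ico.1 hi).1).trans ?_
    rw [← Finset.mul_sum]
    exact mul_le_mul_of_nonneg_left (hsum _ _ H₁ m J) (by linarith)
  refine ⟨fun i hi => ⟨hpos i hi, ?_⟩, hS, ?_, ?_⟩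
  · have := hσl i hi
    have := mul_pos hκ0 (hlam0 i hi)
    linarith
  · refine le_trans ?_ (le_add_of_nonneg_right (Real.exp_pos _).le)
    have hterm : ∀ i ∈ Finset.Ico m J, Real.exp (-((lam i - σ * l) * shiftStep lam m i)) ≤
        Real.exp (-(κ * (((i - m : ℕ) : ℝ) + 1))) := fun i hi => by
      have hi' := (Finset.mem_Ico.1 hi).1
      refine Real.exp_le_exp.2 (neg_le_neg ?_)
      have h1 := mul_le_mul_of_nonneg_right (hσl i hi') (hpos i hi').le
      refine le_trans (le_of_eq ?_) h1
      rw [shiftStep, mul_assoc, mul_div_cancel₀ _ (hlam0 i hi').ne']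
    have hYi : ∀ i : ℕ, Real.exp (-(κ * (((i - m : ℕ) : ℝ) + 1))) ≤ Real.exp (-κ) := fun i => by
      refine Real.exp_le_exp.2 ?_
      have : (0 : ℝ) ≤ ((i - m : ℕ) : ℝ) := by positivity
      nlinarith
    have h1Y : 0 < 1 - Real.exp (-κ) := by linarith
    refine (prod_le_exp_sum _ _ (fun i => σ * Q * shiftStep lam m i +
      ((((i - m : ℕ) : ℝ) + 1) * Real.exp (-κ) ^ (i - m)) / (1 - Real.exp (-κ)))
      (fun i hi => ?_) fun i hi => ?_).trans (Real.exp_le_exp.2 ?_)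
    · have := (hterm i hi).trans (hYi i)
      exact div_nonneg (Real.exp_pos _).le (by linarith)
    · have hi' := (Finset.mem_Ico.1 hi).1
      rw [Real.exp_add, div_eq_mul_one_div]
      refine mul_le_mul (Real.exp_le_exp.2 ?_) ?_ (one_div_nonneg.2 ?_) (Real.exp_pos _).le
      · exact mul_le_mul_of_nonneg_right (mul_le_mul_of_nonneg_left hlQ (by linarith))
          (hpos i hi').le
      · refine (one_div_one_sub_le_exp (Real.exp_pos _).le ((hterm i hi).trans (hYi i)) hY).trans ?_
        refine Real.exp_le_exp.2 (div_le_div_of_nonneg_right ?_ h1Y.le)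
        exact (hterm i hi).trans (hexp κ _ hκ0)
      · have := (hterm i hi).trans (hYi i)
        linarith
    · rw [Finset.sum_add_distrib, ← Finset.mul_sum, ← Finset.sum_div]
      refine add_le_add (mul_le_mul_of_nonneg_left hS (by positivity)) ?_
      exact div_le_div_of_nonneg_right (hsum _ _ H₂ m J) h1Y.le
  · refine le_trans ?_ (le_add_of_nonneg_left (Real.exp_pos _).le)
    refine (prod_le_exp_sum _ _ (fun i => (((i - m : ℕ) : ℝ) + 1) * Real.exp (-1) ^ (i - m))
      (fun i _ => by positivity) fun i hi => ?_).trans (Real.exp_le_exp.2 (hsum _ _ H₃ m J))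
    have hi' := (Finset.mem_Ico.1 hi).1
    rw [add_comm]
    refine (Real.add_one_le_exp _).trans (Real.exp_le_exp.2 ?_)
    refine le_trans (le_of_eq ?_) (hexp 1 (i - m) one_pos)
    rw [shiftStep, mul_div_cancel₀ _ (hlam0 i hi').ne', one_mul]

/-- Each cost factors as (1 + μ_i/θ)(1 + λ_i/(θ - λ_i)) ≤ e^{D μ_i}, since λ_i ≤ 1/q < θ. The sum of
the μ_i with i < n is geometric, hence at most a constant times μ_n. -/
lemma exists_tail_constant {q ρ θ C₁ : ℝ} (hρ : 1 < ρ) (hq : 1 < q) (hθ : q⁻¹ < θ)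
    (hC₁ : 1 ≤ C₁) :
    ∃ K : ℝ, 0 < K ∧ ∀ (lam mu : ℕ → ℝ) (n : ℕ), (∀ j, 0 < lam j) → (∀ j, lam j ≤ mu j) →
      (∀ j, ρ * mu j ≤ mu (j + 1)) → mu n ≤ C₁ → (∀ i < n, q * lam i ≤ 1) →
      (∀ i < n, lam i < θ) ∧ ∏ i ∈ Finset.range n, (mu i + θ) / (θ - lam i) ≤ K := by
  have hq0 : 0 < q := by linarith
  have hθ0 : 0 < θ := (inv_pos.2 hq0).trans hθ
  have hg : 0 < θ - q⁻¹ := by linarith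
  have hρ1 : 0 < 1 - ρ⁻¹ := by linarith [inv_lt_one_of_one_lt₀ hρ]
  set D := 1 / θ + 1 / (θ - q⁻¹) with hD
  have hD0 : 0 < D := by positivity
  refine ⟨Real.exp (D * (C₁ * (2 / (1 - ρ⁻¹)))), Real.exp_pos _,
    fun lam mu n hlam hle hlac hmun hsep => ?_⟩
  have hmu : ∀ j, 0 < mu j := fun j => (hlam j).trans_le (hle j)
  have hlt : ∀ i < n, lam i ≤ q⁻¹ := fun i hi => by
    have := hsep i hi
    rwa [← one_div, le_div_iff₀ hq0, mul_comm]
  refine ⟨fun i hi => (hlt i hi).trans_lt hθ, ?_⟩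
  refine (prod_le_exp_sum _ _ (fun i => D * mu i) (fun i hi => ?_) fun i hi => ?_).trans
    (Real.exp_le_exp.2 ?_)
  · have := hlt i (Finset.mem_range.1 hi)
    exact div_nonneg (by linarith [hmu i]) (by linarith)
  · have h1 := hlt i (Finset.mem_range.1 hi)
    have h2 : 0 < θ - lam i := by linarith
    have e : (mu i + θ) / (θ - lam i) = (mu i / θ + 1) * (lam i / (θ - lam i) + 1) := by
      field_simp
      ring
    have h3 : lam i / (θ - lam i) ≤ mu i / (θ - q⁻¹) :=
      div_le_div₀ (hmu i).le (hle i) hg (by linarith)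
    have e2 : D * mu i = mu i / θ + mu i / (θ - q⁻¹) := by rw [hD]; ring
    rw [e, e2, Real.exp_add]
    have h4 : 0 ≤ lam i / (θ - lam i) := div_nonneg (hlam i).le h2.le
    exact mul_le_mul (Real.add_one_le_exp _) ((Real.add_one_le_exp _).trans (Real.exp_le_exp.2 h3))
      (by linarith) (Real.exp_pos _).le
  · rw [← Finset.mul_sum]
    refine mul_le_mul_of_nonneg_left ?_ hD0.le
    have h1 := sum_min_inv_le_of_lacunary hρ (u := fun i => mu i / mu n)
      (fun i => div_pos (hmu i) (hmu n)) (fun i => by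
        rw [← mul_div_assoc]; exact div_le_div_of_nonneg_right (hlac i) (hmu n).le) n
    have h2 : ∑ i ∈ Finset.range n, mu i =
        mu n * ∑ i ∈ Finset.range n, min (mu i / mu n) (mu i / mu n)⁻¹ := by
      rw [Finset.mul_sum]
      refine Finset.sum_congr rfl fun i hi => ?_
      have h3 := mul_le_of_lacunary_of_lt hρ hmu hlac (Finset.mem_range.1 hi)
      have h4 : mu i ≤ mu n := by nlinarith [hmu i]
      rw [inv_div, min_eq_left, mul_div_cancel₀ _ (hmu n).ne']
      exact ((div_le_one (hmu n)).2 h4).trans ((one_le_div (hmu i)).2 h4)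
    rw [h2]
    exact mul_le_mul hmun h1 (Finset.sum_nonneg fun i _ => by
      have := div_pos (hmu i) (hmu n)
      positivity) (by linarith)

/-! ### Extraction of one block. -/

/-- Extraction of a block of exponents from an exponential sum, when the first exponent of the
block is `1`. -/
lemma exists_block_extraction {q ρ θ Q C₁ : ℝ} (N : ℕ) (hq : 1 < q) (hρ : 1 < ρ) (hθ : q⁻¹ < θ)
    (hθ1 : θ < 1) (hQ : 1 ≤ Q) (hC₁ : 1 ≤ C₁) :
    ∃ C : ℝ, 0 < C ∧ ∀ lam mu : ℕ → ℝ, (∀ j, 0 < lam j) → StrictMono lam → (∀ j, lam j ≤ mu j) →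
      (∀ j, mu j ≤ C₁ * lam j) → (∀ j, ρ * mu j ≤ mu (j + 1)) →
      ∀ n m J : ℕ, n < m → m ≤ J → m ≤ n + N → lam n = 1 → (∀ j, n ≤ j → j < m → lam j ≤ Q) →
      (∀ i < n, q * lam i ≤ 1) → q * lam (m - 1) ≤ lam m → ∀ (c : ℕ → ℂ) (x : ℝ), 0 ≤ x →
      ‖expSum (Finset.Ico n m) lam c x‖ₑ ≤ ENNReal.ofReal (C * Real.exp (-(θ * x))) *
        ∫⁻ v in Set.Ioi 1, ‖expSum (Finset.range J) lam c v‖ₑ *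
          ENNReal.ofReal (kernel mu (n + 1) v) := by
  have hθ0 : 0 < θ := (inv_pos.2 (by linarith)).trans hθ
  -- Any σ strictly between 1 and q serves: the fast rate σl of the weight exceeds every exponent of
  -- the block and stays below all later ones.
  set σ := (1 + q) / 2 with hσ
  have hσ1 : 1 < σ := by rw [hσ]; linarith
  have hσq : σ < q := by rw [hσ]; linarith
  obtain ⟨CE, RE, hCE, hRE, HE⟩ := exists_weight_bound (Q := Q) hθ0 hθ1 hσ1 N
  obtain ⟨T, KH, hT, hKH, HH⟩ := exists_shift_constants hρ hσ1 hσq hQ hC₁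
  obtain ⟨KL, hKL, HL⟩ := exists_tail_constant hρ hq hθ hC₁
  obtain ⟨CL, hCL, HF⟩ := exists_lintegral_tail_prod_le hρ
  set R := RE + T with hR
  have hR1 : 1 ≤ R := by linarith
  refine ⟨2 * (KL * (KH * (CE * (KH * (CL * R * Real.exp (C₁ * R)))))), by positivity,
    fun lam mu hlam hmono hle hge hlac n m J hnm hmJ hmN hn1 hblock hlow hgap c => ?_⟩
  set l := lam (m - 1) with hl
  have hl1 : 1 ≤ l := by rw [← hn1]; exact hmono.monotone (by omega)
  have hlQ : l ≤ Q := hblock _ (by omega) (by omega)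
  have hmun1 : 1 ≤ mu n := by rw [← hn1]; exact hle n
  have hmunC : mu n ≤ C₁ := by simpa [hn1] using hge n
  obtain ⟨hstep, hsumT, hprodK, hprodF⟩ := HH lam mu m J l hmono.monotone hl1 hlQ hgap hle hge hlac
  obtain ⟨hlowθ, hprodL⟩ := HL lam mu n hlam hle hlac hmunC hlow
  set S := Finset.Ico n m with hS
  have hcard : S.card ≤ N := by rw [hS, Nat.card_Ico]; omega
  have hSb : ∀ j ∈ S, 1 ≤ lam j ∧ lam j ≤ l := fun j hj => by
    have hj' := Finset.mem_Ico.1 hj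
    exact ⟨hn1 ▸ hmono.monotone hj'.1, hmono.monotone (by omega)⟩
  have hθΘ : θ ≤ σ * l := by nlinarith
  have hbound : ∀ c' : ℕ → ℂ, ∀ x, ‖expSum S lam c' x‖ ≤
      CE * (∫ y in (1 : ℝ)..RE, ‖expSum S lam c' y‖) * weight θ (σ * l) x := fun c' x =>
    (HE S lam c' l hcard hSb hl1 hlQ x).trans (le_of_eq (by ring))
  -- The coefficients `cL` vanish for indices below n, and `cH` also for indices from m to J - 1. On
  -- the block, `cL` and `cH` are the multiplied coefficients, from which `stepA` and `stepB`
  -- recover c.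
  set cL : ℕ → ℂ := fun j => ((∏ i ∈ Finset.range n,
        (lam j - lam i) / (lam j + mu i) : ℝ) : ℂ) * c j with hcL
  set cH : ℕ → ℂ := fun j => ((∏ i ∈ Finset.Ico m J, (Real.exp (-(lam j * shiftStep lam m i)) -
        Real.exp (-(lam i * shiftStep lam m i))) : ℝ) : ℂ) * cL j with hcH
  set I := ∫ y in (1 : ℝ)..RE, ‖expSum S lam cH y‖ with hI
  have hI0 : 0 ≤ I := intervalIntegral.integral_nonneg hRE fun _ _ => norm_nonneg _
  -- Here `hbound` plays two roles: at each factor it supplies only the finiteness needed for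
  -- absorption, and for `cH` it supplies the actual bound by the local mean I.
  have stepA := norm_expSum_le_of_prod (S := S) (lam := lam) (W := weight θ (σ * l))
    (b := fun i j => Real.exp (-(lam j * shiftStep lam m i)) -
        Real.exp (-(lam i * shiftStep lam m i)))
    (K := fun i => Real.exp (σ * l * shiftStep lam m i) /
        (1 - Real.exp (-((lam i - σ * l) * shiftStep lam m i)))) (Finset.Ico m J)
    (fun i hi c' B hB => norm_expSum_le_of_shift hθΘ (hstep i (Finset.mem_Ico.1 hi).1).2
      (hstep i (Finset.mem_Ico.1 hi).1).1 ⟨_, hbound c'⟩ hB) cL (CE * I) (hbound cH)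
  have stepB := norm_expSum_le_of_prod (S := S) (lam := lam) (W := weight θ (σ * l))
    (b := fun i j => (lam j - lam i) / (lam j + mu i))
    (K := fun i => (mu i + θ) / (θ - lam i)) (Finset.range n)
    (fun i hi c' B hB => norm_expSum_le_of_tail hθΘ (hlowθ i (Finset.mem_range.1 hi))
      (hlam i).le ((hlam i).trans_le (hle i)) (fun j _ => hlam j) ⟨_, hbound c'⟩ hB) c _ stepA
  have hφ : ∀ y, expSum S lam cH y = expSum (Finset.range J) lam cH y := fun y => by
    unfold expSum
    refine Finset.sum_subset (fun j hj => ?_) fun j hj hjS => ?_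
    · have := Finset.mem_Ico.1 hj
      exact Finset.mem_range.2 (by omega)
    · have hz : cH j = 0 := by
        rcases lt_or_ge j n with h | h
        · have : cL j = 0 := by
            simp only [hcL]
            rw [Finset.prod_eq_zero (Finset.mem_range.2 h) (by simp)]
            simp
          simp only [hcH]
          rw [this, mul_zero]
        · have hmj : m ≤ j := by
            by_contra hlt
            exact hjS (Finset.mem_Ico.2 ⟨h, by omega⟩)
          simp only [hcH]
          rw [Finset.prod_eq_zero (Finset.mem_Ico.2 ⟨hmj, Finset.mem_range.1 hj⟩) (by simp)]
          simp
      rw [hz, zero_mul]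
  have hfwd : I ≤ KH * ∫ x in (1 : ℝ)..R, ‖expSum (Finset.range J) lam cL x‖ := by
    rw [hI]
    simp_rw [hφ]
    refine (integral_norm_shift_prod_le (Finset.Ico m J)
      (fun i hi => (hstep i (Finset.mem_Ico.1 hi).1).1.le) cL RE hRE).trans ?_
    have hs0 : 0 ≤ ∑ i ∈ Finset.Ico m J, shiftStep lam m i :=
      Finset.sum_nonneg fun i hi => (hstep i (Finset.mem_Ico.1 hi).1).1.le
    refine mul_le_mul hprodF ?_ (intervalIntegral.integral_nonneg (by linarith)
      fun _ _ => norm_nonneg _) hKH.le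
    exact intervalIntegral.integral_mono_interval le_rfl (by linarith) (by linarith)
      (Filter.Eventually.of_forall fun _ => norm_nonneg _)
      ((continuous_expSum _ lam cL).norm.intervalIntegrable _ _)
  have hF := HF lam mu hlam hle hlac n C₁ R hR1 hmun1 hmunC (Finset.range J) c
  have hconv : ENNReal.ofReal (∫ x in (1 : ℝ)..R, ‖expSum (Finset.range J) lam cL x‖) =
      ∫⁻ x in Set.Ioc 1 R, ‖expSum (Finset.range J) lam cL x‖ₑ := by
    rw [intervalIntegral.integral_of_le hR1]
    refine ofReal_integral_norm_eq_lintegral_enorm ?_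
    exact ((continuous_expSum _ lam cL).integrableOn_Icc).mono_set Set.Ioc_subset_Icc_self
  rw [← hconv] at hF
  intro x hx
  have hw : weight θ (σ * l) x ≤ 2 * Real.exp (-(θ * x)) := by
    have : Real.exp (-(σ * l * x)) ≤ Real.exp (-(θ * x)) := Real.exp_le_exp.2 (by nlinarith)
    unfold weight
    linarith
  set F := ∫ x in (1 : ℝ)..R, ‖expSum (Finset.range J) lam cL x‖ with hFdef
  have hF0 : 0 ≤ F := intervalIntegral.integral_nonneg hR1 fun _ _ => norm_nonneg _
  have hreal : ‖expSum S lam c x‖ ≤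
      (2 * (KL * (KH * (CE * KH))) * Real.exp (-(θ * x))) * F := by
    refine (stepB x).trans ?_
    have hp0 : 0 ≤ ∏ i ∈ Finset.Ico m J, Real.exp (σ * l * shiftStep lam m i) /
        (1 - Real.exp (-((lam i - σ * l) * shiftStep lam m i))) :=
      Finset.prod_nonneg fun i hi => by
        obtain ⟨h1, h2⟩ := hstep i (Finset.mem_Ico.1 hi).1
        refine div_nonneg (Real.exp_pos _).le (sub_nonneg.2 (Real.exp_le_one_iff.2 ?_))
        have := mul_pos (sub_pos.2 h2) h1
        linarith
    calc _ ≤ KL * (KH * (CE * (KH * F))) * (2 * Real.exp (-(θ * x))) := by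
          refine mul_le_mul (mul_le_mul hprodL (mul_le_mul hprodK
            (mul_le_mul_of_nonneg_left hfwd hCE.le) (by positivity) hKH.le) (by positivity)
            hKL.le) hw (weight_pos _ _ _).le (by positivity)
      _ = _ := by ring
  rw [← ofReal_norm]
  refine (ENNReal.ofReal_le_ofReal hreal).trans ?_
  rw [ENNReal.ofReal_mul (by positivity)]
  refine (mul_le_mul_right hF _).trans ?_
  rw [← mul_assoc, ← ENNReal.ofReal_mul (by positivity)]
  refine le_of_eq ?_
  congr 2
  ring

/-! ### Separated blocks and the lacunary majorant. -/

/-- Consecutive blocks `[m k, m (k + 1))` of boundedly many comparable exponents, separated by gaps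
of ratio at least `q`. -/
structure SeparatedBlocks (lam : ℕ → ℝ) (m : ℕ → ℕ) (N : ℕ) (q Q : ℝ) : Prop where
  pos : ∀ j, 0 < lam j
  strictMono : StrictMono lam
  strictMono_index : StrictMono m
  index_zero : m 0 = 0
  card : ∀ k, m (k + 1) ≤ m k + N
  one_lt : 1 < q
  gap : ∀ k, q * lam (m (k + 1) - 1) ≤ lam (m (k + 1))
  comparable : ∀ k j, m k ≤ j → j < m (k + 1) → lam j ≤ Q * lam (m k)

/-- The least sequence with ratios at least `ρ` above `A * lam`. -/
noncomputable def lacunaryMajorant (lam : ℕ → ℝ) (A ρ : ℝ) : ℕ → ℝ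
  | 0 => A * lam 0
  | j + 1 => max (ρ * lacunaryMajorant lam A ρ j) (A * lam (j + 1))

lemma le_lacunaryMajorant (lam : ℕ → ℝ) (A ρ : ℝ) (j : ℕ) :
    A * lam j ≤ lacunaryMajorant lam A ρ j := by
  cases j with
  | zero => exact le_rfl
  | succ j => exact le_max_right _ _

lemma mul_lacunaryMajorant_le (lam : ℕ → ℝ) (A ρ : ℝ) (j : ℕ) :
    ρ * lacunaryMajorant lam A ρ j ≤ lacunaryMajorant lam A ρ (j + 1) := le_max_left _ _

lemma exists_mem_block {m : ℕ → ℕ} (hm : StrictMono m) (h0 : m 0 = 0) (j : ℕ) :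
    ∃ k, m k ≤ j ∧ j < m (k + 1) := by
  have hex : ∃ k, j < m (k + 1) := ⟨j, lt_of_lt_of_le (Nat.lt_succ_self j) (hm.id_le (j + 1))⟩
  refine ⟨Nat.find hex, ?_, Nat.find_spec hex⟩
  rcases Nat.eq_zero_or_pos (Nat.find hex) with h | h
  · rw [h, h0]; exact Nat.zero_le _
  · have := Nat.find_min hex (Nat.sub_lt h one_pos)
    rw [Nat.sub_add_cancel (show 1 ≤ Nat.find hex from h)] at this
    exact not_lt.1 this

namespace SeparatedBlocks

variable {lam : ℕ → ℝ} {m : ℕ → ℕ} {N : ℕ} {q Q : ℝ}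

lemma one_le_comparable (h : SeparatedBlocks lam m N q Q) : 1 ≤ Q := by
  have h1 := h.comparable 0 (m 0) le_rfl (h.strictMono_index (Nat.lt_succ_self 0))
  have h2 := h.pos (m 0)
  by_contra hlt
  nlinarith

lemma leader_lacunary (h : SeparatedBlocks lam m N q Q) (k : ℕ) :
    q * lam (m k) ≤ lam (m (k + 1)) := by
  refine le_trans (mul_le_mul_of_nonneg_left (h.strictMono.monotone ?_) (by linarith [h.one_lt]))
    (h.gap k)
  have := h.strictMono_index (Nat.lt_succ_self k)
  exact Nat.le_sub_one_of_lt this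

/-- Inside a block the ratio ρ may be enforced fewer than N times before the next leader, and
reaching that leader costs at most ρ^N ≤ q in all. The leaders grow at least by the factor q, so the
excess does not accumulate from block to block. -/
lemma lacunaryMajorant_le (h : SeparatedBlocks lam m N q Q) {A ρ : ℝ} (hA : 0 ≤ A) (hρ : 1 ≤ ρ)
    (hρq : ρ ^ N ≤ q) (j : ℕ) : lacunaryMajorant lam A ρ j ≤ A * Q * q * lam j := by
  have hQ := h.one_le_comparable
  have hq := h.one_lt
  have hpow : ∀ i, i ≤ N → ρ ^ i ≤ q := fun i hi => (pow_le_pow_right₀ hρ hi).trans hρq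
  have hblock : ∀ k, lacunaryMajorant lam A ρ (m k) ≤ A * Q * lam (m k) → ∀ i, m k + i < m (k + 1) →
      lacunaryMajorant lam A ρ (m k + i) ≤ ρ ^ i * (A * Q * lam (m k)) := by
    intro k hk i
    induction i with
    | zero => intro _; simpa using hk
    | succ i ih =>
      intro hi
      have ih' := ih (by omega)
      have hp := h.pos (m k)
      refine max_le ?_ ?_
      · calc ρ * lacunaryMajorant lam A ρ (m k + i) ≤ ρ * (ρ ^ i * (A * Q * lam (m k))) :=
            mul_le_mul_of_nonneg_left ih' (by linarith)
          _ = _ := by ring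
      · have h1 := mul_le_mul_of_nonneg_left (h.comparable k (m k + (i + 1)) (by omega) hi) hA
        refine h1.trans ?_
        rw [← mul_assoc]
        exact le_mul_of_one_le_left (by positivity) (one_le_pow₀ hρ)
  have hlead : ∀ k, lacunaryMajorant lam A ρ (m k) ≤ A * Q * lam (m k) := by
    intro k
    induction k with
    | zero =>
      rw [h.index_zero, lacunaryMajorant]
      have := mul_nonneg hA (h.pos 0).le
      nlinarith
    | succ k ih =>
      have hlt := h.strictMono_index (Nat.lt_succ_self k)
      have hcard := h.card k
      obtain ⟨i, hi⟩ : ∃ i, m (k + 1) = m k + i + 1 := ⟨m (k + 1) - m k - 1, by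
        rw [Nat.succ_eq_add_one] at hlt; omega⟩
      have h1 := hblock k ih i (by omega)
      have hp := h.pos (m k)
      rw [hi, lacunaryMajorant, ← hi]
      refine max_le ?_ ?_
      · calc ρ * lacunaryMajorant lam A ρ (m k + i) ≤ ρ * (ρ ^ i * (A * Q * lam (m k))) :=
              mul_le_mul_of_nonneg_left h1 (by linarith)
          _ = ρ ^ (i + 1) * (A * Q * lam (m k)) := by ring
          _ ≤ q * (A * Q * lam (m k)) :=
              mul_le_mul_of_nonneg_right (hpow _ (by omega)) (by positivity)
          _ = A * Q * (q * lam (m k)) := by ring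
          _ ≤ _ := mul_le_mul_of_nonneg_left (h.leader_lacunary k) (by positivity)
      · have := mul_nonneg hA (h.pos (m (k + 1))).le
        nlinarith
  obtain ⟨k, hk1, hk2⟩ := exists_mem_block h.strictMono_index h.index_zero j
  obtain ⟨i, rfl⟩ := Nat.exists_eq_add_of_le hk1
  have hcard := h.card k
  have hp := h.pos (m k)
  calc _ ≤ ρ ^ i * (A * Q * lam (m k)) := hblock k (hlead k) i hk2
    _ ≤ q * (A * Q * lam (m k)) := mul_le_mul_of_nonneg_right (hpow _ (by omega)) (by positivity)
    _ = A * Q * q * lam (m k) := by ring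
    _ ≤ _ := mul_le_mul_of_nonneg_left (h.strictMono.monotone (by omega)) (by positivity)

end SeparatedBlocks

lemma lintegral_Ioi_one_eq {a : ℝ} (ha : 0 < a) (G : ℝ → ℝ≥0∞) :
    ∫⁻ v in Set.Ioi 1, G v = ∫⁻ w in Set.Ioi a⁻¹, ENNReal.ofReal a * G (a * w) := by
  have himg : (fun w => a * w) '' Set.Ioi a⁻¹ = Set.Ioi 1 := by
    rw [Set.image_mul_left_Ioi ha, mul_inv_cancel₀ ha.ne']
  rw [← himg, lintegral_image_eq_lintegral_abs_deriv_mul measurableSet_Ioi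
    (f' := fun _ => a) (fun x _ => by
      simpa using ((hasDerivAt_id x).const_mul a).hasDerivWithinAt)
    (fun x _ y _ hxy => mul_left_cancel₀ ha.ne' hxy)]
  simp_rw [abs_of_pos ha]

/-- Extraction of a block of exponents from an exponential sum. -/
lemma SeparatedBlocks.exists_extraction {lam mu : ℕ → ℝ} {m : ℕ → ℕ} {N : ℕ} {q Q ρ C₁ θ : ℝ}
    (h : SeparatedBlocks lam m N q Q) (hρ : 1 < ρ) (hC₁ : 1 ≤ C₁) (hθ : q⁻¹ < θ) (hθ1 : θ < 1)
    (hle : ∀ j, lam j ≤ mu j) (hge : ∀ j, mu j ≤ C₁ * lam j) (hlac : ∀ j, ρ * mu j ≤ mu (j + 1)) :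
    ∃ C : ℝ, 0 < C ∧ ∀ (c : ℕ → ℂ) (k K : ℕ), k < K → ∀ x, 0 ≤ x →
      ‖expSum (Finset.Ico (m k) (m (k + 1))) lam c x‖ₑ ≤
        ENNReal.ofReal (C * Real.exp (-(θ * lam (m k) * x))) *
        ∫⁻ v in Set.Ioi (lam (m k))⁻¹, ‖expSum (Finset.range (m K)) lam c v‖ₑ *
          ENNReal.ofReal (kernel mu (m k + 1) v) := by
  obtain ⟨C, hC, H⟩ := exists_block_extraction N h.one_lt hρ hθ hθ1 h.one_le_comparable hC₁
  refine ⟨C, hC, fun c k K hkK x hx => ?_⟩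
  -- Dividing all exponents by a normalises the leader to 1. The kernel measure kernel(v) dv is
  -- invariant under this scaling, so the constant does not depend on k.
  set a := lam (m k) with ha
  have ha0 : 0 < a := h.pos _
  have hmk := h.strictMono_index (Nat.lt_succ_self k)
  have hscale : ∀ S y, expSum S (fun j => lam j / a) c (a * y) = expSum S lam c y := fun S y => by
    unfold expSum
    refine Finset.sum_congr rfl fun j _ => ?_
    congr 4
    field_simp
  have hkern : ∀ n v, kernel (fun j => mu j / a) n (a * v) = kernel mu n v / a := fun n v => by
    unfold kernel
    rw [Finset.sum_div]
    refine Finset.sum_congr rfl fun j _ => ?_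
    have : mu j / a * (a * v) = mu j * v := by field_simp
    rw [this]
    ring
  have key := H (fun j => lam j / a) (fun j => mu j / a) (fun j => div_pos (h.pos j) ha0)
    (fun i j hij => div_lt_div_of_pos_right (h.strictMono hij) ha0)
    (fun j => div_le_div_of_nonneg_right (hle j) ha0.le)
    (fun j => by rw [← mul_div_assoc]; exact div_le_div_of_nonneg_right (hge j) ha0.le)
    (fun j => by rw [← mul_div_assoc]; exact div_le_div_of_nonneg_right (hlac j) ha0.le)
    (m k) (m (k + 1)) (m K) hmk (h.strictMono_index.monotone hkK) (h.card k)
    (div_self ha0.ne') (fun j h1 h2 => (div_le_iff₀ ha0).2 (h.comparable k j h1 h2))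
    (fun i hi => by
      rw [← mul_div_assoc, div_le_one ha0]
      obtain ⟨k', rfl⟩ : ∃ k', k = k' + 1 := by
        refine Nat.exists_eq_succ_of_ne_zero fun h0 => ?_
        rw [h0, h.index_zero] at hi
        exact absurd hi (Nat.not_lt_zero _)
      refine le_trans (mul_le_mul_of_nonneg_left (h.strictMono.monotone ?_)
        (by linarith [h.one_lt])) (h.gap k')
      omega)
    (by rw [← mul_div_assoc]; exact div_le_div_of_nonneg_right (h.gap k) ha0.le)
    c (a * x) (mul_nonneg ha0.le hx)
  rw [hscale, lintegral_Ioi_one_eq ha0, ← mul_assoc] at key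
  refine key.trans (le_of_eq ?_)
  congr 1
  refine lintegral_congr fun w => ?_
  rw [hscale, hkern, mul_left_comm, ← ENNReal.ofReal_mul ha0.le, mul_div_cancel₀ _ ha0.ne']

/-! ### From L^s to weighted ℓ^s. -/

/-- With u = μ_i v, half of e^{-u} supplies e^{-bv}, and the other half gives u e^{-u/2} ≤ 8 min(u,
1/u), which is summable along a lacunary sequence. The factor e^{-bv} is later needed to compare
with the measure `nu α` near t = 0. -/
lemma exists_kernel_le {ρ : ℝ} (hρ : 1 < ρ) :
    ∃ C : ℝ, 0 < C ∧ ∀ (mu : ℕ → ℝ) (b : ℝ), (∀ j, 0 < mu j) → (∀ j, ρ * mu j ≤ mu (j + 1)) →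
      2 * b ≤ mu 0 → ∀ (n : ℕ) (v : ℝ), 0 < v → kernel mu n v ≤ C * (v⁻¹ * Real.exp (-(b * v))) := by
  have hρ1 : 0 < 1 - ρ⁻¹ := by linarith [inv_lt_one_of_one_lt₀ hρ]
  refine ⟨8 * (2 / (1 - ρ⁻¹)), by positivity, fun mu b hmu hlac hb n v hv => ?_⟩
  have hterm : ∀ i, mu i * Real.exp (-(mu i * v)) ≤
      8 * (v⁻¹ * Real.exp (-(b * v))) * min (mu i * v) (mu i * v)⁻¹ := fun i => by
    set u := mu i * v with hu
    have hu0 : 0 < u := mul_pos (hmu i) hv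
    have hmu0 : mu 0 ≤ mu i := by
      rcases Nat.eq_zero_or_pos i with rfl | hi
      · exact le_rfl
      · have := mul_le_of_lacunary_of_lt hρ hmu hlac hi
        nlinarith [hmu 0]
    have hbu : b * v ≤ u / 2 := by rw [hu]; nlinarith
    have h1 : Real.exp (-u) ≤ Real.exp (-(b * v)) * Real.exp (-(u / 2)) := by
      rw [← Real.exp_add]; exact Real.exp_le_exp.2 (by linarith)
    have hx0 : 0 < Real.exp (-(u / 2)) := Real.exp_pos _
    have hx1 : Real.exp (-(u / 2)) ≤ 1 := Real.exp_le_one_iff.2 (by linarith)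
    have h2 : u * Real.exp (-(u / 2)) ≤ 8 * min u u⁻¹ := by
      rw [mul_min_of_nonneg _ _ (by norm_num : (0 : ℝ) ≤ 8)]
      refine le_min (by nlinarith) ?_
      have h3 := Real.quadratic_le_exp_of_nonneg (by linarith : 0 ≤ u / 2)
      have h4 : u ^ 2 ≤ 8 * Real.exp (u / 2) := by nlinarith
      rw [← div_eq_mul_inv, le_div_iff₀ hu0, Real.exp_neg, ← div_eq_mul_inv, div_mul_eq_mul_div,
        div_le_iff₀ (Real.exp_pos _)]
      nlinarith
    have e : mu i = v⁻¹ * u := by rw [hu]; field_simp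
    calc mu i * Real.exp (-u) = v⁻¹ * (u * Real.exp (-u)) := by rw [e]; ring
      _ ≤ v⁻¹ * (u * (Real.exp (-(b * v)) * Real.exp (-(u / 2)))) := by gcongr
      _ = v⁻¹ * Real.exp (-(b * v)) * (u * Real.exp (-(u / 2))) := by ring
      _ ≤ v⁻¹ * Real.exp (-(b * v)) * (8 * min u u⁻¹) := by gcongr
      _ = _ := by ring
  unfold kernel
  refine (Finset.sum_le_sum fun i _ => hterm i).trans ?_
  rw [← Finset.mul_sum]
  have := sum_min_inv_le_of_lacunary hρ (u := fun i => mu i * v) (fun i => mul_pos (hmu i) hv)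
    (fun i => by rw [← mul_assoc]; exact mul_le_mul_of_nonneg_right (hlac i) hv.le) n
  refine (mul_le_mul_of_nonneg_left this (by positivity)).trans (le_of_eq ?_)
  ring

/-- Hölder's inequality with a weight. -/
lemma lintegral_rpow_le_mul_weight {ν : Measure ℝ} {s : ℝ} (hs : 1 ≤ s) {F : ℝ → ℝ≥0∞}
    (hF : AEMeasurable F ν) {w : ℝ → ℝ} (hw : Measurable w) (hw0 : ∀ᵐ v ∂ν, 0 < w v) :
    (∫⁻ v, F v ∂ν) ^ s ≤ (∫⁻ v, F v ^ s * ENNReal.ofReal (w v ^ (s - 1)) ∂ν) *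
      (∫⁻ v, ENNReal.ofReal (w v)⁻¹ ∂ν) ^ (s - 1) := by
  rcases hs.eq_or_lt with rfl | hs
  · simp
  have hs0 : 0 < s := by linarith
  have hs1 : 0 < s - 1 := by linarith
  set t := s.conjExponent with ht
  have hst : s.HolderConjugate t := Real.HolderConjugate.conjExponent hs
  have ht' : t = s / (s - 1) := rfl
  have h1 : ∫⁻ v, F v ∂ν = ∫⁻ v, ((fun v => F v * ENNReal.ofReal (w v ^ ((s - 1) / s))) *
      fun v => ENNReal.ofReal (w v ^ (-((s - 1) / s)))) v ∂ν := by
    refine lintegral_congr_ae ?_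
    filter_upwards [hw0] with v hv
    rw [Pi.mul_apply, mul_assoc, ← ENNReal.ofReal_mul (Real.rpow_nonneg hv.le _),
      ← Real.rpow_add hv]
    simp
  have h2 := ENNReal.lintegral_mul_le_Lp_mul_Lq ν hst
    (f := fun v => F v * ENNReal.ofReal (w v ^ ((s - 1) / s)))
    (g := fun v => ENNReal.ofReal (w v ^ (-((s - 1) / s))))
    (hF.mul (hw.pow_const _).ennreal_ofReal.aemeasurable)
    (hw.pow_const _).ennreal_ofReal.aemeasurable
  rw [← h1] at h2
  have h3 := ENNReal.rpow_le_rpow h2 hs0.le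
  rw [ENNReal.mul_rpow_of_nonneg _ _ hs0.le, ← ENNReal.rpow_mul, ← ENNReal.rpow_mul,
    one_div_mul_cancel hs0.ne', ENNReal.rpow_one] at h3
  have e3 : 1 / t * s = s - 1 := by rw [ht']; field_simp
  rw [e3] at h3
  refine h3.trans (le_of_eq ?_)
  congr 1
  · refine lintegral_congr_ae ?_
    filter_upwards [hw0] with v hv
    rw [ENNReal.mul_rpow_of_nonneg _ _ hs0.le, ENNReal.ofReal_rpow_of_nonneg
      (Real.rpow_nonneg hv.le _) hs0.le, ← Real.rpow_mul hv.le, div_mul_cancel₀ _ hs0.ne']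
  · congr 1
    refine lintegral_congr_ae ?_
    filter_upwards [hw0] with v hv
    rw [ENNReal.ofReal_rpow_of_nonneg (Real.rpow_nonneg hv.le _) hst.symm.nonneg,
      ← Real.rpow_mul hv.le]
    have : -((s - 1) / s) * t = -1 := by rw [ht']; field_simp
    rw [this, Real.rpow_neg_one]

lemma lintegral_rpow_mul_exp {b δ : ℝ} (hb : 0 < b) (hδ : δ < 1) :
    ∫⁻ v in Set.Ioi (0 : ℝ), ENNReal.ofReal (b * Real.exp (-(b * v)) / v ^ δ) =
      ENNReal.ofReal (b ^ δ * Real.Gamma (1 - δ)) := by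
  have hδ' : 0 < 1 - δ := by linarith
  have h1 := Real.integral_rpow_mul_exp_neg_mul_Ioi hδ' hb
  have hG := Real.Gamma_pos_of_pos hδ'
  have h2 : Integrable (fun v : ℝ => v ^ (1 - δ - 1) * Real.exp (-(b * v)))
      (volume.restrict (Set.Ioi 0)) := by
    refine Integrable.of_integral_ne_zero ?_
    rw [h1]
    positivity
  have h3 : ∫ v in Set.Ioi (0 : ℝ), b * (v ^ (1 - δ - 1) * Real.exp (-(b * v))) =
      b ^ δ * Real.Gamma (1 - δ) := by
    rw [integral_const_mul, h1, ← mul_assoc]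
    congr 1
    rw [one_div, Real.inv_rpow hb.le, ← Real.rpow_neg hb.le]
    nth_rewrite 1 [← Real.rpow_one b]
    rw [← Real.rpow_add hb]
    congr 1; ring
  rw [← h3, ofReal_integral_eq_lintegral_ofReal (h2.const_mul b)]
  · refine setLIntegral_congr_fun measurableSet_Ioi fun v hv => ?_
    have hv' : 0 < v := hv
    have : 1 - δ - 1 = -δ := by ring
    rw [this, Real.rpow_neg hv'.le]
    congr 1
    ring
  · refine (ae_restrict_iff' measurableSet_Ioi).2 (Filter.Eventually.of_forall fun v hv => ?_)
    have hv' : 0 < v := hv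
    simp only [Pi.zero_apply]
    positivity

lemma continuous_kernel (mu : ℕ → ℝ) (n : ℕ) : Continuous (kernel mu n) := by
  unfold kernel
  fun_prop

lemma kernel_pos {mu : ℕ → ℝ} (hmu : ∀ j, 0 < mu j) (n : ℕ) (v : ℝ) : 0 < kernel mu (n + 1) v :=
  Finset.sum_pos (fun i _ => mul_pos (hmu i) (Real.exp_pos _)) ⟨0, by simp⟩

/-- Each term integrates to Γ(1-δ) μ_i^δ: δ < 1 gives integrability at 0, and δ > 0 makes the
geometric sum comparable with its last term. This is the dual factor in the weighted Hölder
inequality. -/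
lemma exists_lintegral_kernel_le {ρ δ : ℝ} (hρ : 1 < ρ) (hδ0 : 0 < δ) (hδ : δ < 1) :
    ∃ C : ℝ, 0 < C ∧ ∀ mu : ℕ → ℝ, (∀ j, 0 < mu j) → (∀ j, ρ * mu j ≤ mu (j + 1)) → ∀ n,
      ∫⁻ v in Set.Ioi (0 : ℝ), ENNReal.ofReal (kernel mu (n + 1) v / v ^ δ) ≤
        ENNReal.ofReal (C * mu n ^ δ) := by
  obtain ⟨C, hC, H⟩ := exists_sum_rpow_le_of_lacunary hρ hδ0
  have hG := Real.Gamma_pos_of_pos (by linarith : 0 < 1 - δ)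
  refine ⟨C * Real.Gamma (1 - δ), by positivity, fun mu hmu hlac n => ?_⟩
  have h1 : ∫⁻ v in Set.Ioi (0 : ℝ), ENNReal.ofReal (kernel mu (n + 1) v / v ^ δ) =
      ∫⁻ v in Set.Ioi (0 : ℝ), ∑ i ∈ Finset.range (n + 1),
        ENNReal.ofReal (mu i * Real.exp (-(mu i * v)) / v ^ δ) := by
    refine setLIntegral_congr_fun measurableSet_Ioi fun v hv => ?_
    have hv' : 0 < v := hv
    rw [kernel, Finset.sum_div, ENNReal.ofReal_sum_of_nonneg]
    intro i _
    have := hmu i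
    positivity
  rw [h1, lintegral_finsetSum _ fun i _ => (by fun_prop)]
  simp_rw [fun i => lintegral_rpow_mul_exp (hmu i) hδ]
  rw [← ENNReal.ofReal_sum_of_nonneg fun i _ => by have := hmu i; positivity]
  refine ENNReal.ofReal_le_ofReal ?_
  rw [← Finset.sum_mul, mul_right_comm]
  refine mul_le_mul_of_nonneg_right ?_ hG.le
  have h2 := H (fun i => mu i / mu n) (fun i => div_pos (hmu i) (hmu n)) (fun i => by
    rw [← mul_div_assoc]; exact div_le_div_of_nonneg_right (hlac i) (hmu n).le) (n + 1)
  have h3 : ∑ i ∈ Finset.range (n + 1), mu i ^ δ = mu n ^ δ * ∑ i ∈ Finset.range (n + 1),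
      min ((mu i / mu n) ^ δ) ((mu i / mu n) ^ (-δ)) := by
    rw [Finset.mul_sum]
    refine Finset.sum_congr rfl fun i hi => ?_
    have hin : mu i ≤ mu n := by
      rcases (Nat.lt_succ_iff.1 (Finset.mem_range.1 hi)).eq_or_lt with rfl | hlt
      · exact le_rfl
      · have := mul_le_of_lacunary_of_lt hρ hmu hlac hlt
        nlinarith [hmu i]
    have hu := div_pos (hmu i) (hmu n)
    have hu1 := (div_le_one (hmu n)).2 hin
    rw [min_eq_left (Real.rpow_le_rpow_of_exponent_ge hu hu1 (by linarith)),
      Real.div_rpow (hmu i).le (hmu n).le, mul_div_cancel₀]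
    exact (Real.rpow_pos_of_pos (hmu n) δ).ne'
  rw [h3, mul_comm]
  exact mul_le_mul_of_nonneg_right h2 (Real.rpow_nonneg (hmu n).le _)

/-- The block extraction functionals are bounded from the weighted `L^s` space to a weighted
`ℓ^s`. -/
lemma exists_sum_lintegral_rpow_le {q ρ α s C₁ : ℝ} (hq : 1 < q) (hρ : 1 < ρ) (hα : 0 < α)
    (hs : 1 ≤ s) (hC₁ : 0 < C₁) :
    ∃ C : ℝ, 0 < C ∧ ∀ (L mu : ℕ → ℝ) (n : ℕ → ℕ), (∀ k, 0 < L k) → (∀ k, q * L k ≤ L (k + 1)) →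
      (∀ j, 0 < mu j) → (∀ j, ρ * mu j ≤ mu (j + 1)) → 2 * (α + 1) ≤ mu 0 →
      (∀ k, mu (n k) ≤ C₁ * L k) → ∀ F : ℝ → ℝ≥0∞, Measurable F → ∀ K : ℕ,
      ∑ k ∈ Finset.range K, ENNReal.ofReal (L k ^ (-α)) *
        (∫⁻ v in Set.Ioi (L k)⁻¹, F v * ENNReal.ofReal (kernel mu (n k + 1) v)) ^ s ≤
      ENNReal.ofReal C * ∫⁻ v in Set.Ioi (0 : ℝ), F v ^ s *
        ENNReal.ofReal (v ^ (α - 1) * Real.exp (-((α + 1) * v))) := by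
  have hs0 : 0 < s := by linarith
  -- Hölder with weight v^δ/kernel costs a factor L_k^{δ(s-1)}. Taking δ this small leaves a
  -- positive power γ = α - δ(s-1) with which to sum over k.
  set δ := min (1 / 2) (α / (2 * s)) with hδ
  have hδ0 : 0 < δ := by positivity
  have hδ1 : δ < 1 := (min_le_left _ _).trans_lt (by norm_num)
  set γ := α - δ * (s - 1) with hγ
  have hγ0 : 0 < γ := by
    have h1 : δ * (2 * s) ≤ α := by
      have := min_le_right (1 / 2) (α / (2 * s))
      rwa [← hδ, le_div_iff₀ (by positivity)] at this
    rw [hγ]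
    nlinarith
  obtain ⟨CM, hCM, HM⟩ := exists_lintegral_kernel_le hρ hδ0 hδ1
  obtain ⟨CK, hCK, HK⟩ := exists_kernel_le hρ
  obtain ⟨CS, hCS, HS⟩ := exists_sum_rpow_le_of_lacunary hq hγ0
  set B := (CM * C₁ ^ δ) ^ (s - 1) with hB
  have hB0 : 0 < B := by positivity
  refine ⟨B * (CS * CK), by positivity, fun L mu n hL hLlac hmu hlac hmu0 hn F hF K => ?_⟩
  set G : ℕ → ℝ → ℝ≥0∞ := fun k v =>
    F v ^ s * ENNReal.ofReal (v ^ (δ * (s - 1)) * kernel mu (n k + 1) v) with hG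
  have hGm : ∀ k, Measurable (G k) := fun k => by
    have := (continuous_kernel mu (n k + 1)).measurable
    exact (hF.pow_const _).mul (((measurable_id.pow_const _).mul this).ennreal_ofReal)
  have h1 : ∀ k, ENNReal.ofReal (L k ^ (-α)) *
      (∫⁻ v in Set.Ioi (L k)⁻¹, F v * ENNReal.ofReal (kernel mu (n k + 1) v)) ^ s ≤
      ENNReal.ofReal B * ∫⁻ v in Set.Ioi (0 : ℝ),
        ENNReal.ofReal (L k ^ (-γ)) * (Set.Ioi (L k)⁻¹).indicator (G k) v := by
    intro k
    have hk := fun v => kernel_pos hmu (n k) v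
    have hLk := hL k
    have hkm := (continuous_kernel mu (n k + 1)).measurable
    have hIoi : Set.Ioi (L k)⁻¹ ⊆ Set.Ioi (0 : ℝ) := Set.Ioi_subset_Ioi (inv_pos.2 hLk).le
    have h2 := lintegral_rpow_le_mul_weight (ν := volume.restrict (Set.Ioi (L k)⁻¹)) hs
      (F := fun v => F v * ENNReal.ofReal (kernel mu (n k + 1) v))
      (hF.mul hkm.ennreal_ofReal).aemeasurable
      (w := fun v => v ^ δ / kernel mu (n k + 1) v) ((measurable_id.pow_const δ).div hkm)
      ((ae_restrict_iff' measurableSet_Ioi).2 (Filter.Eventually.of_forall fun v hv => by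
        have : 0 < v := hIoi hv
        have := hk v
        positivity))
    have h3 : ∫⁻ v in Set.Ioi (L k)⁻¹, (F v * ENNReal.ofReal (kernel mu (n k + 1) v)) ^ s *
        ENNReal.ofReal ((v ^ δ / kernel mu (n k + 1) v) ^ (s - 1)) =
        ∫⁻ v in Set.Ioi (L k)⁻¹, G k v := by
      refine setLIntegral_congr_fun measurableSet_Ioi fun v hv => ?_
      have hv' : 0 < v := hIoi hv
      have hkv := hk v
      simp only [hG]
      rw [ENNReal.mul_rpow_of_nonneg _ _ hs0.le, ENNReal.ofReal_rpow_of_pos hkv, mul_assoc,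
        ← ENNReal.ofReal_mul (by positivity)]
      congr 2
      rw [Real.div_rpow (by positivity) hkv.le, ← Real.rpow_mul hv'.le, Real.rpow_sub hkv,
        Real.rpow_one]
      have := (Real.rpow_pos_of_pos hkv s).ne'
      field_simp
    have h4 : ∫⁻ v in Set.Ioi (L k)⁻¹, ENNReal.ofReal (v ^ δ / kernel mu (n k + 1) v)⁻¹ ≤
        ENNReal.ofReal (CM * (C₁ * L k) ^ δ) := by
      simp_rw [inv_div]
      refine (lintegral_mono_set hIoi).trans ((HM mu hmu hlac (n k)).trans
        (ENNReal.ofReal_le_ofReal ?_))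
      exact mul_le_mul_of_nonneg_left (Real.rpow_le_rpow (hmu _).le (hn k) hδ0.le) hCM.le
    rw [h3] at h2
    have h5 := h2.trans (mul_le_mul_right (ENNReal.rpow_le_rpow h4 (by linarith : 0 ≤ s - 1)) _)
    rw [ENNReal.ofReal_rpow_of_nonneg (by positivity) (by linarith)] at h5
    refine (mul_le_mul_right h5 _).trans (le_of_eq ?_)
    rw [lintegral_const_mul' _ _ ENNReal.ofReal_ne_top, lintegral_indicator measurableSet_Ioi,
      Measure.restrict_restrict measurableSet_Ioi, Set.inter_eq_left.2 hIoi, mul_left_comm,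
      ← ENNReal.ofReal_mul (by positivity), mul_comm, ← mul_assoc,
      ← ENNReal.ofReal_mul (by positivity)]
    congr 2
    rw [Real.mul_rpow hC₁.le hLk.le, ← mul_assoc, Real.mul_rpow (by positivity) (by positivity),
      ← Real.rpow_mul hLk.le, ← hB, mul_left_comm, ← Real.rpow_add hLk]
    congr 2
    rw [hγ]; ring
  refine (Finset.sum_le_sum fun k _ => h1 k).trans ?_
  rw [← Finset.mul_sum, ← lintegral_finsetSum _ fun k _ =>
    ((hGm k).indicator measurableSet_Ioi).const_mul _, ENNReal.ofReal_mul hB0.le, mul_assoc]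
  refine mul_le_mul_right ?_ _
  rw [← lintegral_const_mul' _ _ ENNReal.ofReal_ne_top]
  refine setLIntegral_mono' measurableSet_Ioi fun v hv => ?_
  have hv' : 0 < v := hv
  -- For fixed v only the k with L_k v > 1 contribute, and ∑ (L_k v)^{-γ} over them is bounded by
  -- lacunarity. Together with kernel(v) ≤ C v^{-1} e^{-(α+1)v} this leaves the weight v^{α-1}
  -- e^{-(α+1)v}.
  have hS := HS (fun k => L k * v) (fun k => mul_pos (hL k) hv') (fun k => by
    rw [← mul_assoc]; exact mul_le_mul_of_nonneg_right (hLlac k) hv'.le) K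
  set E := Real.exp (-((α + 1) * v)) with hE
  have hE0 : 0 < E := Real.exp_pos _
  have hterm : ∀ k ∈ Finset.range K,
      ENNReal.ofReal (L k ^ (-γ)) * (Set.Ioi (L k)⁻¹).indicator (G k) v ≤
      F v ^ s * ENNReal.ofReal (CK * (v ^ (α - 1) * E) *
        min ((L k * v) ^ γ) ((L k * v) ^ (-γ))) := by
    intro k _
    have hLk := hL k
    by_cases hvk : v ∈ Set.Ioi (L k)⁻¹
    · rw [Set.indicator_of_mem hvk, hG]
      simp only
      rw [mul_left_comm, ← ENNReal.ofReal_mul (by positivity)]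
      refine mul_le_mul_right (ENNReal.ofReal_le_ofReal ?_) _
      have hu : 1 ≤ L k * v := by
        have h1 : (L k)⁻¹ < v := hvk
        rw [inv_lt_iff_one_lt_mul₀ hLk] at h1
        linarith
      rw [min_eq_right (Real.rpow_le_rpow_of_exponent_le hu (by linarith)),
        Real.mul_rpow hLk.le hv'.le]
      have hker := HK mu (α + 1) hmu hlac hmu0 (n k + 1) v hv'
      calc L k ^ (-γ) * (v ^ (δ * (s - 1)) * kernel mu (n k + 1) v)
          ≤ L k ^ (-γ) * (v ^ (δ * (s - 1)) * (CK * (v⁻¹ * E))) := by gcongr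
        _ = CK * (v ^ (δ * (s - 1)) * v⁻¹ * E) * L k ^ (-γ) := by ring
        _ = CK * (v ^ (α - 1) * v ^ (-γ) * E) * L k ^ (-γ) := by
            rw [← Real.rpow_neg_one v, ← Real.rpow_add hv', ← Real.rpow_add hv']
            congr 4
            rw [hγ]; ring
        _ = _ := by ring
    · rw [Set.indicator_of_notMem hvk, mul_zero]
      exact zero_le
  refine (Finset.sum_le_sum hterm).trans ?_
  rw [← Finset.mul_sum, ← ENNReal.ofReal_sum_of_nonneg fun k _ => by
    have := hL k
    positivity, ← Finset.mul_sum, mul_left_comm (ENNReal.ofReal (CS * CK)), ← ENNReal.ofReal_mul (by positivity)]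
  refine mul_le_mul_right (ENNReal.ofReal_le_ofReal ?_) _
  calc _ ≤ CK * (v ^ (α - 1) * E) * CS := mul_le_mul_of_nonneg_left hS (by positivity)
    _ = _ := by ring

/-- The main estimate: the blocks of an exponential sum are controlled pointwise by quantities
whose weighted `ℓ^s` norm is bounded by the weighted `L^s` norm of the sum. -/
lemma SeparatedBlocks.exists_block_estimate {lam : ℕ → ℝ} {m : ℕ → ℕ} {N : ℕ} {q Q θ α s : ℝ}
    (h : SeparatedBlocks lam m N q Q) (hθ : q⁻¹ < θ) (hθ1 : θ < 1) (hα : 0 < α) (hs : 1 ≤ s) :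
    ∃ C : ℝ, 0 < C ∧ ∀ (c : ℕ → ℂ) (K : ℕ), ∃ D : ℕ → ℝ≥0∞,
      (∀ k < K, ∀ x, 0 ≤ x → ‖expSum (Finset.Ico (m k) (m (k + 1))) lam c x‖ₑ ≤
        D k * ENNReal.ofReal (Real.exp (-(θ * lam (m k) * x)))) ∧
      ∑ k ∈ Finset.range K, ENNReal.ofReal (lam (m k) ^ (-α)) * D k ^ s ≤
        ENNReal.ofReal C * ∫⁻ v in Set.Ioi (0 : ℝ), ‖expSum (Finset.range (m K)) lam c v‖ₑ ^ s *
          ENNReal.ofReal (v ^ (α - 1) * Real.exp (-((α + 1) * v))) := by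
  have hq := h.one_lt
  have hQ := h.one_le_comparable
  have hN : N ≠ 0 := by
    have h1 := h.card 0
    have h2 := h.strictMono_index (Nat.lt_succ_self 0)
    rw [Nat.succ_eq_add_one] at h2
    omega
  set ρ := q ^ ((N : ℝ)⁻¹) with hρdef
  have hρ : 1 < ρ := Real.one_lt_rpow hq (by positivity)
  have hρN : ρ ^ N ≤ q := le_of_eq (Real.rpow_inv_natCast_pow (by linarith) hN)
  -- The factor A raises μ_0 to at least 2(α+1), so that the kernel decays like e^{-(α+1)v}; the
  -- ratio ρ = q^{1/N} was taken so that ρ^N = q.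
  set A := 1 + 2 * (α + 1) / lam 0 with hA
  have hl0 := h.pos 0
  have hA1 : 1 ≤ A := by rw [hA]; linarith [show 0 ≤ 2 * (α + 1) / lam 0 by positivity]
  set mu := lacunaryMajorant lam A ρ with hmu
  have hC₁ : 1 ≤ A * Q * q :=
    one_le_mul_of_one_le_of_one_le (one_le_mul_of_one_le_of_one_le hA1 hQ) hq.le
  have hle : ∀ j, lam j ≤ mu j := fun j =>
    (le_mul_of_one_le_left (h.pos j).le hA1).trans (le_lacunaryMajorant lam A ρ j)
  have hge : ∀ j, mu j ≤ A * Q * q * lam j := h.lacunaryMajorant_le (by linarith) hρ.le hρN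
  have hlac : ∀ j, ρ * mu j ≤ mu (j + 1) := mul_lacunaryMajorant_le lam A ρ
  have hmupos : ∀ j, 0 < mu j := fun j => (h.pos j).trans_le (hle j)
  have hmu0 : 2 * (α + 1) ≤ mu 0 := by
    refine le_trans ?_ (le_lacunaryMajorant lam A ρ 0)
    rw [hA, add_mul, div_mul_cancel₀ _ hl0.ne']
    linarith
  obtain ⟨C, hC, HC⟩ := h.exists_extraction hρ hC₁ hθ hθ1 hle hge hlac
  obtain ⟨C', hC', HC'⟩ := exists_sum_lintegral_rpow_le hq hρ hα hs (by linarith : 0 < A * Q * q)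
  refine ⟨C ^ s * C', by positivity, fun c K => ?_⟩
  set I : ℕ → ℝ≥0∞ := fun k => ∫⁻ v in Set.Ioi (lam (m k))⁻¹,
    ‖expSum (Finset.range (m K)) lam c v‖ₑ * ENNReal.ofReal (kernel mu (m k + 1) v) with hI
  refine ⟨fun k => ENNReal.ofReal C * I k, fun k hk x hx => ?_, ?_⟩
  · refine (HC c k K hk x hx).trans (le_of_eq ?_)
    rw [ENNReal.ofReal_mul hC.le]
    ring
  · have := HC' (fun k => lam (m k)) mu m (fun k => h.pos _) h.leader_lacunary hmupos hlac hmu0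
      (fun k => hge _) (fun v => ‖expSum (Finset.range (m K)) lam c v‖ₑ)
      (continuous_expSum _ lam c).measurable.enorm K
    rw [ENNReal.ofReal_mul (by positivity), mul_assoc]
    refine le_trans (le_of_eq ?_) (mul_le_mul_right this _)
    rw [Finset.mul_sum]
    refine Finset.sum_congr rfl fun k _ => ?_
    rw [ENNReal.mul_rpow_of_nonneg _ _ (by linarith), ENNReal.ofReal_rpow_of_pos hC,
      mul_left_comm]

/-! ### Return to the variable t. -/

/-- The Müntz polynomial `∑ c j * t ^ lam j`. -/
noncomputable def powSum (S : Finset ℕ) (lam : ℕ → ℝ) (c : ℕ → ℂ) (t : ℝ) : ℂ :=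
  ∑ j ∈ S, c j * ((t ^ lam j : ℝ) : ℂ)

lemma measurable_powSum (S : Finset ℕ) (lam : ℕ → ℝ) (c : ℕ → ℂ) : Measurable (powSum S lam c) := by
  unfold powSum
  fun_prop

lemma powSum_exp_neg (S : Finset ℕ) (lam : ℕ → ℝ) (c : ℕ → ℂ) (x : ℝ) :
    powSum S lam c (Real.exp (-x)) = expSum S lam c x := by
  unfold powSum expSum
  refine Finset.sum_congr rfl fun j _ => ?_
  rw [← Real.exp_mul]
  congr 3
  ring

lemma powSum_zero (S : Finset ℕ) {lam : ℕ → ℝ} (hlam : ∀ j, 0 < lam j) (c : ℕ → ℂ) :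
    powSum S lam c 0 = 0 :=
  Finset.sum_eq_zero fun j _ => by rw [Real.zero_rpow (hlam j).ne']; simp

/-- The right side is the density of `nu α` under t = e^{-v}. For α ≤ 1 one uses 1 - e^{-v} ≤ v. For
α > 1 one uses 1 - e^{-v} ≥ v e^{-v}, whose power costs e^{-(α-1)v}; the exponent α+1 on the left
covers both cases. -/
lemma rpow_mul_exp_le {α v : ℝ} (hα : 0 < α) (hv : 0 < v) :
    v ^ (α - 1) * Real.exp (-((α + 1) * v)) ≤
      Real.exp (-v) * (1 - Real.exp (-v)) ^ (α - 1) := by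
  have h1 : 0 < 1 - Real.exp (-v) := by
    rw [sub_pos, Real.exp_lt_one_iff]; linarith
  rcases le_or_gt α 1 with h | h
  · have h2 : 1 - Real.exp (-v) ≤ v := by linarith [Real.add_one_le_exp (-v)]
    have h3 : v ^ (α - 1) ≤ (1 - Real.exp (-v)) ^ (α - 1) :=
      Real.rpow_le_rpow_of_nonpos h1 h2 (by linarith)
    have h4 : Real.exp (-((α + 1) * v)) ≤ Real.exp (-v) := Real.exp_le_exp.2 (by nlinarith)
    rw [mul_comm]
    exact mul_le_mul h4 h3 (by positivity) (Real.exp_pos _).le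
  · have h2 : v * Real.exp (-v) ≤ 1 - Real.exp (-v) := by
      have := Real.add_one_le_exp v
      have h3 : Real.exp v * Real.exp (-v) = 1 := by rw [← Real.exp_add]; simp
      nlinarith [Real.exp_pos (-v)]
    have h3 := Real.rpow_le_rpow (by positivity) h2 (by linarith : 0 ≤ α - 1)
    rw [Real.mul_rpow hv.le (Real.exp_pos _).le, ← Real.exp_mul] at h3
    refine le_trans ?_ (mul_le_mul_of_nonneg_left h3 (Real.exp_pos _).le)
    rw [mul_left_comm, ← Real.exp_add]
    refine mul_le_mul_of_nonneg_left (Real.exp_le_exp.2 ?_) (by positivity)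
    nlinarith

lemma lintegral_exp_neg_le_lintegral_nu {α : ℝ} (hα : 0 < α) {Φ : ℝ → ℝ≥0∞} (hΦ : Measurable Φ) :
    ∫⁻ v in Set.Ioi (0 : ℝ), Φ (Real.exp (-v)) *
      ENNReal.ofReal (v ^ (α - 1) * Real.exp (-((α + 1) * v))) ≤ ∫⁻ t, Φ t ∂(nu α) := by
  have hmeas : Measurable fun x : ℝ => ENNReal.ofReal ((1 - x) ^ (α - 1)) := by fun_prop
  rw [nu, lintegral_withDensity_eq_lintegral_mul _ hmeas hΦ]
  have hsub : (fun v => Real.exp (-v)) '' Set.Ioi (0 : ℝ) ⊆ Set.Icc 0 1 := by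
    rintro _ ⟨v, hv, rfl⟩
    have : 0 < v := hv
    exact ⟨(Real.exp_pos _).le, Real.exp_le_one_iff.2 (by linarith)⟩
  refine le_trans ?_ (lintegral_mono_set hsub)
  rw [lintegral_image_eq_lintegral_abs_deriv_mul measurableSet_Ioi
    (f' := fun v => -Real.exp (-v)) (fun x _ => by
      simpa using ((hasDerivAt_neg x).exp).hasDerivWithinAt)
    (fun x _ y _ hxy => neg_injective (Real.exp_injective hxy))]
  refine setLIntegral_mono' measurableSet_Ioi fun v hv => ?_
  rw [abs_neg, abs_of_pos (Real.exp_pos _), Pi.mul_apply, ← mul_assoc,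
    ← ENNReal.ofReal_mul (Real.exp_pos _).le, mul_comm]
  exact mul_le_mul_left (ENNReal.ofReal_le_ofReal (rpow_mul_exp_le hα hv)) _

/-- The main estimate for blocks, in the variable `t`. -/
lemma SeparatedBlocks.exists_block_estimate_nu {lam : ℕ → ℝ} {m : ℕ → ℕ} {N : ℕ} {q Q θ α s : ℝ}
    (h : SeparatedBlocks lam m N q Q) (hθ : q⁻¹ < θ) (hθ1 : θ < 1) (hα : 0 < α) (hs : 1 ≤ s) :
    ∃ C : ℝ, 0 < C ∧ ∀ (c : ℕ → ℂ) (K : ℕ), ∃ D : ℕ → ℝ≥0∞,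
      (∀ k < K, ∀ t ∈ Set.Icc (0 : ℝ) 1, ‖powSum (Finset.Ico (m k) (m (k + 1))) lam c t‖ₑ ≤
        D k * ENNReal.ofReal (t ^ (θ * lam (m k)))) ∧
      ∑ k ∈ Finset.range K, ENNReal.ofReal (lam (m k) ^ (-α)) * D k ^ s ≤
        ENNReal.ofReal C * ∫⁻ t, ‖powSum (Finset.range (m K)) lam c t‖ₑ ^ s ∂(nu α) := by
  obtain ⟨C, hC, H⟩ := h.exists_block_estimate hθ hθ1 hα hs
  refine ⟨C, hC, fun c K => ?_⟩
  obtain ⟨D, hD, hsum⟩ := H c K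
  refine ⟨D, fun k hk t ht => ?_, hsum.trans (mul_le_mul_right ?_ _)⟩
  · rcases ht.1.eq_or_lt with h0 | h0
    · rw [← h0, powSum_zero _ h.pos]
      simp
    · have e : t = Real.exp (-(-Real.log t)) := by rw [neg_neg, Real.exp_log h0]
      have hx : 0 ≤ -Real.log t := neg_nonneg.2 (Real.log_nonpos h0.le ht.2)
      have := hD k hk _ hx
      rw [← powSum_exp_neg, ← e] at this
      refine this.trans (le_of_eq ?_)
      rw [Real.rpow_def_of_pos h0]
      congr 3
      ring
  · refine le_trans (le_of_eq ?_) (lintegral_exp_neg_le_lintegral_nu hα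
      ((measurable_powSum (Finset.range (m K)) lam c).enorm.pow_const s))
    simp_rw [powSum_exp_neg]

/-! ### Lacunary sums in L^r(μ). -/

/-- With t = e^{-x}, the index m separates the k for which t^{L_k} is bounded below from those for
which it has begun to decay; m = n if no decay occurs in range. -/
lemma exists_threshold {L : ℕ → ℝ} (hL : Monotone L) {x : ℝ} (hx : 0 ≤ x) (n : ℕ) :
    ∃ m ≤ n, (∀ k < m, L k * x ≤ 1) ∧ ∀ k, m ≤ k → k < n → 1 < L k * x := by
  classical
  have hex : ∃ k, n ≤ k ∨ 1 < L k * x := ⟨n, Or.inl le_rfl⟩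
  refine ⟨Nat.find hex, Nat.find_min' hex (Or.inl le_rfl), fun k hk => ?_, fun k hk hkn => ?_⟩
  · have := Nat.find_min hex hk
    push Not at this
    exact this.2
  · rcases Nat.find_spec hex with h | h
    · omega
    · exact h.trans_le (mul_le_mul_of_nonneg_right (hL hk) hx)

lemma monotone_of_lacunary {q : ℝ} (hq : 1 < q) {L : ℕ → ℝ} (hL : ∀ k, 0 < L k)
    (hLlac : ∀ k, q * L k ≤ L (k + 1)) : Monotone L :=
  monotone_nat_of_le_succ fun k => by nlinarith [hL k, hLlac k]

/-- Pointwise domination of the `r`-th power of a lacunary sum. -/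
lemma exists_rpow_sum_le {q τ r θ p : ℝ} (hq : 1 < q) (hτ : 0 < τ) (hr : 1 ≤ r) (hp : 0 < p)
    (hθ : p < r * θ) :
    ∃ C : ℝ, 0 < C ∧ ∀ L : ℕ → ℝ, (∀ k, 0 < L k) → (∀ k, q * L k ≤ L (k + 1)) →
      ∀ (D : ℕ → ℝ≥0∞) (n : ℕ), ∀ t ∈ Set.Icc (0 : ℝ) 1,
      (∑ k ∈ Finset.range n, D k * ENNReal.ofReal (t ^ (θ * L k))) ^ r ≤
        ENNReal.ofReal C * ∑ k ∈ Finset.range n, D k ^ r *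
          ∑ j ∈ Finset.Ico k n, ENNReal.ofReal ((q ^ (τ / 2)) ^ (j - k) * t ^ (p * L j)) := by
  have hr0 : 0 < r := by linarith
  have hq0 : 0 < q := by linarith
  -- The bound may lose g^{j-k}, because the moments later supply L_j^{-τ} ≤ q^{-τ(j-k)} L_k^{-τ} =
  -- g^{-2(j-k)} L_k^{-τ}: half of the gain pays the loss and the other half sums over j.
  set g := q ^ (τ / 2) with hg
  have hg1 : 1 < g := Real.one_lt_rpow hq (by positivity)
  have hg0 : 0 < g := by linarith
  set a := g ^ (-r⁻¹) with ha
  have ha0 : 0 < a := by positivity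
  have ha1 : a < 1 := Real.rpow_lt_one_of_one_lt_of_neg hg1 (by simp [hr0])
  have har : a ^ (-r) = g := by
    rw [ha, ← Real.rpow_mul hg0.le, neg_mul_neg, inv_mul_cancel₀ hr0.ne', Real.rpow_one]
  set η := (r * θ - p) / r with hη
  have hη0 : 0 < η := div_pos (by linarith) hr0
  have hηr : η * r = r * θ - p := by rw [hη]; field_simp
  set W := (1 - a)⁻¹ + 1 / η * (2 / (1 - q⁻¹)) with hW
  have hq1 : 0 < 1 - q⁻¹ := by linarith [inv_lt_one_of_one_lt₀ hq]
  have h1a : 0 < 1 - a := by linarith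
  have hW0 : 0 < W := by positivity
  refine ⟨W ^ (r - 1) * (g * Real.exp p), by positivity, fun L hL hLlac D n t ht => ?_⟩
  have hθ0 : 0 < θ := by
    by_contra hle
    nlinarith
  rcases ht.1.eq_or_lt with h0 | h0
  · have : ∀ k ∈ Finset.range n, D k * ENNReal.ofReal (t ^ (θ * L k)) = 0 := fun k _ => by
      rw [← h0, Real.zero_rpow (mul_pos hθ0 (hL k)).ne']; simp
    rw [Finset.sum_eq_zero this, ENNReal.zero_rpow_of_pos hr0]
    exact zero_le
  set x := -Real.log t with hx
  have hx0 : 0 ≤ x := neg_nonneg.2 (Real.log_nonpos h0.le ht.2)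
  have hpow : ∀ y, t ^ y = Real.exp (-(y * x)) := fun y => by
    rw [Real.rpow_def_of_pos h0, hx]; congr 1; ring
  obtain ⟨m, hmn, hlow, hhigh⟩ := exists_threshold (monotone_of_lacunary hq hL hLlac) hx0 n
  -- Hölder weights with bounded sum: geometric towards the threshold before it, exponentially
  -- decaying after it. The ratio a satisfies a^{-r} = g, and η spends exactly the margin rθ - p.
  set w : ℕ → ℝ := fun k => if k < m then a ^ (m - k) else Real.exp (-(η * (L k * x))) with hw
  have hw0 : ∀ k, 0 < w k := fun k => by
    simp only [hw]; split_ifs <;> positivity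
  have hwsum : ∑ k ∈ Finset.range n, w k ≤ W := by
    have h1 : ∀ k ∈ Finset.range n, w k ≤ (if k < m then a ^ (m - k) else 0) +
        1 / η * min (L k * x) (L k * x)⁻¹ := fun k hk => by
      have hmin : 0 ≤ min (L k * x) (L k * x)⁻¹ := by have := hL k; positivity
      simp only [hw]
      split_ifs with hkm
      · exact le_add_of_nonneg_right (by positivity)
      · have hu := hhigh k (not_lt.1 hkm) (Finset.mem_range.1 hk)
        have hu0 : 0 < L k * x := by linarith
        rw [zero_add, min_eq_right ((inv_le_one_of_one_le₀ hu.le).trans hu.le), Real.exp_neg,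
          one_div, ← mul_inv]
        refine inv_anti₀ (by positivity) ?_
        linarith [Real.add_one_le_exp (η * (L k * x))]
    refine (Finset.sum_le_sum h1).trans ?_
    rw [Finset.sum_add_distrib, ← Finset.mul_sum, hW]
    refine add_le_add ?_ (mul_le_mul_of_nonneg_left ?_ (by positivity))
    · rw [← Finset.sum_filter]
      have h2 : (Finset.range n).filter (· < m) = Finset.range m := by
        ext k; simp only [Finset.mem_filter, Finset.mem_range]; omega
      rw [h2, ← Finset.sum_range_reflect]
      have h3 : ∀ k ∈ Finset.range m, a ^ (m - (m - 1 - k)) ≤ a ^ k := fun k hk => by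
        have := Finset.mem_range.1 hk
        exact pow_le_pow_of_le_one ha0.le ha1.le (by omega)
      refine (Finset.sum_le_sum h3).trans ?_
      rw [← tsum_geometric_of_lt_one ha0.le ha1]
      exact (summable_geometric_of_lt_one ha0.le ha1).sum_le_tsum _ fun k _ => by positivity
    · rcases hx0.eq_or_lt with hx' | hx'
      · simp only [← hx', mul_zero, inv_zero, min_self, Finset.sum_const_zero]
        positivity
      · exact sum_min_inv_le_of_lacunary hq (fun k => mul_pos (hL k) hx') (fun k => by
          rw [← mul_assoc]; exact mul_le_mul_of_nonneg_right (hLlac k) hx'.le) n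
  -- A single term on the right suffices. Before the threshold it is j = m - 1, where t^{pL_j} ≥
  -- e^{-p}; after it, it is j = k.
  have hterm : ∀ k ∈ Finset.range n, w k * (t ^ (θ * L k) / w k) ^ r ≤
      g * Real.exp p * ∑ j ∈ Finset.Ico k n, g ^ (j - k) * t ^ (p * L j) := by
    intro k hk
    have hkn := Finset.mem_range.1 hk
    have hnn : ∀ j ∈ Finset.Ico k n, 0 ≤ g ^ (j - k) * t ^ (p * L j) := fun j _ => by positivity
    have hep : 1 ≤ Real.exp p := Real.one_le_exp hp.le
    by_cases hkm : k < m
    · have hwk : w k = a ^ (m - k) := by simp only [hw]; rw [if_pos hkm]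
      have h1 := Finset.single_le_sum hnn (Finset.mem_Ico.2 ⟨by omega, by omega⟩ :
        m - 1 ∈ Finset.Ico k n)
      refine le_trans ?_ (mul_le_mul_of_nonneg_left h1 (by positivity))
      have h2 : Real.exp (-p) ≤ t ^ (p * L (m - 1)) := by
        rw [hpow]
        refine Real.exp_le_exp.2 ?_
        have := hlow (m - 1) (by omega)
        nlinarith
      have h3 : t ^ (θ * L k) ≤ 1 := Real.rpow_le_one h0.le ht.2 (mul_pos hθ0 (hL k)).le
      have hwk1 : w k ≤ 1 := by rw [hwk]; exact pow_le_one₀ ha0.le ha1.le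
      have h4 : w k * (t ^ (θ * L k) / w k) ^ r ≤ (w k) ^ (-r) := by
        rw [Real.div_rpow (by positivity) (hw0 k).le, Real.rpow_neg (hw0 k).le]
        have h5 : (t ^ (θ * L k)) ^ r ≤ 1 := Real.rpow_le_one (by positivity) h3 hr0.le
        calc w k * ((t ^ (θ * L k)) ^ r / w k ^ r) ≤ 1 * (1 / w k ^ r) := by
              refine mul_le_mul hwk1 (div_le_div_of_nonneg_right h5 ?_) ?_ zero_le_one
              · have := hw0 k; positivity
              · have := hw0 k; positivity
          _ = _ := by rw [one_mul, one_div]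
      have h6 : (w k) ^ (-r) = g * g ^ (m - 1 - k) := by
        rw [hwk, ← Real.rpow_natCast, ← Real.rpow_mul ha0.le, mul_comm, Real.rpow_mul ha0.le, har,
          Real.rpow_natCast, ← pow_succ']
        congr 1
        omega
      rw [h6] at h4
      refine h4.trans ?_
      have h7 : 1 ≤ Real.exp p * t ^ (p * L (m - 1)) := by
        calc 1 = Real.exp p * Real.exp (-p) := by rw [← Real.exp_add]; simp
          _ ≤ _ := mul_le_mul_of_nonneg_left h2 (Real.exp_pos _).le
      calc g * g ^ (m - 1 - k) ≤ g * g ^ (m - 1 - k) * (Real.exp p * t ^ (p * L (m - 1))) :=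
            le_mul_of_one_le_right (by positivity) h7
        _ = _ := by ring
    · have hwk : w k = Real.exp (-(η * (L k * x))) := by simp only [hw]; rw [if_neg hkm]
      have h1 := Finset.single_le_sum hnn (Finset.mem_Ico.2 ⟨le_rfl, hkn⟩)
      have hge : 1 ≤ g * Real.exp p := one_le_mul_of_one_le_of_one_le hg1.le hep
      refine le_trans ?_ (le_trans h1 (le_mul_of_one_le_left (Finset.sum_nonneg hnn) hge))
      rw [Nat.sub_self, pow_zero, one_mul, hwk, hpow, hpow, ← Real.exp_sub, ← Real.exp_mul,
        ← Real.exp_add]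
      refine Real.exp_le_exp.2 ?_
      have hu : 0 ≤ L k * x := mul_nonneg (hL k).le hx0
      have : -(η * (L k * x)) + (-(θ * L k * x) - -(η * (L k * x))) * r =
          (-η + η * r - θ * r) * (L k * x) := by ring
      rw [this, hηr]
      nlinarith
  have hH := ENNReal.inner_le_weight_mul_Lp_of_nonneg (Finset.range n) hr
    (fun k => ENNReal.ofReal (w k)) (fun k => D k * ENNReal.ofReal (t ^ (θ * L k) / w k))
  have h1 : ∀ k, ENNReal.ofReal (w k) * (D k * ENNReal.ofReal (t ^ (θ * L k) / w k)) =
      D k * ENNReal.ofReal (t ^ (θ * L k)) := fun k => by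
    rw [mul_left_comm, ← ENNReal.ofReal_mul (hw0 k).le, mul_div_cancel₀ _ (hw0 k).ne']
  simp_rw [h1] at hH
  have h2 := ENNReal.rpow_le_rpow hH hr0.le
  rw [ENNReal.mul_rpow_of_nonneg _ _ hr0.le, ← ENNReal.rpow_mul, ← ENNReal.rpow_mul,
    inv_mul_cancel₀ hr0.ne', ENNReal.rpow_one, sub_mul, one_mul, inv_mul_cancel₀ hr0.ne'] at h2
  refine h2.trans ?_
  rw [ENNReal.ofReal_mul (by positivity), mul_assoc]
  refine mul_le_mul' ?_ ?_
  · rw [← ENNReal.ofReal_sum_of_nonneg fun k _ => (hw0 k).le,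
      ENNReal.ofReal_rpow_of_nonneg (Finset.sum_nonneg fun k _ => (hw0 k).le) (by linarith)]
    exact ENNReal.ofReal_le_ofReal (Real.rpow_le_rpow (Finset.sum_nonneg fun k _ => (hw0 k).le)
      hwsum (by linarith))
  · rw [Finset.mul_sum]
    refine Finset.sum_le_sum fun k hk => ?_
    rw [ENNReal.mul_rpow_of_nonneg _ _ hr0.le, mul_left_comm, mul_left_comm (ENNReal.ofReal _)]
    refine mul_le_mul_right ?_ _
    have hwk := hw0 k
    rw [ENNReal.ofReal_rpow_of_nonneg (by positivity) hr0.le, ← ENNReal.ofReal_mul hwk.le,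
      ← ENNReal.ofReal_sum_of_nonneg fun j _ => by positivity, ← ENNReal.ofReal_mul (by positivity)]
    exact ENNReal.ofReal_le_ofReal (hterm k hk)

lemma lintegral_le_of_moment {L τ : ℝ} (hL : 0 < L) {I B : ℝ≥0∞}
    (h : ENNReal.ofReal (L ^ τ) * I ≤ B) : I ≤ ENNReal.ofReal (L ^ (-τ)) * B := by
  calc I = ENNReal.ofReal (L ^ (-τ)) * (ENNReal.ofReal (L ^ τ) * I) := by
        rw [← mul_assoc, ← ENNReal.ofReal_mul (by positivity), ← Real.rpow_add hL]
        simp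
    _ ≤ _ := mul_le_mul_right h _

/-- A lacunary sum in `L^r(μ)`, when the moments of `μ` decay and `r` is large. -/
lemma exists_lintegral_rpow_sum_le {q τ r θ p : ℝ} (hq : 1 < q) (hτ : 0 < τ) (hr : 1 ≤ r)
    (hp : 0 < p) (hθ : p < r * θ) :
    ∃ C : ℝ, 0 < C ∧ ∀ L : ℕ → ℝ, (∀ k, 0 < L k) → (∀ k, q * L k ≤ L (k + 1)) →
      ∀ (μ : Measure ℝ) (B : ℝ≥0∞) (D : ℕ → ℝ≥0∞) (n : ℕ),
      (∀ k < n, ENNReal.ofReal (L k ^ τ) *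
        ∫⁻ t in Set.Icc (0 : ℝ) 1, ENNReal.ofReal (t ^ (p * L k)) ∂μ ≤ B) →
      ∫⁻ t in Set.Icc (0 : ℝ) 1,
        (∑ k ∈ Finset.range n, D k * ENNReal.ofReal (t ^ (θ * L k))) ^ r ∂μ ≤
      ENNReal.ofReal C * B * ∑ k ∈ Finset.range n, ENNReal.ofReal (L k ^ (-τ)) * D k ^ r := by
  obtain ⟨C, hC, H⟩ := exists_rpow_sum_le hq hτ hr hp hθ
  have hq0 : 0 < q := by linarith
  set g := q ^ (τ / 2) with hg
  have hg1 : 1 < g := Real.one_lt_rpow hq (by positivity)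
  have hg0 : 0 < g := by linarith
  have hgi0 : 0 < g⁻¹ := inv_pos.2 hg0
  have hgi : g⁻¹ < 1 := inv_lt_one_of_one_lt₀ hg1
  have h1g : 0 < 1 - g⁻¹ := by linarith
  have hgg : q ^ (-τ) = g⁻¹ * g⁻¹ := by
    rw [hg, ← Real.rpow_neg hq0.le, ← Real.rpow_add hq0]; congr 1; ring
  refine ⟨C * (1 - g⁻¹)⁻¹, by positivity, fun L hL hLlac μ B D n hB => ?_⟩
  refine (setLIntegral_mono' measurableSet_Icc fun t ht => H L hL hLlac D n t ht).trans ?_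
  rw [lintegral_const_mul' _ _ ENNReal.ofReal_ne_top, lintegral_finsetSum _ fun k _ => by fun_prop,
    ENNReal.ofReal_mul hC.le, mul_assoc, mul_assoc]
  refine mul_le_mul_right ?_ _
  rw [mul_left_comm, Finset.mul_sum, Finset.mul_sum]
  refine Finset.sum_le_sum fun k hk => ?_
  rw [lintegral_const_mul _ (by fun_prop), lintegral_finsetSum _ fun k _ => by fun_prop]
  have hj : ∀ j ∈ Finset.Ico k n, ∫⁻ t in Set.Icc (0 : ℝ) 1,
      ENNReal.ofReal (g ^ (j - k) * t ^ (p * L j)) ∂μ ≤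
      B * ENNReal.ofReal (L k ^ (-τ)) * ENNReal.ofReal (g⁻¹ ^ (j - k)) := by
    intro j hj
    obtain ⟨hkj, hjn⟩ := Finset.mem_Ico.1 hj
    simp_rw [ENNReal.ofReal_mul (pow_nonneg hg0.le (j - k))]
    rw [lintegral_const_mul' _ _ ENNReal.ofReal_ne_top]
    refine (mul_le_mul_right (lintegral_le_of_moment (hL j) (hB j hjn)) _).trans ?_
    rw [← mul_assoc, ← ENNReal.ofReal_mul (by positivity), mul_comm _ B, mul_assoc B,
      ← ENNReal.ofReal_mul (Real.rpow_nonneg (hL k).le _)]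
    refine mul_le_mul_right (ENNReal.ofReal_le_ofReal ?_) _
    have h1 := pow_mul_le_of_lacunary hq0.le hLlac k (j - k)
    rw [Nat.add_sub_cancel' hkj] at h1
    have hLk := hL k
    have h2 : L j ^ (-τ) ≤ (q ^ (j - k) * L k) ^ (-τ) :=
      Real.rpow_le_rpow_of_nonpos (by positivity) h1 (by linarith)
    have h3 : (q ^ (j - k) * L k) ^ (-τ) = (g⁻¹ * g⁻¹) ^ (j - k) * L k ^ (-τ) := by
      rw [Real.mul_rpow (by positivity) hLk.le, ← hgg, ← Real.rpow_natCast, ← Real.rpow_natCast,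
        ← Real.rpow_mul hq0.le, ← Real.rpow_mul hq0.le, mul_comm (-τ)]
    rw [h3] at h2
    refine (mul_le_mul_of_nonneg_left h2 (by positivity)).trans (le_of_eq ?_)
    rw [mul_pow, inv_pow]
    field_simp
  refine (mul_le_mul_right (Finset.sum_le_sum hj) _).trans ?_
  rw [← Finset.mul_sum, ← ENNReal.ofReal_sum_of_nonneg fun j _ => by positivity]
  have hgeo : ∑ j ∈ Finset.Ico k n, g⁻¹ ^ (j - k) ≤ (1 - g⁻¹)⁻¹ := by
    rw [Finset.sum_Ico_eq_sum_range]
    simp only [add_tsub_cancel_left]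
    rw [← tsum_geometric_of_lt_one hgi0.le hgi]
    exact (summable_geometric_of_lt_one hgi0.le hgi).sum_le_tsum _ fun k _ => by positivity
  refine (mul_le_mul_right (mul_le_mul_right (ENNReal.ofReal_le_ofReal hgeo) _) _).trans
    (le_of_eq ?_)
  ring

/-- A lacunary sum in `L^β(μ)`, when the coefficients are summable. -/
lemma lintegral_rpow_sum_le_of_le {α β p : ℝ} (hβ : 1 ≤ β) (hp : 0 < p) (hpβ : p ≤ β)
    {L : ℕ → ℝ} (hL : ∀ k, 0 < L k) {μ : Measure ℝ} {B : ℝ≥0∞} (D : ℕ → ℝ≥0∞) {n : ℕ}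
    (hB : ∀ k < n, ENNReal.ofReal (L k ^ (α * β)) *
        ∫⁻ t in Set.Icc (0 : ℝ) 1, ENNReal.ofReal (t ^ (p * L k)) ∂μ ≤ B) :
    ∫⁻ t in Set.Icc (0 : ℝ) 1,
        (∑ k ∈ Finset.range n, D k * ENNReal.ofReal (t ^ L k)) ^ β ∂μ ≤
      B * (∑ k ∈ Finset.range n, ENNReal.ofReal (L k ^ (-α)) * D k) ^ β := by
  have hβ0 : 0 < β := by linarith
  -- Jensen with weights L_k^{-α} D_k, whose sum is finite in the case of use s = 1. It leaves
  -- L_k^{αβ} t^{βL_k}, and t^{βL_k} ≤ t^{pL_k} is integrated by the moment condition, with no need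
  -- for p < β.
  set w : ℕ → ℝ≥0∞ := fun k => ENNReal.ofReal (L k ^ (-α)) * D k with hw
  set W := ∑ k ∈ Finset.range n, w k with hW
  have hpt : ∀ t ∈ Set.Icc (0 : ℝ) 1, (∑ k ∈ Finset.range n, D k * ENNReal.ofReal (t ^ L k)) ^ β ≤
      W ^ (β - 1) * ∑ k ∈ Finset.range n,
        w k * (ENNReal.ofReal (L k ^ (α * β)) * ENNReal.ofReal (t ^ (p * L k))) := by
    intro t ht
    have h1 := ENNReal.inner_le_weight_mul_Lp_of_nonneg (Finset.range n) hβ w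
      (fun k => ENNReal.ofReal (L k ^ α * t ^ L k))
    have e : ∀ k, w k * ENNReal.ofReal (L k ^ α * t ^ L k) =
        D k * ENNReal.ofReal (t ^ L k) := fun k => by
      have hLk := hL k
      simp only [hw]
      rw [mul_comm (ENNReal.ofReal _) (D k), mul_assoc, ← ENNReal.ofReal_mul (by positivity),
        ← mul_assoc, ← Real.rpow_add hLk]
      simp
    simp_rw [e] at h1
    have h2 := ENNReal.rpow_le_rpow h1 hβ0.le
    rw [ENNReal.mul_rpow_of_nonneg _ _ hβ0.le, ← ENNReal.rpow_mul, ← ENNReal.rpow_mul,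
      inv_mul_cancel₀ hβ0.ne', ENNReal.rpow_one, sub_mul, one_mul, inv_mul_cancel₀ hβ0.ne'] at h2
    refine h2.trans (mul_le_mul_right (Finset.sum_le_sum fun k _ => mul_le_mul_right ?_ _) _)
    have hLk := hL k
    have ht0 := ht.1
    rw [ENNReal.ofReal_rpow_of_nonneg (by positivity) hβ0.le, ← ENNReal.ofReal_mul (by positivity),
      Real.mul_rpow (by positivity) (by positivity), ← Real.rpow_mul hLk.le, ← Real.rpow_mul ht0]
    refine ENNReal.ofReal_le_ofReal (mul_le_mul_of_nonneg_left ?_ (by positivity))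
    refine Real.rpow_le_rpow_of_exponent_ge_of_imp ht0 ht.2 (by nlinarith) fun _ h0 => ?_
    nlinarith [mul_pos hp hLk]
  refine (setLIntegral_mono' measurableSet_Icc hpt).trans ?_
  rw [lintegral_const_mul _ (Finset.measurable_fun_sum _ fun k _ => by fun_prop),
    lintegral_finsetSum _ fun k _ => by fun_prop]
  have h3 : ∀ k ∈ Finset.range n, ∫⁻ t in Set.Icc (0 : ℝ) 1,
      w k * (ENNReal.ofReal (L k ^ (α * β)) * ENNReal.ofReal (t ^ (p * L k))) ∂μ ≤ w k * B := by
    intro k hk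
    rw [lintegral_const_mul _ (by fun_prop), lintegral_const_mul' _ _ ENNReal.ofReal_ne_top]
    exact mul_le_mul_right (hB k (Finset.mem_range.1 hk)) _
  refine (mul_le_mul_right (Finset.sum_le_sum h3) _).trans (le_of_eq ?_)
  rw [← Finset.sum_mul, ← hW, mul_comm W, mul_left_comm]
  congr 1
  nth_rewrite 2 [← ENNReal.rpow_one W]
  rw [← ENNReal.rpow_add_of_nonneg _ _ (by linarith) zero_le_one]
  congr 1
  ring

lemma sum_rpow_le_rpow_sum {ι : Type*} (s : Finset ι) (f : ι → ℝ≥0∞) {β : ℝ} (hβ : 1 ≤ β) :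
    ∑ i ∈ s, f i ^ β ≤ (∑ i ∈ s, f i) ^ β := by
  classical
  induction s using Finset.induction_on with
  | empty => simp
  | insert i s hi ih =>
    rw [Finset.sum_insert hi, Finset.sum_insert hi]
    exact (add_le_add_right ih _).trans (ENNReal.add_rpow_le_rpow_add _ _ hβ)

lemma powSum_Ico_eq_sum {m : ℕ → ℕ} (hm : Monotone m) (lam : ℕ → ℝ) (c : ℕ → ℂ) {a b : ℕ}
    (hab : a ≤ b) (t : ℝ) :
    powSum (Finset.Ico (m a) (m b)) lam c t =
      ∑ k ∈ Finset.Ico a b, powSum (Finset.Ico (m k) (m (k + 1))) lam c t := by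
  induction b, hab using Nat.le_induction with
  | base => simp [powSum]
  | succ b hab ih =>
    rw [Finset.sum_Ico_succ_top hab, ← ih]
    exact (Finset.sum_Ico_consecutive _ (hm hab) (hm (Nat.le_succ b))).symm

/-- The embedding inequality for the tails of Müntz polynomials. -/
lemma SeparatedBlocks.exists_embedding_bound {lam : ℕ → ℝ} {m : ℕ → ℕ} {N : ℕ} {q Q α β s p : ℝ}
    (h : SeparatedBlocks lam m N q Q) (hα : 0 < α) (hβ : 1 ≤ β) (hs : 1 ≤ s) (hp : 0 < p)
    (hcase : p < s * β ∨ (s = 1 ∧ p ≤ β ∧ N = 1)) :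
    ∃ C : ℝ, 0 < C ∧ ∀ (μ : Measure ℝ) (B : ℝ≥0∞) (K₀ : ℕ),
      (∀ k, K₀ ≤ k → moment lam m p α β μ k ≤ B) → ∀ (c : ℕ → ℂ) (K : ℕ), K₀ ≤ K →
      ∫⁻ t in Set.Icc (0 : ℝ) 1, ‖powSum (Finset.Ico (m K₀) (m K)) lam c t‖ₑ ^ (s * β) ∂μ ≤
        ENNReal.ofReal C * B * (∫⁻ t, ‖powSum (Finset.range (m K)) lam c t‖ₑ ^ s ∂(nu α)) ^ β := by
  have hq := h.one_lt
  have hq1 : q⁻¹ < 1 := inv_lt_one_of_one_lt₀ hq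
  have hs0 : 0 < s := by linarith
  have hβ0 : 0 < β := by linarith
  have hL : ∀ K₀ i, 0 < lam (m (K₀ + i)) := fun _ _ => h.pos _
  have hLlac : ∀ K₀ i, q * lam (m (K₀ + i)) ≤ lam (m (K₀ + (i + 1))) := fun K₀ i =>
    h.leader_lacunary _
  have hsplit : ∀ (c : ℕ → ℂ) (K₀ K : ℕ), K₀ ≤ K → ∀ (E : ℕ → ℝ≥0∞) (t : ℝ),
      (∀ k < K, ‖powSum (Finset.Ico (m k) (m (k + 1))) lam c t‖ₑ ≤ E k) →
      ‖powSum (Finset.Ico (m K₀) (m K)) lam c t‖ₑ ≤ ∑ i ∈ Finset.range (K - K₀), E (K₀ + i) := by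
    intro c K₀ K hK E t hE
    rw [powSum_Ico_eq_sum h.strictMono_index.monotone lam c hK, Finset.sum_Ico_eq_sum_range]
    refine (enorm_sum_le _ _).trans (Finset.sum_le_sum fun i hi => hE _ ?_)
    have := Finset.mem_range.1 hi
    omega
  have htail : ∀ (G : ℕ → ℝ≥0∞) (K₀ K : ℕ), K₀ ≤ K →
      ∑ i ∈ Finset.range (K - K₀), G (K₀ + i) ≤ ∑ k ∈ Finset.range K, G k := by
    intro G K₀ K hK
    rw [← Finset.sum_Ico_eq_sum_range]
    refine Finset.sum_le_sum_of_subset fun k hk => ?_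
    exact Finset.mem_range.2 (Finset.mem_Ico.1 hk).2
  rcases hcase with hlt | ⟨rfl, hpβ, rfl⟩
  -- Since p < sβ, a θ < 1 can be taken so close to 1 that p < sβθ still holds.
  · obtain ⟨θ, hθ, hθ1⟩ : ∃ θ, max q⁻¹ (p / (s * β)) < θ ∧ θ < 1 :=
      exists_between (max_lt hq1 ((div_lt_one (by positivity)).2 hlt))
    obtain ⟨hθq, hθp⟩ := max_lt_iff.1 hθ
    rw [div_lt_iff₀' (by positivity)] at hθp
    have hr : 1 ≤ s * β := one_le_mul_of_one_le_of_one_le hs hβ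
    obtain ⟨C₁, hC₁, H₁⟩ := h.exists_block_estimate_nu hθq hθ1 hα hs
    obtain ⟨C₂, hC₂, H₂⟩ := exists_lintegral_rpow_sum_le hq (mul_pos hα hβ0) hr hp hθp
    refine ⟨C₂ * C₁ ^ β, by positivity, fun μ B K₀ hB c K hK => ?_⟩
    obtain ⟨D, hD, hsum⟩ := H₁ c K
    have h3 := H₂ (fun i => lam (m (K₀ + i))) (hL K₀) (hLlac K₀) μ B (fun i => D (K₀ + i)) (K - K₀)
      (fun k _ => hB (K₀ + k) (Nat.le_add_right _ _))
    -- The passage from exponent s to sβ is ∑ x_k^β ≤ (∑ x_k)^β, applied to x_k = L_k^{-α} D_k^s.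
    have h4 : ∑ i ∈ Finset.range (K - K₀), ENNReal.ofReal (lam (m (K₀ + i)) ^ (-(α * β))) *
        D (K₀ + i) ^ (s * β) ≤
        (ENNReal.ofReal C₁ * ∫⁻ t, ‖powSum (Finset.range (m K)) lam c t‖ₑ ^ s ∂(nu α)) ^ β := by
      refine (htail (fun k => ENNReal.ofReal (lam (m k) ^ (-(α * β))) * D k ^ (s * β)) K₀ K hK).trans
        (le_trans ?_ (ENNReal.rpow_le_rpow hsum hβ0.le))
      refine le_trans (le_of_eq (Finset.sum_congr rfl fun k _ => ?_)) (sum_rpow_le_rpow_sum _ _ hβ)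
      have := h.pos (m k)
      rw [ENNReal.mul_rpow_of_nonneg _ _ hβ0.le, ENNReal.ofReal_rpow_of_pos (by positivity),
        ← Real.rpow_mul this.le, ENNReal.rpow_mul, neg_mul]
    refine (setLIntegral_mono' measurableSet_Icc fun t ht => ENNReal.rpow_le_rpow
      (hsplit c K₀ K hK _ t fun k hk => hD k hk t ht) (by positivity)).trans (h3.trans ?_)
    refine (mul_le_mul_right h4 _).trans (le_of_eq ?_)
    rw [ENNReal.mul_rpow_of_nonneg _ _ hβ0.le, ENNReal.ofReal_rpow_of_pos hC₁,
      ENNReal.ofReal_mul hC₂.le]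
    ring
  · obtain ⟨θ, hθq, hθ1⟩ := exists_between hq1
    obtain ⟨C₁, hC₁, H₁⟩ := h.exists_block_estimate_nu hθq hθ1 hα le_rfl
    refine ⟨C₁ ^ β, by positivity, fun μ B K₀ hB c K hK => ?_⟩
    obtain ⟨D, hD, hsum⟩ := H₁ c K
    have hcard : ∀ k, Finset.Ico (m k) (m (k + 1)) = {m k} := fun k => by
      have h1 := h.card k
      have h2 := h.strictMono_index (Nat.lt_succ_self k)
      rw [Nat.succ_eq_add_one] at h2
      rw [(by omega : m (k + 1) = m k + 1)]
      exact Nat.Ico_succ_singleton _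
    -- A block is now a single monomial, and the estimate at t = 1 bounds its coefficient by D_k.
    -- The decay therefore holds with θ = 1, which the endpoint needs.
    have hD' : ∀ k < K, ∀ t ∈ Set.Icc (0 : ℝ) 1,
        ‖powSum (Finset.Ico (m k) (m (k + 1))) lam c t‖ₑ ≤ D k * ENNReal.ofReal (t ^ lam (m k)) := by
      intro k hk t ht
      have h1 := hD k hk 1 ⟨zero_le_one, le_rfl⟩
      rw [hcard] at h1 ⊢
      simp only [powSum, Finset.sum_singleton, Real.one_rpow, Complex.ofReal_one, mul_one,
        ENNReal.ofReal_one] at h1 ⊢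
      rw [enorm_mul]
      refine mul_le_mul' h1 (le_of_eq ?_)
      rw [← ofReal_norm, Complex.norm_real, Real.norm_of_nonneg (Real.rpow_nonneg ht.1 _)]
    have h3 := lintegral_rpow_sum_le_of_le hβ hp hpβ (hL K₀) (fun i => D (K₀ + i)) (n := K - K₀)
      (fun k _ => hB (K₀ + k) (Nat.le_add_right _ _))
    simp only [ENNReal.rpow_one] at hsum
    simp only [one_mul, ENNReal.rpow_one]
    refine (setLIntegral_mono' measurableSet_Icc fun t ht => ENNReal.rpow_le_rpow
      (hsplit c K₀ K hK _ t fun k hk => hD' k hk t ht) hβ0.le).trans (h3.trans ?_)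
    refine (mul_le_mul_right (ENNReal.rpow_le_rpow ((htail
      (fun k => ENNReal.ofReal (lam (m k) ^ (-α)) * D k) K₀ K hK).trans hsum) hβ0.le) _).trans
      (le_of_eq ?_)
    rw [ENNReal.mul_rpow_of_nonneg _ _ hβ0.le, ENNReal.ofReal_rpow_of_pos hC₁]
    ring

/-! ### Regrouping a quasi-lacunary sequence into separated blocks. -/

lemma exists_one_lt_le {f : ℕ → ℝ} {q : ℝ} (hf : ∀ k, 1 < f k) (hq : 1 < q)
    (h : ∀ᶠ k in atTop, q < f k) : ∃ q' : ℝ, 1 < q' ∧ ∀ k, q' ≤ f k := by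
  obtain ⟨k₀, hk₀⟩ := eventually_atTop.1 h
  have hfin : ∀ n : ℕ, ∃ q' : ℝ, 1 < q' ∧ ∀ k < n, q' ≤ f k := by
    intro n
    induction n with
    | zero => exact ⟨q, hq, fun k hk => absurd hk (Nat.not_lt_zero k)⟩
    | succ n ih =>
      obtain ⟨q', hq', H⟩ := ih
      refine ⟨min q' (f n), lt_min hq' (hf n), fun k hk => ?_⟩
      rcases (Nat.lt_succ_iff.1 hk).eq_or_lt with rfl | hlt
      · exact min_le_right _ _
      · exact (min_le_left _ _).trans (H k hlt)
  obtain ⟨q', hq', H⟩ := hfin k₀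
  refine ⟨min q' q, lt_min hq' hq, fun k => ?_⟩
  rcases lt_or_ge k k₀ with hk | hk
  · exact (min_le_left _ _).trans (H k hk)
  · exact (min_le_right _ _).trans (hk₀ k hk).le

/-- A quasi-lacunary sequence with comparable blocks can be cut into separated blocks; the new
leading exponents are comparable with old ones. -/
lemma IsQuasiLacunary.exists_separatedBlocks {lam : ℕ → ℝ} {n : ℕ → ℕ} {N : ℕ} {q : ℝ}
    (hΛ : IsQuasiLacunary lam n N q) (hblocks : HasComparableBlocks lam n) :
    ∃ (m : ℕ → ℕ) (q' Q Q' : ℝ), SeparatedBlocks lam m (2 * N - 1) q' Q' ∧ 1 ≤ Q ∧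
      ∀ k, ∃ k', k ≤ k' + 1 ∧ lam (n k') ≤ lam (m k) ∧ lam (m k) ≤ Q * lam (n k') := by
  obtain ⟨Q, hQ⟩ := hblocks
  have hnlt : ∀ k, n k < n (k + 1) := fun k => hΛ.strictMono_index (Nat.lt_succ_self k)
  have hmono := hΛ.strictMono.monotone
  have hQ1 : 1 ≤ Q := by
    have h1 := hQ 0 (n 0) le_rfl (hnlt 0)
    have h2 := hΛ.pos (n 0)
    by_contra hlt
    nlinarith
  have hN : N ≠ 0 := by
    have := hΛ.block_card 0
    have := hnlt 0
    rw [zero_add] at *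
    omega
  obtain ⟨q₁, hq₁, hq₁le⟩ := exists_one_lt_le (f := fun k => lam (n (k + 1)) / lam (n k))
    (fun k => (one_lt_div (hΛ.pos _)).2 (hΛ.strictMono (hnlt k))) hΛ.one_lt hΛ.ratio
  have hratio : ∀ k, q₁ * lam (n k) ≤ lam (n (k + 1)) := fun k =>
    (le_div_iff₀ (hΛ.pos _)).1 (hq₁le k)
  set q₂ := q₁ ^ ((N : ℝ)⁻¹) with hq₂def
  have hq₂ : 1 < q₂ := Real.one_lt_rpow hq₁ (by positivity)
  have hq₂N : q₂ ^ N = q₁ := Real.rpow_inv_natCast_pow (by linarith) hN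
  have hJ : ∀ k, ∃ j, n k < j ∧ j ≤ n (k + 1) ∧ q₂ * lam (j - 1) ≤ lam j ∧
      (j = n (k + 1) ∨ lam (n (k + 1)) ≤ Q * q₂ * lam (n k)) := by
    intro k
    by_cases hbig : Q * q₂ * lam (n k) < lam (n (k + 1))
    · refine ⟨n (k + 1), hnlt k, le_rfl, ?_, Or.inl rfl⟩
      have h1 := hQ k (n (k + 1) - 1) (by have := hnlt k; omega) (by have := hnlt k; omega)
      calc q₂ * lam (n (k + 1) - 1) ≤ q₂ * (Q * lam (n k)) :=
            mul_le_mul_of_nonneg_left h1 (by linarith)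
        _ = Q * q₂ * lam (n k) := by ring
        _ ≤ _ := hbig.le
    · by_contra hno
      push Not at hno hbig
      have hlt : ∀ j, n k < j → j ≤ n (k + 1) → lam j < q₂ * lam (j - 1) := fun j h1 h2 => by
        by_contra hle
        exact absurd (hno j h1 h2 (not_lt.1 hle)).2 (not_lt.2 hbig)
      have hpow : ∀ i, n k + i ≤ n (k + 1) → lam (n k + i) ≤ q₂ ^ i * lam (n k) := by
        intro i
        induction i with
        | zero => intro _; simp
        | succ i ih =>
          intro hi
          have h1 := hlt (n k + (i + 1)) (by omega) hi
          have h2 := ih (by omega)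
          rw [show n k + (i + 1) - 1 = n k + i by omega] at h1
          refine h1.le.trans ((mul_le_mul_of_nonneg_left h2 (by linarith)).trans (le_of_eq ?_))
          ring
      have hlast := hlt (n (k + 1)) (hnlt k) le_rfl
      obtain ⟨i, hi⟩ : ∃ i, n (k + 1) = n k + i + 1 := ⟨n (k + 1) - n k - 1, by
        have := hnlt k; omega⟩
      have h3 := hpow i (by omega)
      rw [show n (k + 1) - 1 = n k + i by omega] at hlast
      have hcard := hΛ.block_card k
      have h4 : q₂ ^ (i + 1) ≤ q₁ := hq₂N ▸ pow_le_pow_right₀ hq₂.le (by omega)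
      have h5 := hratio k
      have h6 := hΛ.pos (n k)
      have h7 : q₂ * lam (n k + i) ≤ q₂ ^ (i + 1) * lam (n k) :=
        (mul_le_mul_of_nonneg_left h3 (by linarith)).trans (le_of_eq (by ring))
      have h8 := mul_le_mul_of_nonneg_right h4 h6.le
      linarith
  choose J hJ1 hJ2 hJ3 hJ4 using hJ
  -- The block [J k, J (k+1)) meets at most two old blocks. As J k > n k and J (k+1) ≤ n (k+2), it
  -- has at most 2N - 1 exponents; in particular N = 1 still gives singletons.
  set m : ℕ → ℕ := fun k => Nat.casesOn k 0 J with hm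
  have hm0 : m 0 = 0 := rfl
  have hmS : ∀ k, m (k + 1) = J k := fun _ => rfl
  have hmn : ∀ k, m k ≤ n k := fun k => by
    cases k with
    | zero => exact Nat.zero_le _
    | succ k => exact hJ2 k
  refine ⟨m, q₂, Q, Q * (Q * q₂), ⟨hΛ.pos, hΛ.strictMono, ?_, hm0, ?_, hq₂, hJ3, ?_⟩, hQ1, ?_⟩
  · exact strictMono_nat_of_lt_succ fun k => (hmn k).trans_lt (hJ1 k)
  · intro k
    have h1 := hJ2 k
    have h2 := hΛ.block_card k
    cases k with
    | zero =>
      rw [hmS, hm0]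
      rw [hΛ.index_zero] at h2
      omega
    | succ k =>
      have h3 := hΛ.block_card k
      have h4 := hJ1 k
      have h5 := hJ2 k
      rw [hmS, hmS]
      omega
  · intro k j hj1 hj2
    have hQq : 1 ≤ Q * q₂ := one_le_mul_of_one_le_of_one_le hQ1 hq₂.le
    have hjn : j < n (k + 1) := hj2.trans_le (hJ2 k)
    cases k with
    | zero =>
      have h1 := hQ 0 j (by rw [hΛ.index_zero]; exact Nat.zero_le _) hjn
      rw [hΛ.index_zero] at h1
      rw [hm0]
      have h2 := hΛ.pos 0
      refine h1.trans ?_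
      rw [mul_assoc]
      exact mul_le_mul_of_nonneg_left (le_mul_of_one_le_left h2.le hQq) (by linarith)
    | succ k =>
      rw [hmS] at hj1 ⊢
      have hJp := hΛ.pos (J k)
      have h3 : lam (n (k + 1)) ≤ Q * q₂ * lam (J k) := by
        rcases hJ4 k with h | h
        · rw [← h]; exact le_mul_of_one_le_left hJp.le hQq
        · exact h.trans (mul_le_mul_of_nonneg_left (hmono (hJ1 k).le) (by linarith))
      have h4 : lam j ≤ Q * lam (n (k + 1)) := by
        rcases le_or_gt (n (k + 1)) j with h | h
        · exact hQ (k + 1) j h hjn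
        · exact (hmono h.le).trans (le_mul_of_one_le_left (hΛ.pos _).le hQ1)
      rw [mul_assoc]
      exact h4.trans (mul_le_mul_of_nonneg_left h3 (by linarith))
  · intro k
    cases k with
    | zero =>
      refine ⟨0, Nat.zero_le _, ?_, ?_⟩
      · rw [hm0, hΛ.index_zero]
      · rw [hm0, hΛ.index_zero]; exact le_mul_of_one_le_left (hΛ.pos _).le hQ1
    | succ k =>
      rw [hmS]
      rcases (hJ2 k).eq_or_lt with h | h
      · refine ⟨k + 1, by omega, by rw [h], ?_⟩
        rw [h]; exact le_mul_of_one_le_left (hΛ.pos _).le hQ1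
      · exact ⟨k, le_rfl, hmono (hJ1 k).le, hQ k (J k) (hJ1 k).le h⟩

lemma moment_le_of_comparable {lam : ℕ → ℝ} {m n : ℕ → ℕ} {p α β Q : ℝ} {μ : Measure ℝ} {k k' : ℕ}
    (hlam : ∀ j, 0 < lam j) (hp : 0 < p) (hαβ : 0 ≤ α * β) (hQ : 1 ≤ Q)
    (h1 : lam (n k') ≤ lam (m k)) (h2 : lam (m k) ≤ Q * lam (n k')) :
    moment lam m p α β μ k ≤ ENNReal.ofReal (Q ^ (α * β)) * moment lam n p α β μ k' := by
  have hn := hlam (n k')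
  have hm := hlam (m k)
  rw [moment, moment, ← mul_assoc, ← ENNReal.ofReal_mul (by positivity),
    ← Real.mul_rpow (by positivity) hn.le]
  refine mul_le_mul' (ENNReal.ofReal_le_ofReal (Real.rpow_le_rpow hm.le h2 hαβ)) ?_
  refine setLIntegral_mono' measurableSet_Icc fun t ht => ENNReal.ofReal_le_ofReal ?_
  refine Real.rpow_le_rpow_of_exponent_ge_of_imp ht.1 ht.2
    (mul_le_mul_of_nonneg_left h1 hp.le) fun _ h0 => ?_
  exact absurd h0 (mul_pos hp hm).ne'

/-! ### From inequalities to operators. -/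

/-- The Müntz polynomial with given coefficients, as a class in `L^P(ρ)`, keeping only the
exponents whose index is at least `M`. -/
noncomputable def tailLp {lam : ℕ → ℝ} {P : ℝ≥0∞} {ρ : Measure ℝ}
    (hmem : ∀ j, MemLp (fun t : ℝ => ((t ^ lam j : ℝ) : ℂ)) P ρ) [Fact (1 ≤ P)] (M : ℕ) :
    (ℕ →₀ ℂ) →ₗ[ℂ] Lp ℂ P ρ :=
  Finsupp.linearCombination ℂ fun j => if M ≤ j then (hmem j).toLp _ else 0

lemma coeFn_sum_smul_toLp {lam : ℕ → ℝ} {P : ℝ≥0∞} {ρ : Measure ℝ}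
    (hmem : ∀ j, MemLp (fun t : ℝ => ((t ^ lam j : ℝ) : ℂ)) P ρ) (S : Finset ℕ) (c : ℕ → ℂ) :
    ((∑ j ∈ S, c j • (hmem j).toLp _ : Lp ℂ P ρ) : ℝ → ℂ) =ᵐ[ρ] powSum S lam c := by
  induction S using Finset.induction_on with
  | empty =>
    refine (Lp.coeFn_zero ℂ P ρ).trans (Filter.EventuallyEq.of_eq ?_)
    funext t
    simp [powSum]
  | insert i S hi ih =>
    rw [Finset.sum_insert hi]
    refine (Lp.coeFn_add _ _).trans ?_
    filter_upwards [Lp.coeFn_smul (c i) ((hmem i).toLp _), (hmem i).coeFn_toLp, ih] with t h1 h2 h3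
    rw [Pi.add_apply, h1, Pi.smul_apply, h2, h3, powSum, powSum, Finset.sum_insert hi, smul_eq_mul]

section

variable {lam : ℕ → ℝ} {P : ℝ≥0∞} {ρ : Measure ℝ} [Fact (1 ≤ P)]
  (hmem : ∀ j, MemLp (fun t : ℝ => ((t ^ lam j : ℝ) : ℂ)) P ρ)

lemma tailLp_eq_sum (M : ℕ) (a : ℕ →₀ ℂ) {K : ℕ} (hK : a.support ⊆ Finset.range K) :
    tailLp hmem M a = ∑ j ∈ Finset.Ico M K, a j • (hmem j).toLp _ := by
  rw [tailLp, Finsupp.linearCombination_apply, Finsupp.sum_of_support_subset a hK _ (by simp)]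
  have : Finset.Ico M K = (Finset.range K).filter (M ≤ ·) := by
    ext j; simp only [Finset.mem_filter, Finset.mem_range, Finset.mem_Ico]; omega
  rw [this, Finset.sum_filter]
  refine Finset.sum_congr rfl fun j _ => ?_
  split_ifs <;> simp

lemma coeFn_tailLp (M : ℕ) (a : ℕ →₀ ℂ) {K : ℕ} (hK : a.support ⊆ Finset.range K) :
    (tailLp hmem M a : ℝ → ℂ) =ᵐ[ρ] powSum (Finset.Ico M K) lam a := by
  rw [tailLp_eq_sum hmem M a hK]
  exact coeFn_sum_smul_toLp hmem _ _

end

lemma exists_support_subset (a : ℕ →₀ ℂ) : ∃ K, a.support ⊆ Finset.range K :=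
  ⟨a.support.sup id + 1, fun _ hj => Finset.mem_range.2 (Nat.lt_succ_of_le
    (Finset.le_sup (f := id) hj))⟩

lemma mem_polynomials_iff {lam : ℕ → ℝ} {f : ℝ → ℂ} :
    f ∈ polynomials lam ↔ ∃ a : ℕ →₀ ℂ, ∀ K, a.support ⊆ Finset.range K →
      f = powSum (Finset.range K) lam a := by
  have key : ∀ (a : ℕ →₀ ℂ) (K : ℕ), a.support ⊆ Finset.range K →
      Finsupp.linearCombination ℂ (fun j : ℕ => fun t : ℝ => ((t ^ lam j : ℝ) : ℂ)) a =
        powSum (Finset.range K) lam a := fun a K hK => by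
    rw [Finsupp.linearCombination_apply, Finsupp.sum_of_support_subset a hK _ (by simp)]
    funext t
    simp [powSum, Finset.sum_apply]
  rw [polynomials, ← Finsupp.range_linearCombination, LinearMap.mem_range]
  constructor
  · rintro ⟨a, rfl⟩
    exact ⟨a, key a⟩
  · rintro ⟨a, ha⟩
    obtain ⟨K, hK⟩ := exists_support_subset a
    exact ⟨a, (key a K hK).trans (ha K hK).symm⟩

lemma enorm_rpow_eq_lintegral {s : ℝ} (hs : 0 < s) {ρ : Measure ℝ}
    (x : Lp ℂ (ENNReal.ofReal s) ρ) {f : ℝ → ℂ} (hx : (x : ℝ → ℂ) =ᵐ[ρ] f) :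
    ‖x‖ₑ ^ s = ∫⁻ t, ‖f t‖ₑ ^ s ∂ρ := by
  rw [Lp.enorm_def, eLpNorm_congr_ae hx, eLpNorm_eq_lintegral_rpow_enorm_toReal
    (by simpa using hs) ENNReal.ofReal_ne_top, ENNReal.toReal_ofReal hs.le, ← ENNReal.rpow_mul,
    one_div_mul_cancel hs.ne', ENNReal.rpow_one]

/-- Continuous extension of a linear map from a dense range; it is compact if, up to maps of finite
rank, the bound can be made arbitrarily small. -/
lemma exists_extension_of_bound {A E F : Type*} [AddCommGroup A] [Module ℂ A]
    [NormedAddCommGroup E] [NormedSpace ℂ E] [NormedAddCommGroup F] [NormedSpace ℂ F]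
    [CompleteSpace F] {e : A →ₗ[ℂ] E} (hdense : DenseRange e) (L : ℕ → A →ₗ[ℂ] F)
    (V : ℕ → Submodule ℂ F) [∀ M, FiniteDimensional ℂ (V M)]
    (hV : ∀ M a, L 0 a - L M a ∈ V M) (hbound : ∃ C : ℝ, ∀ a, ‖L 0 a‖ ≤ C * ‖e a‖) :
    ∃ J : E →L[ℂ] F, (∀ a, J (e a) = L 0 a) ∧
      ((∀ ε : ℝ, 0 < ε → ∃ M, ∀ a, ‖L M a‖ ≤ ε * ‖e a‖) → IsCompactOperator J) := by
  obtain ⟨C, hC⟩ := hbound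
  set J := (L 0).extendOfNorm e with hJ
  have hJe : ∀ a, J (e a) = L 0 a := LinearMap.extendOfNorm_eq hdense ⟨C, hC⟩
  refine ⟨J, hJe, fun htail => ?_⟩
  choose! M hM using htail
  set T : ℕ → E →L[ℂ] F := fun i => (L (M (1 / ((i : ℝ) + 1)))).extendOfNorm e with hT
  have hpos : ∀ i : ℕ, 0 < 1 / ((i : ℝ) + 1) := fun i => by positivity
  have hTe : ∀ i a, T i (e a) = L (M (1 / ((i : ℝ) + 1))) a := fun i =>
    LinearMap.extendOfNorm_eq hdense ⟨_, hM _ (hpos i)⟩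
  have hTn : ∀ i, ‖T i‖ ≤ 1 / ((i : ℝ) + 1) := fun i =>
    ContinuousLinearMap.opNorm_le_bound _ (hpos i).le
      (LinearMap.norm_extendOfNorm_apply_le hdense _ (hM _ (hpos i)))
  have hT0 : Tendsto T atTop (𝓝 0) :=
    squeeze_zero_norm hTn tendsto_one_div_add_atTop_nhds_zero_nat
  have hlim : Tendsto (fun i => J - T i) atTop (𝓝 J) := by
    simpa using tendsto_const_nhds.sub hT0
  refine isCompactOperator_of_tendsto hlim (Filter.Eventually.of_forall fun i => ?_)
  -- On the dense range the values lie in a finite dimensional subspace, which is closed, so all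
  -- values do. Hence J - T i has finite rank, and J is the norm limit of these operators.
  have hVmem : ∀ x, (J - T i) x ∈ V (M (1 / ((i : ℝ) + 1))) := by
    intro x
    refine hdense.induction_on x ?_ fun a => ?_
    · exact (Submodule.closed_of_finiteDimensional _).preimage (J - T i).continuous
    · rw [sub_apply, hJe, hTe]
      exact hV _ a
  have : ProperSpace (V (M (1 / ((i : ℝ) + 1)))) := FiniteDimensional.proper ℂ _
  exact (isCompactOperator_of_locallyCompactSpace_dom
    ((J - T i).codRestrict _ hVmem)).clm_comp (Submodule.subtypeL _)

/-- A norm inequality for Müntz polynomials yields the bounded inclusion operator, and it is compact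
if the inequality improves on polynomials with large exponents. -/
lemma exists_inclusion_of_bound {lam : ℕ → ℝ} {α : ℝ} {s r : ℝ≥0∞} {μ : Measure ℝ}
    [Fact (1 ≤ s)] [Fact (1 ≤ r)]
    (hν : ∀ j, MemLp (fun t : ℝ => ((t ^ lam j : ℝ) : ℂ)) s (nu α))
    (hμ : ∀ j, MemLp (fun t : ℝ => ((t ^ lam j : ℝ) : ℂ)) r μ)
    (hbound : ∃ C : ℝ, ∀ a, ‖tailLp hμ 0 a‖ ≤ C * ‖tailLp hν 0 a‖) :
    ∃ J : space lam α s →L[ℂ] Lp ℂ r μ, IsInclusion lam α s r μ J ∧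
      ((∀ ε : ℝ, 0 < ε → ∃ M, ∀ a, ‖tailLp hμ M a‖ ≤ ε * ‖tailLp hν 0 a‖) →
        IsCompactOperator J) := by
  have hmemc : ∀ a, tailLp hν 0 a ∈ polynomialClasses lam α s := fun a => by
    obtain ⟨K, hK⟩ := exists_support_subset a
    have h := coeFn_tailLp hν 0 a hK
    rw [← Finset.range_eq_Ico] at h
    refine ⟨_, mem_polynomials_iff.2 ⟨a, fun K' hK' => ?_⟩, h⟩
    have hind : ∀ K, a.support ⊆ Finset.range K →
        ∀ t, powSum (Finset.range K) lam a t = powSum a.support lam a t := fun K hK t =>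
      (Finset.sum_subset hK fun j _ hj => by
        rw [Finsupp.notMem_support_iff.1 hj, zero_mul]).symm
    funext t
    rw [hind K hK, hind K' hK']
  set e : (ℕ →₀ ℂ) →ₗ[ℂ] space lam α s :=
    (tailLp hν 0).codRestrict _ fun a => Submodule.le_topologicalClosure _ (hmemc a)
  have hpoly : ∀ f ∈ polynomials lam, ∃ a, ((tailLp hν 0 a : Lp ℂ s (nu α)) : ℝ → ℂ) =ᵐ[nu α] f ∧
      ((tailLp hμ 0 a : Lp ℂ r μ) : ℝ → ℂ) =ᵐ[μ] f := fun f hf => by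
    obtain ⟨a, ha⟩ := mem_polynomials_iff.1 hf
    obtain ⟨K, hK⟩ := exists_support_subset a
    have h1 := coeFn_tailLp hν 0 a hK
    have h2 := coeFn_tailLp hμ 0 a hK
    rw [← Finset.range_eq_Ico, ← ha K hK] at h1 h2
    exact ⟨a, h1, h2⟩
  have hdense : DenseRange e := by
    intro x
    rw [closure_subtype]
    refine closure_mono ?_ x.2
    rintro g ⟨f, hf, hg⟩
    obtain ⟨a, ha, -⟩ := hpoly f hf
    exact ⟨e a, ⟨a, rfl⟩, Lp.ext (ha.trans hg.symm)⟩
  set V : ℕ → Submodule ℂ (Lp ℂ r μ) := fun M => Submodule.span ℂ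
    ((fun j => (hμ j).toLp (fun t : ℝ => ((t ^ lam j : ℝ) : ℂ))) '' (Finset.range M : Set ℕ))
    with hV
  have hfin : ∀ M, FiniteDimensional ℂ (V M) := fun M =>
    FiniteDimensional.span_of_finite ℂ ((Finset.finite_toSet _).image _)
  have hVmem : ∀ M a, tailLp hμ 0 a - tailLp hμ M a ∈ V M := by
    intro M a
    obtain ⟨K, hK⟩ := exists_support_subset a
    have hK' : a.support ⊆ Finset.range (max K M) := fun j hj =>
      Finset.mem_range.2 ((Finset.mem_range.1 (hK hj)).trans_le (le_max_left _ _))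
    rw [tailLp_eq_sum hμ _ a hK', tailLp_eq_sum hμ _ a hK',
      ← Finset.sum_Ico_consecutive _ (Nat.zero_le M) (le_max_right K M), add_sub_cancel_right]
    refine Submodule.sum_mem _ fun j hj => Submodule.smul_mem _ _ (Submodule.subset_span ?_)
    exact ⟨j, by simpa using (Finset.mem_Ico.1 hj).2, rfl⟩
  obtain ⟨J, hJe, hJc⟩ := exists_extension_of_bound hdense (tailLp hμ) V hVmem hbound
  refine ⟨J, fun f hf => ?_, hJc⟩
  obtain ⟨a, ha1, ha2⟩ := hpoly f hf
  exact ⟨e a, ha1, by rw [hJe]; exact ha2⟩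

lemma isFiniteMeasure_nu {α : ℝ} (hα : 0 < α) : IsFiniteMeasure (nu α) := by
  have h1 : IntervalIntegrable (fun x : ℝ => x ^ (α - 1)) volume 0 1 :=
    intervalIntegral.intervalIntegrable_rpow' (by linarith)
  have h2 : IntervalIntegrable (fun x : ℝ => (1 - x) ^ (α - 1)) volume 0 1 := by
    simpa using (h1.comp_sub_left 1).symm
  rw [intervalIntegrable_iff_integrableOn_Icc_of_le zero_le_one] at h2
  exact isFiniteMeasure_withDensity_ofReal h2.2

lemma memLp_nu {lam : ℕ → ℝ} (hlam : ∀ j, 0 < lam j) {α : ℝ} (hα : 0 < α) (s : ℝ≥0∞) (j : ℕ) :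
    MemLp (fun t : ℝ => ((t ^ lam j : ℝ) : ℂ)) s (nu α) := by
  have := isFiniteMeasure_nu hα
  refine MemLp.of_bound (Measurable.aestronglyMeasurable (by fun_prop)) 1 ?_
  refine (withDensity_absolutelyContinuous _ _).ae_le ?_
  refine (ae_restrict_iff' measurableSet_Icc).2 (Filter.Eventually.of_forall fun t ht => ?_)
  rw [Complex.norm_real, Real.norm_of_nonneg (Real.rpow_nonneg ht.1 _)]
  exact Real.rpow_le_one ht.1 ht.2 (hlam j).le

/-- The measure may be infinite near 0, but t^{rλ_j} ≤ t^{pλ_0} on [0,1], so the moment with k = 0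
already puts every monomial in L^r(μ). -/
lemma memLp_of_moment {lam : ℕ → ℝ} {m : ℕ → ℕ} (hlam : ∀ j, 0 < lam j) (hmono : Monotone lam)
    (hm0 : m 0 = 0) {α β p r : ℝ} (hp : 0 < p) (hpr : p ≤ r) {μ : Measure ℝ}
    (hμ : μ (Set.Icc 0 1)ᶜ = 0) (h : moment lam m p α β μ 0 ≠ ∞) (j : ℕ) :
    MemLp (fun t : ℝ => ((t ^ lam j : ℝ) : ℂ)) (ENNReal.ofReal r) μ := by
  have hr : 0 < r := by linarith
  refine ⟨Measurable.aestronglyMeasurable (by fun_prop), ?_⟩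
  rw [eLpNorm_lt_top_iff_lintegral_rpow_enorm_lt_top (by simpa using hr) ENNReal.ofReal_ne_top,
    ENNReal.toReal_ofReal hr.le, ← Measure.restrict_eq_self_of_ae_mem (μ := μ)
    (s := Set.Icc (0 : ℝ) 1) (by rw [ae_iff]; exact hμ)]
  have h1 : ∫⁻ t in Set.Icc (0 : ℝ) 1, ENNReal.ofReal (t ^ (p * lam (m 0))) ∂μ ≠ ∞ := by
    intro htop
    refine h ?_
    rw [moment, htop, ENNReal.mul_top]
    exact (ENNReal.ofReal_pos.2 (Real.rpow_pos_of_pos (hlam _) _)).ne'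
  refine lt_of_le_of_lt (setLIntegral_mono' measurableSet_Icc fun t ht => ?_)
    (lt_top_iff_ne_top.2 h1)
  rw [← ofReal_norm, Complex.norm_real, Real.norm_of_nonneg (Real.rpow_nonneg ht.1 _),
    ENNReal.ofReal_rpow_of_nonneg (Real.rpow_nonneg ht.1 _) hr.le, ← Real.rpow_mul ht.1]
  refine ENNReal.ofReal_le_ofReal ?_
  have h0 : lam (m 0) ≤ lam j := by rw [hm0]; exact hmono (Nat.zero_le j)
  refine Real.rpow_le_rpow_of_exponent_ge_of_imp ht.1 ht.2 ?_ fun _ h2 => ?_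
  · rw [mul_comm (lam j)]
    exact mul_le_mul hpr h0 (hlam _).le hr.le
  · exact absurd h2 (mul_pos (hlam j) hr).ne'

/-- The embedding operator for separated blocks, and its compactness. -/
lemma SeparatedBlocks.exists_inclusion {lam : ℕ → ℝ} {m : ℕ → ℕ} {N : ℕ} {q Q α β r p : ℝ}
    (h : SeparatedBlocks lam m N q Q) (hα : 0 < α) (hβ : 1 ≤ β) (hr : β ≤ r) (hp : 0 < p)
    (hcase : p < r ∨ (r = β ∧ p ≤ β ∧ N = 1)) {μ : Measure ℝ} (hμ : μ (Set.Icc 0 1)ᶜ = 0)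
    {b : ℝ} (hB : ∀ k, moment lam m p α β μ k ≤ ENNReal.ofReal b) :
    Embeds lam α β r μ ∧
      (Tendsto (moment lam m p α β μ) atTop (𝓝 0) → EmbedsCompactly lam α β r μ) := by
  have hβ0 : 0 < β := by linarith
  have hr0 : 0 < r := by linarith
  set s := r / β with hs
  have hs1 : 1 ≤ s := (one_le_div hβ0).2 hr
  have hs0 : 0 < s := by linarith
  have hsβ : s * β = r := div_mul_cancel₀ r hβ0.ne'
  have i1 : Fact (1 ≤ ENNReal.ofReal (r / β)) := ⟨by rw [← hs]; simpa using hs1⟩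
  have i2 : Fact (1 ≤ ENNReal.ofReal r) := ⟨by simpa using hβ.trans hr⟩
  have hpr : p ≤ r := by
    rcases hcase with h | ⟨h1, h2, -⟩
    · exact h.le
    · rw [h1]; exact h2
  have hν := memLp_nu h.pos hα (ENNReal.ofReal (r / β))
  have hμm := memLp_of_moment h.pos h.strictMono.monotone h.index_zero hp hpr hμ
    (ne_top_of_le_ne_top ENNReal.ofReal_ne_top (hB 0))
  obtain ⟨C, hC, H⟩ := h.exists_embedding_bound hα hβ hs1 hp (by
    rw [hsβ]
    refine hcase.imp id fun ⟨h1, h2, h3⟩ => ⟨?_, h2, h3⟩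
    rw [hs, h1, div_self hβ0.ne'])
  have hrestrict : μ.restrict (Set.Icc 0 1) = μ :=
    Measure.restrict_eq_self_of_ae_mem (by rw [ae_iff]; exact hμ)
  have key : ∀ (K₀ : ℕ) (b : ℝ), 0 ≤ b →
      (∀ k, K₀ ≤ k → moment lam m p α β μ k ≤ ENNReal.ofReal b) →
      ∀ a, ‖tailLp hμm (m K₀) a‖ ≤ (C * b) ^ r⁻¹ * ‖tailLp hν 0 a‖ := by
    intro K₀ b hb0 hb a
    obtain ⟨K, hK⟩ := exists_support_subset a
    have hK1 : a.support ⊆ Finset.range (m (max K K₀)) := fun j hj =>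
      Finset.mem_range.2 ((Finset.mem_range.1 (hK hj)).trans_le
        ((le_max_left _ _).trans (h.strictMono_index.id_le _)))
    have h1 := H μ (ENNReal.ofReal b) K₀ hb a (max K K₀) (le_max_right _ _)
    have h2 := enorm_rpow_eq_lintegral hr0 _ (coeFn_tailLp hμm (m K₀) a hK1)
    have h3 := enorm_rpow_eq_lintegral hs0 _ (coeFn_tailLp hν 0 a hK1)
    rw [← Finset.range_eq_Ico] at h3
    rw [hrestrict, hsβ, ← h2, ← h3, ← ENNReal.rpow_mul, hsβ, ← ENNReal.ofReal_mul hC.le] at h1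
    have h4 := ENNReal.rpow_le_rpow h1 (inv_nonneg.2 hr0.le)
    rw [ENNReal.mul_rpow_of_nonneg _ _ (inv_nonneg.2 hr0.le), ← ENNReal.rpow_mul,
      ← ENNReal.rpow_mul, mul_inv_cancel₀ hr0.ne', ENNReal.rpow_one, ENNReal.rpow_one,
      ENNReal.ofReal_rpow_of_nonneg (by positivity) (inv_nonneg.2 hr0.le), ← ofReal_norm,
      ← ofReal_norm, ← ENNReal.ofReal_mul (by positivity)] at h4
    exact (ENNReal.ofReal_le_ofReal_iff (by positivity)).1 h4
  obtain ⟨J, hJ, hJc⟩ := exists_inclusion_of_bound hν hμm ⟨_, fun a => by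
    have := key 0 (max b 0) (le_max_right _ _) (fun k _ =>
      (hB k).trans (ENNReal.ofReal_le_ofReal (le_max_left _ _))) a
    rwa [h.index_zero] at this⟩
  refine ⟨⟨i1, i2, J, hJ⟩, fun htend => ⟨i1, i2, J, hJ, hJc fun ε hε => ?_⟩⟩
  -- The operator bound for moments at most b is (C b)^{1/r}, which equals ε for b = ε^r / C.
  have hb : 0 < ε ^ r / C := by positivity
  obtain ⟨K₀, hK₀⟩ := eventually_atTop.1
    (htend.eventually (ge_mem_nhds (ENNReal.ofReal_pos.2 hb)))
  refine ⟨m K₀, fun a => (key K₀ _ hb.le hK₀ a).trans (le_of_eq ?_)⟩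
  rw [mul_div_cancel₀ _ hC.ne', ← Real.rpow_mul hε.le, mul_inv_cancel₀ hr0.ne', Real.rpow_one]

/-- The embedding and its compactness for quasi-lacunary exponents with comparable blocks: regroup
into separated blocks, whose leading moments are controlled by the given ones. -/
lemma IsQuasiLacunary.embeds {lam : ℕ → ℝ} {n : ℕ → ℕ} {N : ℕ} {q : ℝ}
    (hΛ : IsQuasiLacunary lam n N q) (hblocks : HasComparableBlocks lam n) {α β p r : ℝ}
    (hα : 0 < α) (hβ : 1 ≤ β) (hp : 0 < p) {μ : Measure ℝ} (hμ : μ (Set.Icc 0 1)ᶜ = 0)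
    (hB : ConditionB lam n p α β μ) (hr : β ≤ r)
    (hcase : p < r ∨ (r = β ∧ p ≤ β ∧ N = 1)) :
    Embeds lam α β r μ ∧
      (Tendsto (moment lam n p α β μ) atTop (𝓝 0) → EmbedsCompactly lam α β r μ) := by
  obtain ⟨m, q', Q, Q', hsep, hQ, hcomp⟩ := hΛ.exists_separatedBlocks hblocks
  choose k' hk' hle hge using hcomp
  have hαβ : 0 ≤ α * β := by positivity
  have hmom : ∀ k, moment lam m p α β μ k ≤
      ENNReal.ofReal (Q ^ (α * β)) * moment lam n p α β μ (k' k) := fun k =>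
    moment_le_of_comparable hΛ.pos hp hαβ hQ (hle k) (hge k)
  have hfin : ENNReal.ofReal (Q ^ (α * β)) * (⨆ k, moment lam n p α β μ k) ≠ ∞ :=
    ENNReal.mul_ne_top ENNReal.ofReal_ne_top hB.ne
  obtain ⟨h1, h2⟩ := hsep.exists_inclusion hα hβ hr hp
    (hcase.imp id fun ⟨a, b, c⟩ => ⟨a, b, by omega⟩) hμ
    (b := (ENNReal.ofReal (Q ^ (α * β)) * (⨆ k, moment lam n p α β μ k)).toReal) (fun k => by
      rw [ENNReal.ofReal_toReal hfin]
      exact (hmom k).trans (mul_le_mul_right (le_iSup (moment lam n p α β μ) _) _))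
  refine ⟨h1, fun ht => h2 ?_⟩
  -- The inequality k ≤ k' + 1 transfers the decay of the given moments to those of the regrouped
  -- leaders.
  have hk'tend : Tendsto k' atTop atTop :=
    tendsto_atTop_mono (fun k => Nat.sub_le_of_le_add (hk' k)) (tendsto_sub_atTop_nat 1)
  have h3 : Tendsto (fun k => ENNReal.ofReal (Q ^ (α * β)) * moment lam n p α β μ (k' k)) atTop
      (𝓝 0) := by
    have := ENNReal.Tendsto.const_mul (ht.comp hk'tend)
      (Or.inr (ENNReal.ofReal_ne_top (r := Q ^ (α * β))))
    rwa [mul_zero] at this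
  exact tendsto_of_tendsto_of_tendsto_of_le_of_le tendsto_const_nhds h3 (fun _ => zero_le) hmom

end Muntz

/-! ### The theorem. -/

theorem mainTheorem3 (lam : ℕ → ℝ) (n : ℕ → ℕ) (N : ℕ) (q : ℝ)
    (hΛ : Muntz.IsQuasiLacunary lam n N q) (hblocks : Muntz.HasComparableBlocks lam n)
    (α β p : ℝ) (hα : 0 < α) (hβ : 1 ≤ β) (hp : 0 < p)
    (μ : Measure ℝ) (hμ : μ (Set.Icc 0 1)ᶜ = 0)
    (hB : Muntz.ConditionB lam n p α β μ) :
    (p * N ≤ β → ∀ r : ℝ, β ≤ r → Muntz.Embeds lam α β r μ) ∧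
    (β < p * N → ∀ r : ℝ, p * N < r → Muntz.Embeds lam α β r μ) ∧
    (Tendsto (Muntz.moment lam n p α β μ) atTop (𝓝 0) →
      (p * N ≤ β → ∀ r : ℝ, β ≤ r → Muntz.EmbedsCompactly lam α β r μ) ∧
      (β < p * N → ∀ r : ℝ, p * N < r → Muntz.EmbedsCompactly lam α β r μ)) := by
  have hN : 1 ≤ N := by
    have h1 := hΛ.block_card 0
    have h2 := hΛ.strictMono_index (Nat.lt_succ_self 0)
    rw [Nat.succ_eq_add_one] at h2
    omega
  have hN' : (1 : ℝ) ≤ N := by exact_mod_cast hN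
  have hpN : p ≤ p * N := le_mul_of_one_le_right hp.le hN'
  -- For N ≥ 2 the inequality pN ≤ β forces p < β ≤ r. Only N = 1 with r = β can give p = r, and
  -- this is the endpoint case with single monomials.
  have case1 : p * N ≤ β → ∀ r : ℝ, β ≤ r → p < r ∨ (r = β ∧ p ≤ β ∧ N = 1) := by
    intro h r hr
    rcases hN.eq_or_lt with h1 | h1
    · rcases hr.eq_or_lt with h2 | h2
      · exact Or.inr ⟨h2.symm, hpN.trans h, h1.symm⟩
      · exact Or.inl ((hpN.trans h).trans_lt h2)
    · have : (1 : ℝ) < N := by exact_mod_cast h1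
      exact Or.inl (((lt_mul_of_one_lt_right hp this).trans_le h).trans_le hr)
  have key := fun r h1 h2 =>
    hΛ.embeds (r := r) hblocks hα hβ hp hμ hB h1 h2
  exact ⟨fun h r hr => (key r hr (case1 h r hr)).1,
    fun h r hr => (key r (h.trans hr).le (Or.inl (hpN.trans_lt hr))).1,
    fun ht => ⟨fun h r hr => (key r hr (case1 h r hr)).2 ht,
      fun h r hr => (key r (h.trans hr).le (Or.inl (hpN.trans_lt hr))).2 ht⟩⟩
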